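/- Let $(\alpha_y)_{y\in\mathbb Z}$ be real, even, with $|\alpha_y|\le Ce^{-|y|/C}$ for some $C>0$, and such that $\hat\alpha(k)=\sum_y\alpha_ye^{-2\pi iky}>0$ for $k\in\mathbb T\setminus\{0\}$, $\mathbb T=\mathbb R/\mathbb Z$ (with period cell $[-1/2,1/2]$). Assume that the dispersion relation $\omega=\sqrt{\hat\alpha}$ is continuous on $\mathbb T$, is $C^2$ on $\mathbb T\setminus\{0\}$ with one-sided limits of $\omega',\omega''$ at $0$, and is strictly increasing on $[0,1/2]$. If $\omega$ is not differentiable at $0$, put $\omega'(0):=0$ (the symmetric derivative). For $\gamma>0$ set $$J(t)=\int_{\mathbb T}\cos(\omega(k)t)\,dk,\qquad \tilde J(\lambda)=\int_0^\infty e^{-\lambda t}J(t)\,dt,\qquad \tilde g(\lambda)=\frac1{1+\gamma\tilde J(\lambda)}\quad(\mathrm{Re}\,\lambda>0),$$ $$\nu(k)=\lim_{\varepsilon\to0+}\tilde g(\varepsilon+i\omega(k)),\qquad \Gamma=\frac{\gamma}{2\pi}\int_{\mathbb R}|(\tilde J\tilde g)(i\beta)|^2d\beta,\qquad (\tilde J\tilde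 g)(i\beta)=\lim_{\varepsilon\to0+}(\tilde J\tilde g)(\varepsilon+i\beta).$$ Then the limit $(\tilde J\tilde g)(i\beta)$ exists for almost every $\beta$ and is square integrable, the limit $\nu(k)$ exists for every $k\in\mathbb T$, and $\Gamma\in(0,1/2]$. Moreover, let $\mu>1/2$, $T>0$, let $N$ be a Poisson process of intensity $1$ and $(\tilde p_j)_{j\ge0}$ i.i.d. $\mathcal N(0,T)$ random variables independent of $N$, let $\tilde p(t)=\frac{\sqrt{2\mu-1}}{\mu}\,\tilde p_{N(\gamma\mu t)+1}$, and let $\hat\psi(t,k)$ be a solution with null initial data of $$d\hat\psi(t,k)=-i\omega(k)\hat\psi(t,k)\,dt+i\Big(\tilde p(t-)-\frac1\mu\mathfrak p_0(t-)\Big)dN(\gamma\mu t),\quad \hat\psi(0,k)\equiv0,\qquad \mathfrak p_0(t)=\int_{\mathbb T}\mathrm{Im}\,\hat\psi(t,k)\,dk.$$ For $\varepsilon>0$ put $$\widehat W_\varepsilon(t,\eta,k)=\frac\varepsilon2\,\mathbb E\Big[\hat\psi^*\Big(\frac t\varepsilon,k-\frac{\varepsilon\eta}2\Big)\hat\psi\Big(\frac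 t\varepsilon,k+\frac{\varepsilon\eta}2\Big)\Big],\qquad \widehat w_\varepsilon(\lambda,\eta,k)=\int_0^\infty e^{-\lambda t}\,\widehat W_\varepsilon(t,\eta,k)\,dt .$$ Then for all $\lambda\in\mathbb C$ with $\mathrm{Re}\,\lambda>0$ and all $(\eta,k)\in\mathbb R\times\mathbb T$ this expectation and this integral converge absolutely, and $$\lim_{\varepsilon\to0+}\widehat w_\varepsilon(\lambda,\eta,k)=\frac{\gamma T|\nu(k)|^2}{(1-\Gamma/\mu)\,\lambda\,(\lambda+i\omega'(k)\eta)}\Big(1-\frac1{2\mu}\Big).$$ -/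

import Mathlib

open MeasureTheory ProbabilityTheory Filter Topology Set
open scoped NNReal

noncomputable section

namespace HarmonicChain

/-! Functions on the torus `𝕋 = ℝ/ℤ` are written as `1`-periodic functions on `ℝ`, and `∫_𝕋` as
the integral over the fundamental period `[-1/2, 1/2]`. -/

/-- The Fourier transform `α̂(k) = ∑_y α_y exp(-2πiky)`. -/
def alphaHat (α : ℤ → ℝ) (k : ℝ) : ℂ :=
  ∑' y : ℤ, (α y : ℂ) * Complex.exp (-(2 * Real.pi * k * y : ℝ) * Complex.I)

/-- The dispersion relation `ω(k) = √(α̂(k))` (`α̂` is real for even `α`). -/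
def disp (α : ℤ → ℝ) (k : ℝ) : ℝ := Real.sqrt (alphaHat α k).re

/-- The derivative `ω'(k)`. Where `ω` is differentiable this is the derivative. The only other
points are the integers for an acoustic chain (where `ω` has a kink); there `deriv` is `0`, which
is the value of the symmetric derivative of the even function `ω`. -/
def dispDeriv (α : ℤ → ℝ) (k : ℝ) : ℝ := deriv (disp α) k

/-- The assumptions on the coupling coefficients and on the dispersion relation. -/
structure AdmissibleCoupling (α : ℤ → ℝ) : Prop where
  even : ∀ y, α (-y) = α y
  decay : ∃ C : ℝ, 0 < C ∧ ∀ y : ℤ, |α y| ≤ C * Real.exp (-|(y : ℝ)| / C)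
  pos : ∀ k : ℝ, (∀ m : ℤ, k ≠ m) → 0 < (alphaHat α k).re
  continuous : Continuous (disp α)
  contDiffOn : ContDiffOn ℝ 2 (disp α) (Ioo 0 1)
  deriv_right : ∃ l : ℝ, Tendsto (deriv (disp α)) (𝓝[>] 0) (𝓝 l)
  deriv_left : ∃ l : ℝ, Tendsto (deriv (disp α)) (𝓝[<] 0) (𝓝 l)
  deriv2_right : ∃ l : ℝ, Tendsto (deriv (deriv (disp α))) (𝓝[>] 0) (𝓝 l)
  deriv2_left : ∃ l : ℝ, Tendsto (deriv (deriv (disp α))) (𝓝[<] 0) (𝓝 l)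
  unimodal : StrictMonoOn (disp α) (Icc 0 (1 / 2))

/-- `J(t) = ∫_𝕋 cos(ω(k) t) dk`. -/
def J (α : ℤ → ℝ) (t : ℝ) : ℝ := ∫ k in (-1 / 2 : ℝ)..(1 / 2), Real.cos (disp α k * t)

/-- The Laplace transform `J̃(z) = ∫_0^∞ e^{-zt} J(t) dt`, used for `Re z > 0`. -/
def Jt (α : ℤ → ℝ) (z : ℂ) : ℂ :=
  ∫ t in Ioi (0 : ℝ), Complex.exp (-z * t) * (J α t : ℂ)

/-- `g̃(z) = (1 + γ J̃(z))⁻¹`. -/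
def gt (α : ℤ → ℝ) (γ : ℝ) (z : ℂ) : ℂ := (1 + (γ : ℂ) * Jt α z)⁻¹

/-- The boundary value `lim_{ε → 0+} f(ε + iβ)` of a function on the right half-plane. -/
def bdry (f : ℂ → ℂ) (β : ℝ) : ℂ :=
  limUnder (𝓝[>] (0 : ℝ)) (fun ε : ℝ => f ((ε : ℂ) + Complex.I * (β : ℂ)))

/-- `f` has a boundary value at `iβ`. -/
def HasBdry (f : ℂ → ℂ) (β : ℝ) : Prop :=
  ∃ c : ℂ, Tendsto (fun ε : ℝ => f ((ε : ℂ) + Complex.I * (β : ℂ))) (𝓝[>] (0 : ℝ)) (𝓝 c)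

/-- `ν(k) = lim_{ε → 0+} g̃(ε + iω(k))`. -/
def nu (α : ℤ → ℝ) (γ : ℝ) (k : ℝ) : ℂ := bdry (gt α γ) (disp α k)

/-- The function `J̃ g̃`. -/
def Jgt (α : ℤ → ℝ) (γ : ℝ) (z : ℂ) : ℂ := Jt α z * gt α γ z

/-- `Γ = (γ / 2π) ∫_ℝ |(J̃ g̃)(iβ)|² dβ`. -/
def Gam (α : ℤ → ℝ) (γ : ℝ) : ℝ :=
  γ / (2 * Real.pi) * ∫ β : ℝ, ‖bdry (Jgt α γ) β‖ ^ 2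

/-- `N` is a Poisson process of intensity `1`. -/
structure IsPoissonProcess {Ω : Type*} [MeasurableSpace Ω] (P : Measure Ω)
    (N : ℝ≥0 → Ω → ℕ) : Prop where
  measurable : ∀ t, Measurable (N t)
  paths : ∀ᵐ w ∂P, N 0 w = 0 ∧ Monotone (fun t => N t w) ∧
    ∀ t, ContinuousWithinAt (fun s => N s w) (Ici t) t
  indep : HasIndepIncrements N P
  law : ∀ s t : ℝ≥0, s ≤ t → HasLaw (fun w => N t w - N s w) (poissonMeasure (t - s)) P

/-- `(p̃_j)` are i.i.d. centred Gaussian random variables with variance `T`. -/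
structure IsGaussianSeq {Ω : Type*} [MeasurableSpace Ω] (P : Measure Ω) (T : ℝ)
    (p : ℕ → Ω → ℝ) : Prop where
  measurable : ∀ j, Measurable (p j)
  indep : iIndepFun p P
  law : ∀ j, HasLaw (p j) (gaussianReal 0 T.toNNReal) P

/-- `ρ(μ) = √(2μ - 1) / μ`. -/
def rho (μ : ℝ) : ℝ := Real.sqrt (2 * μ - 1) / μ

/-- The path `t ↦ N(γμt)` of the clock of the thermostat. -/
def clock {Ω : Type*} (N : ℝ≥0 → Ω → ℕ) (γ μ : ℝ) (w : Ω) (t : ℝ≥0) : ℕ :=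
  N ((γ * μ).toNNReal * t) w

/-- The thermostat variable `p̃(t) = ρ(μ) p̃_{N(γμt) + 1}`. -/
def thermo {Ω : Type*} (N : ℝ≥0 → Ω → ℕ) (p : ℕ → Ω → ℝ) (γ μ : ℝ) (w : Ω) (t : ℝ≥0) : ℝ :=
  rho μ * p (clock N γ μ w t + 1) w

/-- The integral `∫_{(0,t]} F(s-) dn(s)` with respect to a counting path `n`: the sum of `F(s-)`
over the jump times `s ∈ (0,t]` of `n`, weighted by the sizes `n(s) - n(s-)` of the jumps. -/
def jumpIntegral (n : ℝ≥0 → ℕ) (F : ℝ≥0 → ℝ) (t : ℝ≥0) : ℝ :=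
  ∑ᶠ s ∈ Ioc 0 t, ((n s : ℝ) - Function.leftLim (fun r => (n r : ℝ)) s) * Function.leftLim F s

/-- The momentum `𝔭₀ = ∫_𝕋 Im ψ̂(k) dk` of the particle with label `0`. -/
def momentum (ψ : ℝ → ℂ) : ℝ := ∫ k in (-1 / 2 : ℝ)..(1 / 2), (ψ k).im

/-- `ψ̂(t,k)` (written `ψ t w k` at the sample point `w`) is a solution, with initial datum
`ψ₀`, of the stochastic differential equation
`dψ̂(t,k) = -iω(k) ψ̂(t,k) dt + i (p̃(t-) - 𝔭₀(t-)/μ) dN(γμt)`, `ψ̂(0,k) = ψ₀(k)`. -/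
def IsWaveFunction {Ω : Type*} [MeasurableSpace Ω] (P : Measure Ω) (α : ℤ → ℝ) (γ μ : ℝ)
    (N : ℝ≥0 → Ω → ℕ) (p : ℕ → Ω → ℝ) (ψ₀ : Ω → ℝ → ℂ) (ψ : ℝ≥0 → Ω → ℝ → ℂ) : Prop :=
  ∀ᵐ w ∂P, ∀ t : ℝ≥0,
    IntervalIntegrable (ψ t w) volume (-1 / 2) (1 / 2) ∧
    ∀ k : ℝ,
      IntervalIntegrable (fun s : ℝ => ψ s.toNNReal w k) volume 0 t ∧
      ψ t w k = ψ₀ w k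
        - Complex.I * (disp α k : ℂ) * (∫ s in (0 : ℝ)..t, ψ s.toNNReal w k)
        + Complex.I * (jumpIntegral (clock N γ μ w)
            (fun s => thermo N p γ μ w s - momentum (ψ s w) / μ) t : ℂ)

/-- The product `ψ̂*(t/ε, k - εη/2) ψ̂(t/ε, k + εη/2)`. -/
def wignerProd {Ω : Type*} (ψ : ℝ≥0 → Ω → ℝ → ℂ) (ε t η k : ℝ) (w : Ω) : ℂ :=
  starRingEnd ℂ (ψ (t / ε).toNNReal w (k - ε * η / 2)) * ψ (t / ε).toNNReal w (k + ε * η / 2)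

/-- The averaged Fourier-Wigner function
`Ŵ_ε(t,η,k) = (ε/2) 𝔼[ψ̂*(t/ε, k - εη/2) ψ̂(t/ε, k + εη/2)]`, `t ≥ 0`. -/
def fourierWigner {Ω : Type*} [MeasurableSpace Ω] (P : Measure Ω) (ψ : ℝ≥0 → Ω → ℝ → ℂ)
    (ε t η k : ℝ) : ℂ :=
  (ε / 2 : ℂ) * ∫ w, wignerProd ψ ε t η k w ∂P

/-- The Laplace-Fourier-Wigner function `ŵ_ε(z,η,k) = ∫_0^∞ e^{-zt} Ŵ_ε(t,η,k) dt`. -/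
def laplaceWigner {Ω : Type*} [MeasurableSpace Ω] (P : Measure Ω) (ψ : ℝ≥0 → Ω → ℝ → ℂ)
    (ε : ℝ) (z : ℂ) (η k : ℝ) : ℂ :=
  ∫ t in Ioi (0 : ℝ), Complex.exp (-z * t) * fourierWigner P ψ ε t η k

end HarmonicChain

end

/-! Jumps occur at rate γμ and each one kicks the wave by i(p̃ − 𝔭₀/μ). On average this is the
friction −iγ𝔭₀, and the remaining noise M has orthogonal increments. Hence ψ̂ is the stochastic
convolution of M with the propagator `resp` of the chain damped at one site, and 𝔭₀ is that of M
with the response h, where h = J − γ J∗h. Pathwise this is pure algebra on a finite sum of kicked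
free waves (`shot_eq_driven`).

The variance rate of M is γA with A = (2 − 1/μ)T + 𝔼𝔭₀²/μ. The Itô isometry
(`integral_conj_clockDriven_mul`) gives 𝔼𝔭₀² = γ h²∗A and 𝔼[ψ̂*ψ̂] = γ (resp* resp)∗A. Laplace
transformation turns the second relation into ŵ_ε = (γ/2) · εÃ(ελ) · ε(resp* resp)~(ελ), and the two
factors converge separately.

First factor: A solves the renewal equation A = (2 − 1/μ)T + (γ/μ) h²∗A, so λ·εÃ(ελ) tends to (2 −
1/μ)T/(1 − γ∫h²/μ). Since the Laplace transform of h is J̃g̃, Plancherel identifies γ∫h² with Γ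
(`bdry_Jgt_sq`). The energy balance of the damped chain gives Γ ≤ 1/2 < μ.

Second factor: the Laplace transform of resp is i g̃(z)/(z + iω(k)). In the time-averaged L² sense
resp is asymptotically a free wave whose amplitude is the boundary value of g̃ at −iω(k), of modulus
|ν(k)| (`tendsto_waveError`). Two such waves at k ± εη/2 beat at frequency about εω'(k)η, which
produces |ν|²/(λ + iω'η).

This rests on `hasConeLimit`: g̃ has a nontangential limit at every iβ. Here J̃ is a Cauchy integral
over the values of the odd extension of ω. Off the range of that extension it is regular; at a
noncritical value it is compared with an affine density, integrated by a logarithm; at a critical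
value, where the contact is quadratic, Re J̃ → ∞ and g̃ → 0. -/

open MeasureTheory ProbabilityTheory Filter Topology Set
open scoped NNReal

noncomputable section

namespace HarmonicChain

/-! ### Plancherel identity for the Laplace transform on vertical lines -/

section Plancherel

open scoped FourierTransform SchwartzMap ContDiff

/-- The Fourier integral of an integrable square-integrable function is its `L²` transform. -/
theorem fourier_toLp_ae_eq {f : ℝ → ℂ} (h1 : Integrable f) (h2 : MemLp f 2) :
    ((𝓕 (h2.toLp f) : Lp ℂ 2 (volume : Measure ℝ)) : ℝ → ℂ) =ᵐ[volume] 𝓕 f := by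
  -- Both sides are compared as distributions: against a test function, the L² transform moves onto
  -- the test function by definition, and the Fourier integral does so by Fubini.
  apply ae_eq_of_integral_contDiff_smul_eq
  · exact (Lp.memLp _).locallyIntegrable (by norm_num)
  · exact (VectorFourier.fourierIntegral_continuous Real.continuous_fourierChar
      (innerSL ℝ).continuous₂ h1).locallyIntegrable
  · intro g g_smooth g_cpt
    have hg₁ : HasCompactSupport (Complex.ofRealCLM ∘ g) := g_cpt.comp_left rfl
    have hg₂ : ContDiff ℝ ∞ (Complex.ofRealCLM ∘ g) := by fun_prop
    let G : 𝓢(ℝ, ℂ) := hg₁.toSchwartzMap hg₂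
    have hG : ∀ x, G x = (g x : ℂ) := fun x => rfl
    have e1 := congrArg (fun D : 𝓢'(ℝ, ℂ) => D G)
      (Lp.fourier_toTemperedDistribution_eq (h2.toLp f))
    simp only [TemperedDistribution.fourier_apply, Lp.toTemperedDistribution_apply] at e1
    have e2 : ∫ x, (𝓕 G) x • (h2.toLp f) x = ∫ x, (𝓕 G) x • f x := by
      apply integral_congr_ae
      filter_upwards [h2.coeFn_toLp] with x hx
      rw [hx]
    have e3 : ∫ ξ, (𝓕 G) ξ • f ξ = ∫ x, G x • (𝓕 f) x := by
      have := VectorFourier.integral_fourierIntegral_smul_eq_flip (μ := volume) (ν := volume)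
        (L := innerₗ ℝ) (f := G) (g := f) Real.continuous_fourierChar
        continuous_inner G.integrable h1
      rw [flip_innerₗ] at this
      exact this
    rw [e2, e3] at e1
    simpa [hG] using e1.symm

theorem integral_norm_sq_fourier_of_memLp {f : ℝ → ℂ} (h1 : Integrable f) (h2 : MemLp f 2) :
    MemLp (𝓕 f) 2 ∧ ∫ ξ, ‖(𝓕 f) ξ‖ ^ 2 = ∫ x, ‖f x‖ ^ 2 := by
  have hae := fourier_toLp_ae_eq h1 h2
  have key : ∀ F : Lp ℂ 2 (volume : Measure ℝ), ∫ x, ‖F x‖ ^ 2 = ‖F‖ ^ 2 := by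
    intro F
    have h := MeasureTheory.L2.integral_inner_eq_sq_eLpNorm (𝕜 := ℂ) F
    have h3 := @inner_self_eq_norm_sq_to_K ℂ _ _ _ _ F
    rw [MeasureTheory.L2.inner_def] at h3
    simp only [inner_self_eq_norm_sq_to_K] at h3
    have : ∫ x, ((‖F x‖ : ℂ)) ^ 2 = ((∫ x, ‖F x‖ ^ 2 : ℝ) : ℂ) := by
      rw [← integral_complex_ofReal]; simp
    simp only [Complex.coe_algebraMap] at h3
    rw [this] at h3
    exact_mod_cast h3
  refine ⟨(memLp_congr_ae hae).1 (Lp.memLp _), ?_⟩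
  have e1 : ∫ ξ, ‖(𝓕 f) ξ‖ ^ 2 = ∫ ξ, ‖(𝓕 (h2.toLp f) : Lp ℂ 2 (volume : Measure ℝ)) ξ‖ ^ 2 := by
    apply integral_congr_ae
    filter_upwards [hae] with x hx
    rw [hx]
  have e2 : ∫ x, ‖f x‖ ^ 2 = ∫ x, ‖(h2.toLp f) x‖ ^ 2 := by
    apply integral_congr_ae
    filter_upwards [h2.coeFn_toLp] with x hx
    rw [hx]
  rw [e1, e2, key, key, Lp.norm_fourier_eq]

/-- The Plancherel identity for the Laplace transform on the imaginary axis. -/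
theorem plancherel_laplace {f : ℝ → ℂ} (h1 : IntegrableOn f (Ioi 0))
    (h2 : IntegrableOn (fun t => ‖f t‖ ^ 2) (Ioi 0)) :
    Integrable (fun β : ℝ => ‖∫ t in Ioi (0 : ℝ), Complex.exp (-(Complex.I * β) * t) * f t‖ ^ 2) ∧
    ∫ β : ℝ, ‖∫ t in Ioi (0 : ℝ), Complex.exp (-(Complex.I * β) * t) * f t‖ ^ 2 =
      2 * Real.pi * ∫ t in Ioi (0 : ℝ), ‖f t‖ ^ 2 := by
  set F : ℝ → ℂ := (Ioi (0 : ℝ)).indicator f with hF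
  have hF1 : Integrable F := (integrable_indicator_iff measurableSet_Ioi).2 h1
  have hsq : (fun t => ‖F t‖ ^ 2) = (Ioi (0 : ℝ)).indicator (fun t => ‖f t‖ ^ 2) := by
    ext t; by_cases ht : t ∈ Ioi (0 : ℝ) <;> simp [hF, ht]
  have hF2 : MemLp F 2 := by
    rw [memLp_two_iff_integrable_sq_norm hF1.aestronglyMeasurable, hsq]
    exact (integrable_indicator_iff measurableSet_Ioi).2 h2
  obtain ⟨m, e⟩ := integral_norm_sq_fourier_of_memLp hF1 hF2
  have hm := (memLp_two_iff_integrable_sq_norm m.1).1 m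
  -- The Fourier transform is normalised with e^{−2πixξ}, so ξ = β/2π; the Jacobian of this change
  -- is the factor 2π of the result.
  have hL : ∀ β : ℝ, ∫ t in Ioi (0 : ℝ), Complex.exp (-(Complex.I * β) * t) * f t =
      (𝓕 F) ((2 * Real.pi)⁻¹ * β) := by
    intro β
    rw [Real.fourier_real_eq_integral_exp_smul, ← integral_indicator measurableSet_Ioi]
    congr 1 with t
    by_cases ht : t ∈ Ioi (0 : ℝ)
    · simp only [ht, indicator_of_mem, hF, smul_eq_mul]
      congr 2
      push_cast
      field_simp
    · simp [hF, ht]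
  simp_rw [hL]
  have hpi : (2 * Real.pi)⁻¹ ≠ 0 := by positivity
  refine ⟨(integrable_comp_mul_left_iff (fun x => ‖(𝓕 F) x‖ ^ 2) hpi).2 hm, ?_⟩
  refine (Measure.integral_comp_mul_left (fun x => ‖(𝓕 F) x‖ ^ 2) _).trans ?_
  rw [e, hsq, integral_indicator measurableSet_Ioi, inv_inv, abs_of_pos (by positivity),
    smul_eq_mul]

end Plancherel


/-! ### Regularity of the dispersion relation -/

section Dispersion

variable {α : ℤ → ℝ}

theorem disp_nonneg (α : ℤ → ℝ) (k : ℝ) : 0 ≤ disp α k := Real.sqrt_nonneg _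

theorem disp_neg (hα : AdmissibleCoupling α) (k : ℝ) : disp α (-k) = disp α k := by
  have : alphaHat α (-k) = alphaHat α k := by
    unfold alphaHat
    rw [← (Equiv.neg ℤ).tsum_eq]
    congr 1 with y
    simp only [Equiv.neg_apply, hα.even]
    push_cast
    ring_nf
  rw [disp, disp, this]

theorem disp_add_one (α : ℤ → ℝ) (k : ℝ) : disp α (k + 1) = disp α k := by
  have : alphaHat α (k + 1) = alphaHat α k := by
    unfold alphaHat
    congr 1 with y
    congr 1
    rw [Complex.exp_eq_exp_iff_exists_int]
    refine ⟨-y, ?_⟩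
    push_cast
    ring
  rw [disp, disp, this]

theorem disp_periodic (α : ℤ → ℝ) : Function.Periodic (disp α) 1 := disp_add_one α

theorem disp_add_int (α : ℤ → ℝ) (k : ℝ) (m : ℤ) : disp α (k + m) = disp α k := by
  simpa using (disp_periodic α).int_mul m k

theorem disp_one_sub (hα : AdmissibleCoupling α) (k : ℝ) : disp α (1 - k) = disp α k := by
  rw [← disp_neg hα k, ← disp_add_one α (-k)]
  ring_nf

theorem exists_disp_eq_of_mem (hα : AdmissibleCoupling α) (k : ℝ) :
    ∃ k' ∈ Icc (0 : ℝ) (1 / 2), disp α k = disp α k' := by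
  have h0 : disp α k = disp α (Int.fract k) := by
    conv_lhs => rw [← Int.fract_add_floor k]
    exact disp_add_int α _ _
  rcases le_or_gt (Int.fract k) (1 / 2) with h | h
  · exact ⟨_, ⟨Int.fract_nonneg k, h⟩, h0⟩
  · refine ⟨1 - Int.fract k, ⟨?_, ?_⟩, ?_⟩
    · linarith [Int.fract_lt_one k]
    · linarith
    · rw [disp_one_sub hα, h0]

theorem disp_le_half (hα : AdmissibleCoupling α) (k : ℝ) : disp α k ≤ disp α (1 / 2) := by
  obtain ⟨k', hk', e⟩ := exists_disp_eq_of_mem hα k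
  rw [e]
  exact hα.unimodal.monotoneOn hk' ⟨by norm_num, le_rfl⟩ hk'.2

theorem summable_sq_mul_abs_coupling (hα : AdmissibleCoupling α) :
    Summable (fun y : ℤ => (y : ℝ) ^ 2 * |α y|) := by
  obtain ⟨C, hC, hb⟩ := hα.decay
  have hn : Summable (fun n : ℕ => C * ((n : ℝ) ^ 2 * Real.exp (-(1 / C) * n))) :=
    (Real.summable_pow_mul_exp_neg_nat_mul 2 (by positivity)).mul_left C
  have hz : Summable (fun y : ℤ => C * ((y : ℝ) ^ 2 * Real.exp (-(1 / C) * |(y : ℝ)|))) := by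
    apply Summable.of_nat_of_neg <;> simpa using hn
  refine hz.of_nonneg_of_le (fun y => by positivity) (fun y => ?_)
  calc (y : ℝ) ^ 2 * |α y| ≤ (y : ℝ) ^ 2 * (C * Real.exp (-|(y : ℝ)| / C)) := by
        gcongr; exact hb y
    _ = _ := by rw [show -|(y : ℝ)| / C = -(1 / C) * |(y : ℝ)| by ring]; ring

theorem summable_abs_coupling (hα : AdmissibleCoupling α) : Summable (fun y : ℤ => |α y|) := by
  obtain ⟨C, hC, hb⟩ := hα.decay
  have hn : Summable (fun n : ℕ => C * ((n : ℝ) ^ 0 * Real.exp (-(1 / C) * n))) :=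
    (Real.summable_pow_mul_exp_neg_nat_mul 0 (by positivity)).mul_left C
  have hz : Summable (fun y : ℤ => C * ((y : ℝ) ^ 0 * Real.exp (-(1 / C) * |(y : ℝ)|))) := by
    apply Summable.of_nat_of_neg <;> simpa using hn
  refine hz.of_nonneg_of_le (fun y => by positivity) (fun y => ?_)
  calc |α y| ≤ C * Real.exp (-|(y : ℝ)| / C) := hb y
    _ = _ := by rw [show -|(y : ℝ)| / C = -(1 / C) * |(y : ℝ)| by ring]; ring

theorem re_alphaHat (hα : AdmissibleCoupling α) (k : ℝ) :
    (alphaHat α k).re = ∑' y : ℤ, α y * Real.cos (2 * Real.pi * k * y) := by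
  have hs : Summable (fun y : ℤ =>
      (α y : ℂ) * Complex.exp (-(2 * Real.pi * k * y : ℝ) * Complex.I)) := by
    apply Summable.of_norm
    refine (summable_abs_coupling hα).congr (fun y => ?_)
    rw [norm_mul, ← Complex.ofReal_neg, Complex.norm_exp_ofReal_mul_I]
    simp
  rw [alphaHat, Complex.re_tsum hs]
  congr 1 with y
  rw [Complex.re_ofReal_mul, ← Complex.ofReal_neg, Complex.exp_ofReal_mul_I_re, Real.cos_neg]

theorem summable_coupling_mul_cos (hα : AdmissibleCoupling α) (k : ℝ) :
    Summable (fun y : ℤ => α y * Real.cos (2 * Real.pi * k * y)) := by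
  apply Summable.of_norm
  refine (summable_abs_coupling hα).of_nonneg_of_le (fun y => norm_nonneg _) (fun y => ?_)
  rw [norm_mul, Real.norm_eq_abs, Real.norm_eq_abs]
  exact mul_le_of_le_one_right (abs_nonneg _) (Real.abs_cos_le_one _)

/-- The symbol has a quadratic contact with its value at the origin. -/
theorem exists_abs_re_alphaHat_sub_le (hα : AdmissibleCoupling α) :
    ∃ C : ℝ, ∀ k : ℝ, |(alphaHat α k).re - (alphaHat α 0).re| ≤ C * k ^ 2 := by
  refine ⟨∑' y : ℤ, 2 * Real.pi ^ 2 * ((y : ℝ) ^ 2 * |α y|), fun k => ?_⟩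
  rw [re_alphaHat hα, re_alphaHat hα, ← Summable.tsum_sub (summable_coupling_mul_cos hα k)
    (summable_coupling_mul_cos hα 0), ← tsum_mul_right, ← Real.norm_eq_abs]
  have hs := ((summable_sq_mul_abs_coupling hα).mul_left (2 * Real.pi ^ 2)).mul_right (k ^ 2)
  refine tsum_of_norm_bounded hs.hasSum (fun y => ?_)
  rw [mul_zero, zero_mul, Real.cos_zero, ← mul_sub, norm_mul, Real.norm_eq_abs, Real.norm_eq_abs]
  have h1 : |Real.cos (2 * Real.pi * k * y) - 1| ≤ (2 * Real.pi * k * y) ^ 2 / 2 := by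
    rw [abs_sub_comm, abs_of_nonneg (by linarith [Real.cos_le_one (2 * Real.pi * k * y)])]
    linarith [Real.one_sub_sq_div_two_le_cos (x := 2 * Real.pi * k * y)]
  calc |α y| * |Real.cos (2 * Real.pi * k * y) - 1|
      ≤ |α y| * ((2 * Real.pi * k * y) ^ 2 / 2) := by gcongr
    _ = _ := by ring

theorem re_alphaHat_nonneg (hα : AdmissibleCoupling α) (k : ℝ) (hk : ∀ m : ℤ, k ≠ m) :
    disp α k ^ 2 = (alphaHat α k).re := Real.sq_sqrt (hα.pos k hk).le

/-- A gapped dispersion relation has a quadratic contact at the origin. -/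
theorem exists_disp_sub_le_of_gap (hα : AdmissibleCoupling α) (h0 : 0 < disp α 0) :
    ∃ C : ℝ, ∀ k ∈ Icc (0 : ℝ) (1 / 2), |disp α k - disp α 0| ≤ C * |k - 0| ^ 2 := by
  obtain ⟨C, hC⟩ := exists_abs_re_alphaHat_sub_le hα
  have hsq0 : disp α 0 ^ 2 = (alphaHat α 0).re := Real.sq_sqrt (Real.sqrt_pos.1 h0).le
  refine ⟨C / disp α 0, fun k hk => ?_⟩
  rcases hk.1.eq_or_lt with rfl | hpos
  · simp
  have hsq : disp α k ^ 2 = (alphaHat α k).re := by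
    apply re_alphaHat_nonneg hα
    intro m hm
    have h1 : (0 : ℝ) < m := hm ▸ hpos
    have h2 : (m : ℝ) ≤ 1 / 2 := hm ▸ hk.2
    have h3 : (0 : ℤ) < m := by exact_mod_cast h1
    have h4 : (1 : ℝ) ≤ m := by exact_mod_cast h3
    linarith
  have h := hC k
  -- The quadratic bound holds for ω²; it passes to ω after division by ω(k) + ω(0), which is at
  -- least ω(0) > 0.
  rw [← hsq, ← hsq0, sq_sub_sq, abs_mul] at h
  rw [div_mul_eq_mul_div, le_div_iff₀ h0, sub_zero, sq_abs]
  have h5 : disp α 0 ≤ |disp α k + disp α 0| := by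
    rw [abs_of_nonneg (add_nonneg (disp_nonneg _ _) h0.le)]
    linarith [disp_nonneg α k]
  calc |disp α k - disp α 0| * disp α 0 ≤ |disp α k - disp α 0| * |disp α k + disp α 0| := by
        gcongr
    _ ≤ _ := by linarith

theorem contDiffAt_disp (hα : AdmissibleCoupling α) {k : ℝ} (hk : k ∈ Ioo (0 : ℝ) 1) :
    ContDiffAt ℝ 2 (disp α) k :=
  hα.contDiffOn.contDiffAt (isOpen_Ioo.mem_nhds hk)

theorem differentiableAt_disp (hα : AdmissibleCoupling α) {k : ℝ} (hk : k ∈ Ioo (0 : ℝ) 1) :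
    DifferentiableAt ℝ (disp α) k := (contDiffAt_disp hα hk).differentiableAt (by norm_num)

theorem contDiffAt_deriv_disp (hα : AdmissibleCoupling α) {k : ℝ} (hk : k ∈ Ioo (0 : ℝ) 1) :
    ContDiffAt ℝ 1 (deriv (disp α)) k :=
  (hα.contDiffOn.deriv_of_isOpen (m := 1) isOpen_Ioo (by norm_num)).contDiffAt
    (isOpen_Ioo.mem_nhds hk)

/-- Second-order Taylor bound at an interior point. -/
theorem exists_disp_taylor (hα : AdmissibleCoupling α) {k₀ : ℝ} (hk : k₀ ∈ Ioo (0 : ℝ) 1) :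
    ∃ C δ : ℝ, 0 ≤ C ∧ 0 < δ ∧ ∀ k, |k - k₀| < δ →
      |disp α k - disp α k₀ - deriv (disp α) k₀ * (k - k₀)| ≤ C * |k - k₀| ^ 2 := by
  obtain ⟨K, t, ht, hK⟩ := (contDiffAt_deriv_disp hα hk).exists_lipschitzOnWith
  obtain ⟨δ, hδ, hball⟩ := Metric.mem_nhds_iff.1 (inter_mem ht (isOpen_Ioo.mem_nhds hk))
  refine ⟨K, δ, K.2, hδ, fun k hkd => ?_⟩
  have hsub : uIcc k₀ k ⊆ t ∩ Ioo 0 1 := by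
    intro x hx
    apply hball
    rw [Metric.mem_ball, Real.dist_eq]
    exact (abs_sub_left_of_mem_uIcc hx).trans_lt hkd
  -- ω minus its tangent has derivative ω' − ω'(k₀), bounded by K|k − k₀| between k₀ and k since ω'
  -- is locally Lipschitz; the mean value inequality adds the second power.
  have hmv := (convex_uIcc k₀ k).norm_image_sub_le_of_norm_hasDerivWithin_le
    (f := fun x => disp α x - deriv (disp α) k₀ * x)
    (f' := fun x => deriv (disp α) x - deriv (disp α) k₀) (C := K * |k - k₀|) (x := k₀) (y := k)
    (fun x hx => (((differentiableAt_disp hα (hsub hx).2).hasDerivAt.sub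
      ((hasDerivAt_id x).const_mul _)).hasDerivWithinAt.congr_deriv (by simp)))
    (fun x hx => by
      have h := hK.dist_le_mul x (hsub hx).1 k₀ (hsub left_mem_uIcc).1
      rw [Real.dist_eq, Real.dist_eq] at h
      rw [Real.norm_eq_abs]
      refine h.trans ?_
      have := abs_sub_left_of_mem_uIcc hx
      gcongr)
    left_mem_uIcc right_mem_uIcc
  rw [Real.norm_eq_abs, Real.norm_eq_abs] at hmv
  calc _ = |disp α k - deriv (disp α) k₀ * k - (disp α k₀ - deriv (disp α) k₀ * k₀)| := by
        congr 1; ring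
    _ ≤ _ := hmv
    _ = _ := by ring

/-- One-sided second-order Taylor bound at the origin. -/
theorem exists_disp_taylor_zero (hα : AdmissibleCoupling α) :
    ∃ l C δ : ℝ, 0 ≤ C ∧ 0 < δ ∧ δ < 1 / 2 ∧ ∀ k, 0 ≤ k → k < δ →
      |disp α k - disp α 0 - l * k| ≤ C * |k| ^ 2 := by
  obtain ⟨l, hl⟩ := hα.deriv_right
  obtain ⟨m, hm⟩ := hα.deriv2_right
  have hb : ∀ᶠ x in 𝓝[>] (0 : ℝ), ‖deriv (deriv (disp α)) x‖ < ‖m‖ + 1 :=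
    hm.norm.eventually (gt_mem_nhds (by linarith))
  obtain ⟨δ, hδ, hδb⟩ := (mem_nhdsGT_iff_exists_Ioo_subset).1 hb
  have hδ : 0 < δ := hδ
  set K := ‖m‖ + 1 with hK
  have hK0 : 0 ≤ K := by positivity
  set d := min δ (1 / 3) with hd
  have hd0 : 0 < d := lt_min hδ (by norm_num)
  have hIoo : ∀ x ∈ Ioo (0 : ℝ) d, x ∈ Ioo (0 : ℝ) 1 := fun x hx =>
    ⟨hx.1, (hx.2.trans_le (min_le_right _ _)).trans (by norm_num)⟩
  have hlip : ∀ x ∈ Ioo (0 : ℝ) d, ∀ y ∈ Ioo (0 : ℝ) d,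
      |deriv (disp α) y - deriv (disp α) x| ≤ K * |y - x| := by
    intro x hx y hy
    have := (convex_Ioo (0 : ℝ) d).norm_image_sub_le_of_norm_deriv_le (f := deriv (disp α)) (C := K)
      (fun z hz => (contDiffAt_deriv_disp hα (hIoo z hz)).differentiableAt (by norm_num))
      (fun z hz => (hδb ⟨hz.1, hz.2.trans_le (min_le_left _ _)⟩ : _ < _).le) hx hy
    simpa using this
  -- Letting the other point tend to 0+ in the Lipschitz bound replaces the possibly nonexistent
  -- ω'(0) by the one-sided limit l.
  have hl' : ∀ y ∈ Ioo (0 : ℝ) d, |deriv (disp α) y - l| ≤ K * y := by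
    intro y hy
    have h1 : Tendsto (fun x => |deriv (disp α) y - deriv (disp α) x|) (𝓝[>] 0)
        (𝓝 |deriv (disp α) y - l|) := (tendsto_const_nhds.sub hl).abs
    have h2 : Tendsto (fun x => K * |y - x|) (𝓝[>] 0) (𝓝 (K * |y - 0|)) := by
      refine Tendsto.mono_left ?_ nhdsWithin_le_nhds
      exact (Continuous.tendsto (by fun_prop) 0)
    have h3 := le_of_tendsto_of_tendsto h1 h2 (by
      filter_upwards [Ioo_mem_nhdsGT hd0] with x hx using hlip x hx y hy)
    rwa [sub_zero, abs_of_pos hy.1] at h3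
  refine ⟨l, K, d, hK0, hd0, (min_le_right _ _).trans_lt (by norm_num), fun k hk0 hkd => ?_⟩
  rcases hk0.eq_or_lt with rfl | hkpos
  · simp
  have hcont : ContinuousOn (fun x => disp α x - l * x) (Icc 0 k) :=
    (hα.continuous.sub (by fun_prop)).continuousOn
  have hderiv : ∀ x ∈ Ioo (0 : ℝ) k,
      HasDerivAt (fun x => disp α x - l * x) (deriv (disp α) x - l) x := fun x hx =>
    ((differentiableAt_disp hα (hIoo x ⟨hx.1, hx.2.trans hkd⟩)).hasDerivAt.sub
      ((hasDerivAt_id x).const_mul l)).congr_deriv (by simp)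
  obtain ⟨c, hc, hce⟩ := exists_hasDerivAt_eq_slope _ _ hkpos hcont hderiv
  have hc' := hl' c ⟨hc.1, hc.2.trans hkd⟩
  rw [hce] at hc'
  have e : disp α k - disp α 0 - l * k =
      ((disp α k - l * k - (disp α 0 - l * 0)) / (k - 0)) * k := by
    field_simp; ring
  rw [e, abs_mul, abs_of_pos hkpos, sq]
  have : K * c ≤ K * k := by gcongr; exact hc.2.le
  nlinarith

theorem disp_eq_fract (α : ℤ → ℝ) (k x : ℝ) :
    disp α (k + x) = disp α (Int.fract k + x) := by
  conv_lhs => rw [← Int.fract_add_floor k]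
  rw [add_right_comm, disp_add_int]

/-- The dispersion relation is locally Lipschitz at every point. -/
theorem exists_disp_lipschitz_at (hα : AdmissibleCoupling α) (k : ℝ) :
    ∃ C δ : ℝ, 0 ≤ C ∧ 0 < δ ∧ ∀ x, |x| < δ → |disp α (k + x) - disp α k| ≤ C * |x| := by
  have hred : ∀ x, disp α (k + x) - disp α k =
      disp α (Int.fract k + x) - disp α (Int.fract k) := fun x => by
    rw [disp_eq_fract]
    congr 1
    simpa using disp_eq_fract α k 0
  simp_rw [hred]
  rcases (Int.fract_nonneg k).eq_or_lt with h | h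
  · rw [← h]
    obtain ⟨l, C, δ, hC, hδ, hδ2, hb⟩ := exists_disp_taylor_zero hα
    refine ⟨|l| + C, δ, by positivity, hδ, fun x hx => ?_⟩
    have habs : disp α (0 + x) = disp α |x| := by
      rcases abs_choice x with e | e <;> rw [e] <;> simp [disp_neg hα]
    rw [habs]
    have h1 := hb |x| (abs_nonneg x) hx
    have h2 := abs_add_le (disp α |x| - disp α 0 - l * |x|) (l * |x|)
    rw [sub_add_cancel, abs_mul, abs_abs] at h2
    rw [abs_abs] at h1
    have h3 : C * |x| ^ 2 ≤ C * |x| := by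
      gcongr
      nlinarith [abs_nonneg x]
    linarith
  · obtain ⟨C, δ, hC, hδ, hb⟩ := exists_disp_taylor hα ⟨h, Int.fract_lt_one k⟩
    refine ⟨|deriv (disp α) (Int.fract k)| + C, min δ 1, by positivity, by positivity,
      fun x hx => ?_⟩
    have h1 := hb (Int.fract k + x) (by simpa using hx.trans_le (min_le_left _ _))
    rw [add_sub_cancel_left] at h1
    have h2 := abs_add_le (disp α (Int.fract k + x) - disp α (Int.fract k) -
      deriv (disp α) (Int.fract k) * x) (deriv (disp α) (Int.fract k) * x)
    rw [sub_add_cancel, abs_mul] at h2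
    have h3 : C * |x| ^ 2 ≤ C * |x| := by
      gcongr
      nlinarith [abs_nonneg x, hx.trans_le (min_le_right _ _)]
    linarith

/-- The symmetric difference quotient converges to `ω'`. -/
theorem tendsto_disp_symm_diff (hα : AdmissibleCoupling α) (k η : ℝ) :
    Tendsto (fun ε : ℝ => (disp α (k + ε * η / 2) - disp α (k - ε * η / 2)) / ε) (𝓝[>] 0)
      (𝓝 (dispDeriv α k * η)) := by
  rcases (Int.fract_nonneg k).eq_or_lt with h | h
  · have hk : k = ⌊k⌋ := by linarith [Int.fract_add_floor k]
    -- At an integer k, ω is symmetric about k, so every symmetric difference vanishes; the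
    -- reflection rule for `deriv` needs no differentiability and gives the value 0 even at a kink.
    have hsymm : ∀ x, disp α (2 * k - x) = disp α x := fun x => by
      rw [hk, ← disp_neg hα x, show (2 * (⌊k⌋ : ℝ) - x) = -x + ((2 * ⌊k⌋ : ℤ) : ℝ) by
        push_cast; ring, disp_add_int]
    have hd : dispDeriv α k = 0 := by
      have h1 := deriv_comp_const_sub (disp α) (2 * k) k
      simp_rw [hsymm] at h1
      rw [show 2 * k - k = k by ring] at h1
      unfold dispDeriv
      linarith
    rw [hd, zero_mul]
    refine tendsto_const_nhds.congr (fun ε => ?_)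
    rw [← hsymm (k + ε * η / 2), show 2 * k - (k + ε * η / 2) = k - ε * η / 2 by ring]
    simp
  · have hdiff : DifferentiableAt ℝ (disp α) k := by
      have h1 := differentiableAt_disp hα (k := Int.fract k) ⟨h, Int.fract_lt_one k⟩
      have h2 : disp α = fun x => disp α (x - ⌊k⌋) := by
        ext x
        have := disp_add_int α x (-⌊k⌋)
        push_cast at this
        rw [sub_eq_add_neg, this]
      rw [h2]
      exact DifferentiableAt.comp (f := fun x => x - (⌊k⌋ : ℝ)) k h1 (by fun_prop)
    have hF : HasDerivAt (fun ε : ℝ => disp α (k + ε * η / 2) - disp α (k - ε * η / 2))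
        (dispDeriv α k * η) 0 := by
      have hp : HasDerivAt (fun ε : ℝ => k + ε * η / 2) (η / 2) 0 := by
        simpa using (((hasDerivAt_id (0 : ℝ)).mul_const η).div_const 2).const_add k
      have hm : HasDerivAt (fun ε : ℝ => k - ε * η / 2) (-(η / 2)) 0 := by
        simpa using (((hasDerivAt_id (0 : ℝ)).mul_const η).div_const 2).const_sub k
      have hd := hdiff.hasDerivAt
      have h1 : HasDerivAt (fun ε : ℝ => disp α (k + ε * η / 2)) (deriv (disp α) k * (η / 2)) 0 :=
        HasDerivAt.comp (h₂ := disp α) (h := fun ε : ℝ => k + ε * η / 2) 0 (by simpa using hd) hp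
      have h2 : HasDerivAt (fun ε : ℝ => disp α (k - ε * η / 2))
          (deriv (disp α) k * (-(η / 2))) 0 :=
        HasDerivAt.comp (h₂ := disp α) (h := fun ε : ℝ => k - ε * η / 2) 0 (by simpa using hd) hm
      exact (h1.sub h2).congr_deriv (by unfold dispDeriv; ring)
    have := hF.tendsto_slope.mono_left (nhdsGT_le_nhdsNE 0)
    refine this.congr (fun ε => ?_)
    simp [slope_def_field]

end Dispersion


/-! ### Boundary values of J̃ and g̃ on the imaginary axis -/

section BoundaryValues

variable {α : ℤ → ℝ}

theorem integrableOn_exp_neg_mul_Ioi {z : ℂ} (hz : 0 < z.re) :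
    IntegrableOn (fun t : ℝ => Complex.exp (-z * t)) (Ioi 0) :=
  integrableOn_exp_mul_complex_Ioi (a := -z) (by simpa using hz) 0

theorem integral_exp_neg_mul_Ioi {z : ℂ} (hz : 0 < z.re) :
    ∫ t in Ioi (0 : ℝ), Complex.exp (-z * t) = z⁻¹ := by
  rw [integral_exp_mul_complex_Ioi (a := -z) (by simpa using hz) 0]
  simp

theorem norm_exp_neg_mul (z : ℂ) (t : ℝ) :
    ‖Complex.exp (-z * t)‖ = Real.exp (-z.re * t) := by
  rw [Complex.norm_exp]
  simp

/-- The odd extension of the dispersion relation from `(0, 1/2]`. -/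
def oddDisp (α : ℤ → ℝ) (k : ℝ) : ℝ := if 0 ≤ k then disp α k else -disp α k

theorem measurable_oddDisp (hα : AdmissibleCoupling α) : Measurable (oddDisp α) :=
  Measurable.ite measurableSet_Ici hα.continuous.measurable hα.continuous.measurable.neg

theorem sub_I_mul_ne_zero {z : ℂ} (hz : 0 < z.re) (v : ℝ) : z - Complex.I * v ≠ 0 := by
  intro h
  have := congrArg Complex.re h
  simp at this
  linarith

theorem norm_inv_sub_I_mul_le {z : ℂ} (hz : 0 < z.re) (v : ℝ) :
    ‖(z - Complex.I * v)⁻¹‖ ≤ z.re⁻¹ := by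
  rw [norm_inv]
  apply inv_anti₀ hz
  have := Complex.abs_re_le_norm (z - Complex.I * v)
  simp at this
  exact (le_abs_self _).trans this

theorem measurable_inv_sub_I_mul (z : ℂ) {v : ℝ → ℝ} (hv : Measurable v) :
    Measurable (fun k => (z - Complex.I * (v k : ℂ))⁻¹) := by fun_prop

theorem intervalIntegrable_inv_sub_I_mul {z : ℂ} (hz : 0 < z.re) {v : ℝ → ℝ} (hv : Measurable v)
    (a b : ℝ) : IntervalIntegrable (fun k => (z - Complex.I * (v k : ℂ))⁻¹) volume a b := by
  refine (intervalIntegrable_const (c := z.re⁻¹)).mono_fun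
    (measurable_inv_sub_I_mul z hv).aestronglyMeasurable (Eventually.of_forall fun k => ?_)
  exact (norm_inv_sub_I_mul_le hz _).trans (le_abs_self _)

theorem integral_exp_neg_mul_cos {z : ℂ} (hz : 0 < z.re) (w : ℝ) :
    ∫ t in Ioi (0 : ℝ), Complex.exp (-z * t) * (Real.cos (w * t) : ℂ) =
      ((z - Complex.I * w)⁻¹ + (z - Complex.I * (-w : ℝ))⁻¹) / 2 := by
  have h1 : 0 < (z - Complex.I * w).re := by simpa using hz
  have h2 : 0 < (z - Complex.I * (-w : ℝ)).re := by simpa using hz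
  rw [← integral_exp_neg_mul_Ioi h1, ← integral_exp_neg_mul_Ioi h2,
    ← integral_add (integrableOn_exp_neg_mul_Ioi h1) (integrableOn_exp_neg_mul_Ioi h2),
    ← integral_div]
  congr 1 with t
  rw [Complex.ofReal_cos, Complex.cos, mul_div_assoc', mul_add, ← Complex.exp_add,
    ← Complex.exp_add]
  push_cast
  ring_nf

/-- `J̃` as a Cauchy integral of the odd dispersion relation. -/
theorem Jt_eq_integral_inv (hα : AdmissibleCoupling α) {z : ℂ} (hz : 0 < z.re) :
    Jt α z = ∫ k in (-1 / 2 : ℝ)..(1 / 2), (z - Complex.I * (oddDisp α k : ℂ))⁻¹ := by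
  have hle : (-1 / 2 : ℝ) ≤ 1 / 2 := by norm_num
  -- The transform of cos(ωt) is the mean of (z − iω)⁻¹ and (z + iω)⁻¹; symmetrising in k
  -- distributes the two poles over the two halves of the period, which is why the odd extension
  -- appears.
  have hsymm : ∀ F : ℝ → ℂ, IntervalIntegrable F volume (-1 / 2 : ℝ) (1 / 2) →
      ∫ k in (-1 / 2 : ℝ)..(1 / 2), F k = ∫ k in (-1 / 2 : ℝ)..(1 / 2), (F k + F (-k)) / 2 := by
    intro F hF
    have h1 : ∫ k in (-1 / 2 : ℝ)..(1 / 2), F (-k) = ∫ k in (-1 / 2 : ℝ)..(1 / 2), F k := by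
      rw [intervalIntegral.integral_comp_neg]; norm_num
    have hF' : IntervalIntegrable (fun k => F (-k)) volume (-1 / 2 : ℝ) (1 / 2) := by
      have := (IntervalIntegrable.iff_comp_neg (f := F) (a := -1 / 2) (b := 1 / 2)).1 hF
      have h2 := this.symm
      norm_num at h2 ⊢
      exact h2
    rw [intervalIntegral.integral_div, intervalIntegral.integral_add hF hF', h1]
    ring
  rw [hsymm _ (intervalIntegrable_inv_sub_I_mul hz (measurable_oddDisp hα) _ _)]
  have hJ : ∀ t : ℝ, Complex.exp (-z * t) * (J α t : ℂ) =
      ∫ k in Ioc (-1 / 2 : ℝ) (1 / 2), Complex.exp (-z * t) * (Real.cos (disp α k * t) : ℂ) := by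
    intro t
    rw [J, intervalIntegral.integral_of_le hle, ← integral_complex_ofReal, integral_const_mul]
  rw [Jt, intervalIntegral.integral_of_le hle]
  simp_rw [hJ]
  rw [integral_integral_swap]
  · apply integral_congr_ae
    have h0 : ∀ᵐ k : ℝ ∂(volume.restrict (Ioc (-1 / 2 : ℝ) (1 / 2))), k ≠ 0 :=
      ae_restrict_of_ae (Measure.ae_ne volume 0)
    filter_upwards [h0] with k hk
    rw [integral_exp_neg_mul_cos hz]
    rcases lt_or_gt_of_ne hk with h | h
    · have h1 : oddDisp α k = -disp α k := by simp [oddDisp, h]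
      have h2 : oddDisp α (-k) = disp α k := by simp [oddDisp, h.le, disp_neg hα]
      rw [h1, h2, add_comm]
    · have h1 : oddDisp α k = disp α k := by simp [oddDisp, h.le]
      have h2 : oddDisp α (-k) = -disp α k := by simp [oddDisp, h, disp_neg hα]
      rw [h1, h2]
  · have hint : Integrable (fun t : ℝ => Real.exp (-z.re * t)) (volume.restrict (Ioi 0)) := by
      have := (integrableOn_exp_neg_mul_Ioi hz).norm
      simpa only [norm_exp_neg_mul] using this
    have h3 := hint.mul_prod (ν := volume.restrict (Ioc (-1 / 2 : ℝ) (1 / 2)))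
      (integrable_const (1 : ℝ))
    refine h3.mono' ?_ (Eventually.of_forall fun p => ?_)
    · have := hα.continuous
      apply Continuous.aestronglyMeasurable
      unfold Function.uncurry
      fun_prop
    · simp only [Function.uncurry, norm_mul, norm_exp_neg_mul, mul_one, Complex.norm_real]
      exact mul_le_of_le_one_right (Real.exp_pos _).le (Real.abs_cos_le_one _)

theorem re_inv_sub_I_mul (z : ℂ) (v : ℝ) :
    ((z - Complex.I * (v : ℂ))⁻¹).re = z.re / (z.re ^ 2 + (z.im - v) ^ 2) := by
  rw [Complex.inv_re, Complex.normSq_apply]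
  simp [sq]

theorem re_integral_inv {z : ℂ} (hz : 0 < z.re) {v : ℝ → ℝ} (hv : Measurable v) (a b : ℝ) :
    (∫ k in a..b, (z - Complex.I * (v k : ℂ))⁻¹).re =
      ∫ k in a..b, z.re / (z.re ^ 2 + (z.im - v k) ^ 2) := by
  have h := Complex.reCLM.intervalIntegral_comp_comm (intervalIntegrable_inv_sub_I_mul hz hv a b)
  simp only [Complex.reCLM_apply, re_inv_sub_I_mul] at h
  exact h.symm

/-- The real part of the Cauchy kernel is a Poisson kernel, hence positive. This keeps 1 + γJ̃
outside the open unit disc, so that g̃ is well defined and bounded by 1 on the half-plane. -/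
theorem re_Jt_nonneg (hα : AdmissibleCoupling α) {z : ℂ} (hz : 0 < z.re) : 0 ≤ (Jt α z).re := by
  rw [Jt_eq_integral_inv hα hz, re_integral_inv hz (measurable_oddDisp hα)]
  exact intervalIntegral.integral_nonneg (by norm_num) (fun k _ => by positivity)

theorem one_le_norm_one_add_Jt (hα : AdmissibleCoupling α) {γ : ℝ} (hγ : 0 < γ) {z : ℂ}
    (hz : 0 < z.re) : 1 ≤ ‖1 + (γ : ℂ) * Jt α z‖ := by
  have h1 := Complex.abs_re_le_norm (1 + (γ : ℂ) * Jt α z)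
  have h2 := mul_nonneg hγ.le (re_Jt_nonneg hα hz)
  simp only [Complex.add_re, Complex.one_re, Complex.re_ofReal_mul] at h1
  exact le_trans (le_trans (by linarith) (le_abs_self _)) h1

theorem one_add_Jt_ne_zero (hα : AdmissibleCoupling α) {γ : ℝ} (hγ : 0 < γ) {z : ℂ}
    (hz : 0 < z.re) : 1 + (γ : ℂ) * Jt α z ≠ 0 := by
  intro h
  have := one_le_norm_one_add_Jt hα hγ hz
  rw [h, norm_zero] at this
  linarith

theorem norm_gt_le_one (hα : AdmissibleCoupling α) {γ : ℝ} (hγ : 0 < γ) {z : ℂ}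
    (hz : 0 < z.re) : ‖gt α γ z‖ ≤ 1 := by
  rw [gt, norm_inv]
  exact inv_le_one_of_one_le₀ (one_le_norm_one_add_Jt hα hγ hz)

/-- Reduces J̃g̃ to g̃, and thereby gives its boundary values even where J̃ itself blows up. -/
theorem mul_Jgt (hα : AdmissibleCoupling α) {γ : ℝ} (hγ : 0 < γ) {z : ℂ}
    (hz : 0 < z.re) : (γ : ℂ) * Jgt α γ z = 1 - gt α γ z := by
  have := one_add_Jt_ne_zero hα hγ hz
  rw [Jgt, gt]
  field_simp
  ring

theorem Jt_conj (α : ℤ → ℝ) (z : ℂ) : Jt α (starRingEnd ℂ z) = starRingEnd ℂ (Jt α z) := by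
  rw [Jt, Jt, ← integral_conj]
  congr 1 with t
  simp [← Complex.exp_conj]

theorem gt_conj (α : ℤ → ℝ) (γ : ℝ) (z : ℂ) :
    gt α γ (starRingEnd ℂ z) = starRingEnd ℂ (gt α γ z) := by
  simp [gt, Jt_conj]

/-- A Stolz cone in the right half-plane with vertex `iβ`. -/
def cone (M β : ℝ) : Set ℂ := {z | 0 < z.re ∧ |z.im - β| ≤ M * z.re}

/-- Inside a cone, the distance from z to any point iv controls the distance from iv to the vertex,
uniformly up to the vertex. This supplies the dominating functions for the limits z → iβ. -/
theorem mul_abs_le_norm_of_mem_cone {M β v : ℝ} {z : ℂ} (hM : 0 ≤ M) (hz : z ∈ cone M β) :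
    |v - β| ≤ (1 + M) * ‖z - Complex.I * v‖ := by
  have h1 := Complex.abs_im_le_norm (z - Complex.I * v)
  have h2 := Complex.abs_re_le_norm (z - Complex.I * v)
  simp at h1 h2
  rw [abs_of_pos hz.1] at h2
  have h3 := abs_sub_le v z.im β
  rw [abs_sub_comm v z.im] at h3
  have h4 := hz.2
  have h5 : M * z.re ≤ M * ‖z - Complex.I * v‖ := by gcongr
  linarith

theorem eventually_mem_cone (M β : ℝ) : ∀ᶠ z in 𝓝[cone M β] (Complex.I * (β : ℂ)), z ∈ cone M β :=
  self_mem_nhdsWithin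

/-- Boundary values of a Cauchy integral away from the range of the density. -/
theorem tendsto_integral_inv_of_gap {v : ℝ → ℝ} (hv : Measurable v) {a b β m M : ℝ}
    (hM : 0 ≤ M) (hm : 0 < m) (hgap : ∀ k, m ≤ |v k - β|) :
    Tendsto (fun z : ℂ => ∫ k in a..b, (z - Complex.I * (v k : ℂ))⁻¹)
      (𝓝[cone M β] (Complex.I * (β : ℂ)))
      (𝓝 (∫ k in a..b, (Complex.I * (β : ℂ) - Complex.I * (v k : ℂ))⁻¹)) := by
  apply intervalIntegral.tendsto_integral_filter_of_dominated_convergence (fun _ => (1 + M) / m)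
  · exact Eventually.of_forall fun z => (measurable_inv_sub_I_mul z hv).aestronglyMeasurable
  · filter_upwards [eventually_mem_cone M β] with z hz
    refine Eventually.of_forall fun k _ => ?_
    have h1 := (hgap k).trans (mul_abs_le_norm_of_mem_cone hM hz)
    have h2 : 0 < ‖z - Complex.I * v k‖ := norm_pos_iff.2 (sub_I_mul_ne_zero hz.1 _)
    rw [norm_inv, inv_eq_one_div, div_le_div_iff₀ h2 hm]
    linarith
  · exact intervalIntegrable_const
  · refine Eventually.of_forall fun k _ => ?_
    refine Tendsto.inv₀ ?_ ?_
    · exact (tendsto_nhdsWithin_of_tendsto_nhds tendsto_id).sub tendsto_const_nhds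
    · rw [← mul_sub, mul_ne_zero_iff]
      refine ⟨Complex.I_ne_zero, ?_⟩
      rw [← Complex.ofReal_sub, Complex.ofReal_ne_zero]
      intro h
      have := hgap k
      rw [abs_sub_comm, h, abs_zero] at this
      linarith

/-- The Cauchy integral of an affine density, by means of the complex logarithm. -/
theorem integral_inv_affine {ζ : ℂ} (hζ : 0 < ζ.re) {c : ℝ} (hc : 0 < c) (a b k₀ : ℝ) :
    ∫ k in a..b, (ζ - Complex.I * ((c * (k - k₀) : ℝ) : ℂ))⁻¹ =
      Complex.I / c * (Complex.log (ζ - Complex.I * ((c * (b - k₀) : ℝ) : ℂ)) -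
        Complex.log (ζ - Complex.I * ((c * (a - k₀) : ℝ) : ℂ))) := by
  have hc' : (c : ℂ) ≠ 0 := Complex.ofReal_ne_zero.2 hc.ne'
  have hd : ∀ k : ℝ, HasDerivAt (fun k : ℝ => Complex.I / c *
      Complex.log (ζ - Complex.I * ((c * (k - k₀) : ℝ) : ℂ)))
      ((ζ - Complex.I * ((c * (k - k₀) : ℝ) : ℂ))⁻¹) k := by
    intro k
    have h1 : HasDerivAt (fun k : ℝ => ζ - Complex.I * ((c * (k - k₀) : ℝ) : ℂ))
        (-(Complex.I * c)) k := by
      have h2 : HasDerivAt (fun k : ℝ => ((c * (k - k₀) : ℝ) : ℂ)) (c : ℂ) k := by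
        have := (((hasDerivAt_id k).sub_const k₀).const_mul c).ofReal_comp
        simpa using this
      simpa using (h2.const_mul Complex.I).const_sub ζ
    have hslit : ζ - Complex.I * ((c * (k - k₀) : ℝ) : ℂ) ∈ Complex.slitPlane := by
      left
      simpa using hζ
    refine ((h1.clog_real hslit).const_mul (Complex.I / c)).congr_deriv ?_
    have hne := Complex.slitPlane_ne_zero hslit
    field_simp
    rw [Complex.I_sq]
    ring
  rw [intervalIntegral.integral_eq_sub_of_hasDerivAt (fun k _ => hd k)
    (intervalIntegrable_inv_sub_I_mul hζ (by fun_prop) a b)]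
  ring

/-- Boundary values of a Cauchy integral at a noncritical value of the density. -/
theorem exists_tendsto_integral_inv_of_regular {v : ℝ → ℝ} (hv : Measurable v)
    {a b k₀ β c c' C M : ℝ} (hM : 0 ≤ M) (hab : k₀ ∈ Ioo a b) (hc : 0 < c) (hc' : 0 < c')
    (hC : ∀ k ∈ Ioc a b, |v k - β - c * (k - k₀)| ≤ C * |k - k₀| ^ 2)
    (hlow : ∀ k ∈ Ioc a b, c' * |k - k₀| ≤ |v k - β|) :
    Tendsto (fun z : ℂ => ∫ k in a..b, (z - Complex.I * (v k : ℂ))⁻¹)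
      (𝓝[cone M β] (Complex.I * (β : ℂ)))
      (𝓝 ((∫ k in a..b, ((Complex.I * (β : ℂ) - Complex.I * (v k : ℂ))⁻¹ -
        (Complex.I * (β : ℂ) - Complex.I * β - Complex.I * ((c * (k - k₀) : ℝ) : ℂ))⁻¹)) +
        Complex.I / c * (Complex.log (Complex.I * (β : ℂ) - Complex.I * β -
          Complex.I * ((c * (b - k₀) : ℝ) : ℂ)) -
        Complex.log (Complex.I * (β : ℂ) - Complex.I * β -
          Complex.I * ((c * (a - k₀) : ℝ) : ℂ))))) := by
  have hlt : a ≤ b := (hab.1.trans hab.2).le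
  have hre : ∀ z ∈ cone M β, 0 < (z - Complex.I * β).re := fun z hz => by simpa using hz.1
  -- The affine density with the same value and slope carries the whole singularity; it is
  -- subtracted and added back in closed form.
  have hsplit : ∀ᶠ z in 𝓝[cone M β] (Complex.I * (β : ℂ)),
      (∫ k in a..b, ((z - Complex.I * (v k : ℂ))⁻¹ -
        (z - Complex.I * β - Complex.I * ((c * (k - k₀) : ℝ) : ℂ))⁻¹)) +
        Complex.I / c * (Complex.log (z - Complex.I * β -
          Complex.I * ((c * (b - k₀) : ℝ) : ℂ)) -
        Complex.log (z - Complex.I * β -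
          Complex.I * ((c * (a - k₀) : ℝ) : ℂ))) =
      ∫ k in a..b, (z - Complex.I * (v k : ℂ))⁻¹ := by
    filter_upwards [eventually_mem_cone M β] with z hz
    rw [← integral_inv_affine (hre z hz) hc, intervalIntegral.integral_sub
      (intervalIntegrable_inv_sub_I_mul hz.1 hv a b)
      (intervalIntegrable_inv_sub_I_mul (hre z hz) (by fun_prop) a b), sub_add_cancel]
  refine Tendsto.congr' hsplit (Tendsto.add ?_ (Tendsto.const_mul _ (Tendsto.sub ?_ ?_)))
  · have hne : ∀ᵐ k : ℝ, k ≠ k₀ := Measure.ae_ne volume k₀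
    -- The difference of the two kernels has a numerator of size C|k − k₀|² and two denominators of
    -- size at least c'|k − k₀|/(1 + M) and c|k − k₀|/(1 + M), so it stays bounded by this constant.
    apply intervalIntegral.tendsto_integral_filter_of_dominated_convergence
      (fun _ => C * (1 + M) ^ 2 / (c * c'))
    · exact Eventually.of_forall fun z => ((measurable_inv_sub_I_mul z hv).sub
        (measurable_inv_sub_I_mul (z - Complex.I * β)
          (v := fun k => c * (k - k₀)) (by fun_prop))).aestronglyMeasurable
    · filter_upwards [eventually_mem_cone M β] with z hz
      filter_upwards [hne] with k hk hkm
      rw [uIoc_of_le hlt] at hkm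
      have hk0 : 0 < |k - k₀| := abs_pos.2 (sub_ne_zero.2 hk)
      have hA := sub_I_mul_ne_zero hz.1 (v k)
      have hB := sub_I_mul_ne_zero (hre z hz) (c * (k - k₀))
      have hA1 : c' * |k - k₀| ≤ (1 + M) * ‖z - Complex.I * v k‖ :=
        (hlow k hkm).trans (mul_abs_le_norm_of_mem_cone hM hz)
      have hB1 : c * |k - k₀| ≤ (1 + M) *
          ‖z - Complex.I * β - Complex.I * ((c * (k - k₀) : ℝ) : ℂ)‖ := by
        have := mul_abs_le_norm_of_mem_cone (v := β + c * (k - k₀)) hM hz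
        rw [add_sub_cancel_left, abs_mul, abs_of_pos hc] at this
        convert this using 3
        push_cast
        ring
      rw [inv_sub_inv hA hB, norm_div, norm_mul]
      have hnum : ‖z - Complex.I * β - Complex.I * ((c * (k - k₀) : ℝ) : ℂ) -
          (z - Complex.I * v k)‖ ≤ C * |k - k₀| ^ 2 := by
        have e : z - Complex.I * β - Complex.I * ((c * (k - k₀) : ℝ) : ℂ) -
          (z - Complex.I * v k) = Complex.I * ((v k - β - c * (k - k₀) : ℝ) : ℂ) := by
          push_cast; ring
        rw [e, norm_mul, Complex.norm_I, one_mul, Complex.norm_real]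
        exact hC k hkm
      have hA0 := norm_pos_iff.2 hA
      have hB0 := norm_pos_iff.2 hB
      rw [div_le_div_iff₀ (by positivity) (by positivity)]
      have hC0 : 0 ≤ C := by
        have := (norm_nonneg _).trans hnum
        exact nonneg_of_mul_nonneg_left this (by positivity)
      have hprod := mul_le_mul hA1 hB1 (by positivity) (by positivity)
      calc _ ≤ C * |k - k₀| ^ 2 * (c * c') := by gcongr
        _ = C * (c' * |k - k₀| * (c * |k - k₀|)) := by ring
        _ ≤ C * _ := mul_le_mul_of_nonneg_left hprod hC0
        _ = _ := by ring
    · exact intervalIntegrable_const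
    · filter_upwards [hne] with k hk hkm
      rw [uIoc_of_le hlt] at hkm
      have hk0 : 0 < |k - k₀| := abs_pos.2 (sub_ne_zero.2 hk)
      have hid : Tendsto (fun z : ℂ => z) (𝓝[cone M β] (Complex.I * (β : ℂ)))
        (𝓝 (Complex.I * (β : ℂ))) := tendsto_nhdsWithin_of_tendsto_nhds tendsto_id
      refine Tendsto.sub (Tendsto.inv₀ (hid.sub tendsto_const_nhds) ?_) (Tendsto.inv₀
        ((hid.sub tendsto_const_nhds).sub tendsto_const_nhds) ?_)
      · rw [← mul_sub, mul_ne_zero_iff]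
        refine ⟨Complex.I_ne_zero, ?_⟩
        rw [← Complex.ofReal_sub, Complex.ofReal_ne_zero]
        intro h
        have h2 := hlow k hkm
        rw [abs_sub_comm (v k), h, abs_zero] at h2
        have : 0 < c' * |k - k₀| := by positivity
        linarith
      · rw [sub_self, zero_sub, neg_ne_zero, mul_ne_zero_iff, Complex.ofReal_ne_zero]
        exact ⟨Complex.I_ne_zero, mul_ne_zero hc.ne' (sub_ne_zero.2 hk)⟩
  all_goals
    -- As k₀ is interior, the limiting arguments are nonzero and purely imaginary, away from the cut
    -- of the logarithm.
    refine Tendsto.clog (((tendsto_nhdsWithin_of_tendsto_nhds tendsto_id).sub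
      tendsto_const_nhds).sub tendsto_const_nhds) (Or.inr ?_)
    simp only [sub_self, zero_sub, Complex.neg_im, Complex.mul_im, Complex.I_re, Complex.ofReal_im,
      mul_zero, Complex.I_im, Complex.ofReal_re, one_mul, zero_add, ne_eq, neg_eq_zero,
      mul_eq_zero, hc.ne', false_or, sub_eq_zero]
  · exact hab.2.ne'
  · exact hab.1.ne

theorem tendsto_re_cone (M β : ℝ) :
    Tendsto Complex.re (𝓝[cone M β] (Complex.I * (β : ℂ))) (𝓝[>] 0) := by
  rw [tendsto_nhdsWithin_iff]
  refine ⟨?_, (eventually_mem_cone M β).mono fun z hz => hz.1⟩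
  have : Tendsto Complex.re (𝓝 (Complex.I * (β : ℂ))) (𝓝 (Complex.I * (β : ℂ)).re) :=
    Complex.continuous_re.tendsto _
  simpa using this.mono_left nhdsWithin_le_nhds

/-- A Cauchy integral blows up at a value taken with a quadratic contact. -/
theorem tendsto_re_integral_inv_of_contact {v : ℝ → ℝ} (hv : Measurable v)
    {a b k₀ β C d M : ℝ} (hC0 : 0 ≤ C) (hd : 0 < d)
    (hC : (∀ k ∈ Ioo k₀ (k₀ + d), k ∈ Ioc a b ∧ |v k - β| ≤ C * |k - k₀| ^ 2) ∨
      (∀ k ∈ Ioo (k₀ - d) k₀, k ∈ Ioc a b ∧ |v k - β| ≤ C * |k - k₀| ^ 2)) :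
    Tendsto (fun z : ℂ => (∫ k in a..b, (z - Complex.I * (v k : ℂ))⁻¹).re)
      (𝓝[cone M β] (Complex.I * (β : ℂ))) atTop := by
  have hab : a ≤ b := by
    rcases hC with h | h
    · have := (h (k₀ + d / 2) ⟨by linarith, by linarith⟩).1
      exact (this.1.trans_le this.2).le
    · have := (h (k₀ - d / 2) ⟨by linarith, by linarith⟩).1
      exact (this.1.trans_le this.2).le
  -- With x = Re z and |k − k₀| < √x, one has |v(k) − β| ≤ Cx and |Im z − β| ≤ Mx, so the Poisson
  -- kernel is at least 1/(xD). Integration over a one-sided window of length √x gives 1/(D√x),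
  -- which diverges.
  set D := 1 + (M + C) ^ 2 with hD
  have hD0 : 0 < D := by positivity
  have hlim : Tendsto (fun z : ℂ => D⁻¹ * (Real.sqrt z.re)⁻¹)
      (𝓝[cone M β] (Complex.I * (β : ℂ))) atTop := by
    apply Tendsto.const_mul_atTop (inv_pos.2 hD0)
    apply tendsto_inv_nhdsGT_zero.comp
    rw [tendsto_nhdsWithin_iff]
    constructor
    · have := ((Real.continuous_sqrt.tendsto 0).mono_left nhdsWithin_le_nhds).comp
        (tendsto_re_cone M β)
      simpa [Function.comp_def] using this
    · filter_upwards [eventually_mem_cone M β] with z hz using Real.sqrt_pos.2 hz.1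
  refine tendsto_atTop_mono' _ ?_ hlim
  have hsmall : ∀ᶠ z in 𝓝[cone M β] (Complex.I * (β : ℂ)), z.re < d ^ 2 :=
    ((tendsto_re_cone M β).mono_right nhdsWithin_le_nhds).eventually
      (gt_mem_nhds (by positivity))
  filter_upwards [eventually_mem_cone M β, hsmall] with z hz hzd
  set x := z.re with hx
  have hx0 : 0 < x := hz.1
  have hs0 : 0 < Real.sqrt x := Real.sqrt_pos.2 hx0
  have hss : Real.sqrt x ^ 2 = x := Real.sq_sqrt hx0.le
  have hsd : Real.sqrt x < d := by
    rw [Real.sqrt_lt' hd]; exact hzd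
  rw [re_integral_inv hz.1 hv, intervalIntegral.integral_of_le hab]
  have hpt : ∀ k, |v k - β| ≤ C * |k - k₀| ^ 2 → |k - k₀| < Real.sqrt x →
      (x * D)⁻¹ ≤ x / (x ^ 2 + (z.im - v k) ^ 2) := by
    intro k hk hks
    have h1 : |v k - β| ≤ C * x := by
      refine hk.trans ?_
      rw [← hss]
      gcongr
    have h2 : |z.im - v k| ≤ (M + C) * x := by
      have := abs_sub_le z.im β (v k)
      rw [abs_sub_comm β] at this
      linarith [hz.2]
    have h3 : (z.im - v k) ^ 2 ≤ ((M + C) * x) ^ 2 := by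
      rw [← sq_abs]
      gcongr
    rw [inv_eq_one_div, div_le_div_iff₀ (by positivity) (by positivity)]
    have : x * (x * D) = x ^ 2 + ((M + C) * x) ^ 2 := by rw [hD]; ring
    rw [this]
    linarith
  have hmeas : Measurable fun k => x / (x ^ 2 + (z.im - v k) ^ 2) := by fun_prop
  have hnn : ∀ k, 0 ≤ x / (x ^ 2 + (z.im - v k) ^ 2) := fun k => by positivity
  have hint : IntegrableOn (fun k => x / (x ^ 2 + (z.im - v k) ^ 2)) (Ioc a b) := by
    refine (integrableOn_const (C := x⁻¹) (by simp)).mono' hmeas.aestronglyMeasurable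
      (Eventually.of_forall fun k => ?_)
    rw [Real.norm_of_nonneg (hnn k), inv_eq_one_div, div_le_div_iff₀ (by positivity) hx0]
    nlinarith [sq_nonneg (z.im - v k)]
  have key : ∀ p : ℝ, (∀ k ∈ Ioo p (p + Real.sqrt x), k ∈ Ioc a b ∧
      |v k - β| ≤ C * |k - k₀| ^ 2 ∧ |k - k₀| < Real.sqrt x) →
      D⁻¹ * (Real.sqrt x)⁻¹ ≤ ∫ k in Ioc a b, x / (x ^ 2 + (z.im - v k) ^ 2) := by
    intro p hp
    have hsub : Ioo p (p + Real.sqrt x) ⊆ Ioc a b := fun k hk => (hp k hk).1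
    calc D⁻¹ * (Real.sqrt x)⁻¹ = ∫ k in Ioo p (p + Real.sqrt x), (x * D)⁻¹ := by
          rw [setIntegral_const, measureReal_def, Real.volume_Ioo, add_sub_cancel_left,
            ENNReal.toReal_ofReal hs0.le, smul_eq_mul]
          nth_rewrite 3 [← hss]
          field_simp
      _ ≤ ∫ k in Ioo p (p + Real.sqrt x), x / (x ^ 2 + (z.im - v k) ^ 2) := by
          apply setIntegral_mono_on (integrableOn_const (by simp)) (hint.mono_set hsub)
            measurableSet_Ioo
          exact fun k hk => hpt k (hp k hk).2.1 (hp k hk).2.2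
      _ ≤ _ := setIntegral_mono_set hint (Eventually.of_forall hnn) hsub.eventuallyLE
  rcases hC with h | h
  · refine key k₀ fun k hk => ?_
    obtain ⟨h1, h2⟩ := h k ⟨hk.1, hk.2.trans (by linarith)⟩
    exact ⟨h1, h2, by rw [abs_of_pos (by linarith [hk.1])]; linarith [hk.2]⟩
  · refine key (k₀ - Real.sqrt x) fun k hk => ?_
    have hk2 : k < k₀ := by linarith [hk.2]
    obtain ⟨h1, h2⟩ := h k ⟨by linarith [hk.1], hk2⟩
    exact ⟨h1, h2, by rw [abs_of_neg (by linarith)]; linarith [hk.1]⟩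

theorem oddDisp_of_nonneg (α : ℤ → ℝ) {k : ℝ} (hk : 0 ≤ k) : oddDisp α k = disp α k := if_pos hk

theorem oddDisp_of_neg (α : ℤ → ℝ) {k : ℝ} (hk : k < 0) : oddDisp α k = -disp α k :=
  if_neg (not_le.2 hk)

theorem tendsto_gt_of_tendsto_Jt (hα : AdmissibleCoupling α) {γ : ℝ} (hγ : 0 < γ) {M β : ℝ}
    {c : ℂ} (h : Tendsto (fun z : ℂ => ∫ k in (-1 / 2 : ℝ)..(1 / 2),
      (z - Complex.I * (oddDisp α k : ℂ))⁻¹) (𝓝[cone M β] (Complex.I * (β : ℂ))) (𝓝 c)) :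
    Tendsto (gt α γ) (𝓝[cone M β] (Complex.I * (β : ℂ))) (𝓝 (1 + γ * c)⁻¹) := by
  rcases (𝓝[cone M β] (Complex.I * (β : ℂ))).eq_or_neBot with hb | hb
  · rw [hb]; exact tendsto_bot
  have hJ : Tendsto (Jt α) (𝓝[cone M β] (Complex.I * (β : ℂ))) (𝓝 c) :=
    h.congr' ((eventually_mem_cone M β).mono fun z hz => (Jt_eq_integral_inv hα hz.1).symm)
  have h1 : Tendsto (fun z => 1 + (γ : ℂ) * Jt α z) (𝓝[cone M β] (Complex.I * (β : ℂ)))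
      (𝓝 (1 + γ * c)) := tendsto_const_nhds.add (hJ.const_mul _)
  refine h1.inv₀ (fun h0 => ?_)
  have h2 : 1 ≤ ‖1 + (γ : ℂ) * c‖ := ge_of_tendsto h1.norm
    ((eventually_mem_cone M β).mono fun z hz => one_le_norm_one_add_Jt hα hγ hz.1)
  rw [h0, norm_zero] at h2
  linarith

/-- At a critical value g̃ vanishes, whatever Im J̃ does, because |1 + γJ̃| ≥ 1 + γ Re J̃. -/
theorem tendsto_gt_of_tendsto_re_Jt (hα : AdmissibleCoupling α) {γ : ℝ} (hγ : 0 < γ) {M β : ℝ}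
    (h : Tendsto (fun z : ℂ => (∫ k in (-1 / 2 : ℝ)..(1 / 2),
      (z - Complex.I * (oddDisp α k : ℂ))⁻¹).re) (𝓝[cone M β] (Complex.I * (β : ℂ))) atTop) :
    Tendsto (gt α γ) (𝓝[cone M β] (Complex.I * (β : ℂ))) (𝓝 0) := by
  have hJ : Tendsto (fun z => (Jt α z).re) (𝓝[cone M β] (Complex.I * (β : ℂ))) atTop :=
    h.congr' ((eventually_mem_cone M β).mono fun z hz => by
      beta_reduce
      rw [Jt_eq_integral_inv hα hz.1])
  have h1 : Tendsto (fun z => ‖1 + (γ : ℂ) * Jt α z‖) (𝓝[cone M β] (Complex.I * (β : ℂ)))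
      atTop := by
    refine tendsto_atTop_mono (fun z => ?_) (tendsto_atTop_add_const_left _ 1
      (hJ.const_mul_atTop hγ))
    have := Complex.abs_re_le_norm (1 + (γ : ℂ) * Jt α z)
    simp only [Complex.add_re, Complex.one_re, Complex.re_ofReal_mul] at this
    exact (le_abs_self _).trans this
  rw [tendsto_zero_iff_norm_tendsto_zero]
  refine (tendsto_inv_atTop_zero.comp h1).congr (fun z => ?_)
  simp [gt]

/-- `g̃` has a nontangential boundary value at `iβ`. -/
def HasConeLimit (α : ℤ → ℝ) (γ β : ℝ) : Prop :=
  ∃ c : ℂ, ∀ M : ℝ, 0 ≤ M → Tendsto (gt α γ) (𝓝[cone M β] (Complex.I * (β : ℂ))) (𝓝 c)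

theorem hasConeLimit_of_contact (hα : AdmissibleCoupling α) {γ : ℝ} (hγ : 0 < γ)
    {k₀ C d : ℝ} (hC0 : 0 ≤ C) (hd : 0 < d)
    (hC : (∀ k ∈ Ioo k₀ (k₀ + d), k ∈ Icc (0 : ℝ) (1 / 2) ∧
        |disp α k - disp α k₀| ≤ C * |k - k₀| ^ 2) ∨
      (∀ k ∈ Ioo (k₀ - d) k₀, k ∈ Icc (0 : ℝ) (1 / 2) ∧
        |disp α k - disp α k₀| ≤ C * |k - k₀| ^ 2)) :
    HasConeLimit α γ (disp α k₀) := by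
  refine ⟨0, fun _ _ => tendsto_gt_of_tendsto_re_Jt hα hγ
    (tendsto_re_integral_inv_of_contact (k₀ := k₀) (measurable_oddDisp hα) hC0 hd
    (hC.imp (fun h k hk => ?_) (fun h k hk => ?_)))⟩
  all_goals
    obtain ⟨h1, h2⟩ := h k hk
    rw [oddDisp_of_nonneg α h1.1]
    exact ⟨⟨by linarith [h1.1], h1.2⟩, h2⟩

theorem hasConeLimit_of_gap (hα : AdmissibleCoupling α) {γ : ℝ} (hγ : 0 < γ) {β m : ℝ}
    (hm : 0 < m) (h : ∀ k, m ≤ |oddDisp α k - β|) : HasConeLimit α γ β :=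
  ⟨_, fun _ hM => tendsto_gt_of_tendsto_Jt hα hγ
    (tendsto_integral_inv_of_gap (measurable_oddDisp hα) hM hm h)⟩

theorem hasConeLimit_of_regular (hα : AdmissibleCoupling α) {γ : ℝ} (hγ : 0 < γ)
    {k₀ β c c' C : ℝ} (hk : k₀ ∈ Ioo (-1 / 2 : ℝ) (1 / 2)) (hc : 0 < c) (hc' : 0 < c')
    (hC : ∀ k ∈ Ioc (-1 / 2 : ℝ) (1 / 2),
      |oddDisp α k - β - c * (k - k₀)| ≤ C * |k - k₀| ^ 2)
    (hlow : ∀ k ∈ Ioc (-1 / 2 : ℝ) (1 / 2), c' * |k - k₀| ≤ |oddDisp α k - β|) :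
    HasConeLimit α γ β :=
  ⟨_, fun _ hM => tendsto_gt_of_tendsto_Jt hα hγ
    (exists_tendsto_integral_inv_of_regular (measurable_oddDisp hα) hM hk hc hc' hC hlow)⟩

theorem abs_oddDisp (α : ℤ → ℝ) (k : ℝ) : |oddDisp α k| = disp α k := by
  rcases le_or_gt 0 k with h | h
  · rw [oddDisp_of_nonneg α h, abs_of_nonneg (disp_nonneg _ _)]
  · rw [oddDisp_of_neg α h, abs_neg, abs_of_nonneg (disp_nonneg _ _)]

/-- Local regularity and a local lower bound at a simple point extend to the whole period. -/
theorem hasConeLimit_of_local_regular (hα : AdmissibleCoupling α) {γ : ℝ} (hγ : 0 < γ)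
    {k₀ β c C δ : ℝ} (hk : k₀ ∈ Ioo (-1 / 2 : ℝ) (1 / 2)) (hc : 0 < c) (hC0 : 0 ≤ C)
    (hδ : 0 < δ) (hβ : |β| ≤ disp α (1 / 2))
    (hC : ∀ k, |k - k₀| < δ → |oddDisp α k - β - c * (k - k₀)| ≤ C * |k - k₀| ^ 2)
    (hfar : ∀ d > 0, ∃ m > 0, ∀ k ∈ Ioc (-1 / 2 : ℝ) (1 / 2), d ≤ |k - k₀| →
      m ≤ |oddDisp α k - β|) :
    HasConeLimit α γ β := by
  -- Within distance d of k₀ the quadratic error is at most half of the linear term, which gives the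
  -- lower bound there with slope c/2.
  set d := min δ (c / (2 * (C + 1))) with hdd
  have hd : 0 < d := by positivity
  obtain ⟨m, hm, hfar⟩ := hfar d hd
  set W := disp α (1 / 2) with hW
  have hW0 : 0 ≤ W := disp_nonneg _ _
  have hle1 : ∀ k ∈ Ioc (-1 / 2 : ℝ) (1 / 2), |k - k₀| ≤ 1 := fun k hkm => by
    rw [abs_le]; constructor <;> linarith [hkm.1, hkm.2, hk.1, hk.2]
  -- Outside the window the affine deviation is at most 2W + c; dividing by d² makes this a
  -- quadratic bound on the whole period.
  refine hasConeLimit_of_regular hα hγ hk hc (c' := min (c / 2) m) (by positivity)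
    (C := C + (2 * W + c) / d ^ 2) ?_ ?_
  · intro k hkm
    rcases lt_or_ge |k - k₀| d with h | h
    · refine (hC k (h.trans_le (min_le_left _ _))).trans ?_
      gcongr
      have : 0 ≤ (2 * W + c) / d ^ 2 := by positivity
      linarith
    · have h1 : |oddDisp α k - β - c * (k - k₀)| ≤ 2 * W + c := by
        have h2 := abs_sub (oddDisp α k - β) (c * (k - k₀))
        have h3 := abs_sub (oddDisp α k) β
        rw [abs_oddDisp] at h3
        rw [abs_mul, abs_of_pos hc] at h2
        have h4 := mul_le_mul_of_nonneg_left (hle1 k hkm) hc.le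
        linarith [disp_le_half hα k]
      have h5 : (2 * W + c) ≤ (2 * W + c) / d ^ 2 * |k - k₀| ^ 2 := by
        rw [div_mul_eq_mul_div, le_div_iff₀ (by positivity)]
        gcongr
      have : 0 ≤ C * |k - k₀| ^ 2 := by positivity
      linarith
  · intro k hkm
    rcases lt_or_ge |k - k₀| d with h | h
    · have h1 := hC k (h.trans_le (min_le_left _ _))
      have h2 := abs_sub_abs_le_abs_sub (c * (k - k₀)) (oddDisp α k - β)
      rw [abs_sub_comm (c * (k - k₀)), abs_mul, abs_of_pos hc] at h2
      have h3 : C * |k - k₀| ^ 2 ≤ c / 2 * |k - k₀| := by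
        rw [sq, ← mul_assoc]
        gcongr
        have h4 := h.le.trans (min_le_right _ _)
        rw [le_div_iff₀ (by positivity)] at h4
        nlinarith [abs_nonneg (k - k₀)]
      have h5 : min (c / 2) m * |k - k₀| ≤ c / 2 * |k - k₀| := by
        gcongr
        exact min_le_left _ _
      linarith
    · calc min (c / 2) m * |k - k₀| ≤ m * 1 := by
            gcongr
            · exact min_le_right _ _
            · exact hle1 k hkm
        _ ≤ _ := by rw [mul_one]; exact hfar k hkm h

theorem disp_lt_of_lt (hα : AdmissibleCoupling α) {a b : ℝ} (ha : 0 ≤ a) (hab : a < b)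
    (hb : b ≤ 1 / 2) : disp α a < disp α b :=
  hα.unimodal ⟨ha, by linarith⟩ ⟨by linarith, hb⟩ hab

theorem disp_le_of_le (hα : AdmissibleCoupling α) {a b : ℝ} (ha : 0 ≤ a) (hab : a ≤ b)
    (hb : b ≤ 1 / 2) : disp α a ≤ disp α b :=
  hα.unimodal.monotoneOn ⟨ha, by linarith⟩ ⟨by linarith, hb⟩ hab

/-- By reflection about 1/2; the upper band edge is thus always a critical value. -/
theorem deriv_disp_half (hα : AdmissibleCoupling α) : deriv (disp α) (1 / 2) = 0 := by
  have h1 := deriv_comp_const_sub (disp α) 1 (1 / 2)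
  simp_rw [disp_one_sub hα] at h1
  rw [show (1 : ℝ) - 1 / 2 = 1 / 2 by norm_num] at h1
  linarith

/-- Each value in the band is either noncritical or reached with quadratic contact. The only
delicate point is k₀ = 0. In the gapped case the contact is quadratic. If ω(0) = 0 with positive
one-sided slope, the kink of ω disappears in the odd extension and 0 becomes a regular point. A zero
slope is again a contact. -/
theorem hasConeLimit_disp (hα : AdmissibleCoupling α) {γ : ℝ} (hγ : 0 < γ) {k₀ : ℝ}
    (hk : k₀ ∈ Icc (0 : ℝ) (1 / 2)) : HasConeLimit α γ (disp α k₀) := by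
  rcases hk.1.eq_or_lt with rfl | h0
  · rcases (disp_nonneg α 0).eq_or_lt with hz | hz
    · obtain ⟨l, C, δ, hC, hδ, hδ2, hb⟩ := exists_disp_taylor_zero hα
      simp_rw [← hz, sub_zero] at hb
      rcases lt_trichotomy l 0 with hl | hl | hl
      · exfalso
        -- A negative slope would force ω(x) < 0 here, since Cx² is at most half of |l|x.
        set x := min (δ / 2) (-l / (2 * (C + 1))) with hx
        have hx0 : 0 < x := lt_min (by linarith) (div_pos (by linarith) (by linarith))
        have hxd : x < δ := (min_le_left _ _).trans_lt (by linarith)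
        have h1 := (abs_le.1 (hb x hx0.le hxd)).2
        have h2 := min_le_right (δ / 2) (-l / (2 * (C + 1)))
        rw [← hx, le_div_iff₀ (by linarith)] at h2
        rw [sq_abs] at h1
        have h3 := disp_nonneg α x
        nlinarith
      · subst hl
        simp_rw [zero_mul, sub_zero] at hb
        refine hasConeLimit_of_contact hα hγ hC hδ (Or.inl fun k hk => ?_)
        rw [zero_add] at hk
        refine ⟨⟨hk.1.le, by linarith [hk.2]⟩, ?_⟩
        rw [← hz, sub_zero, sub_zero]
        exact hb k hk.1.le hk.2
      · rw [← hz]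
        refine hasConeLimit_of_local_regular hα hγ (k₀ := 0) (c := l) (C := C)
          (by norm_num) hl hC hδ (by simpa using disp_nonneg _ _) ?_ ?_
        · intro k hk
          rw [sub_zero] at hk
          rw [sub_zero, sub_zero]
          rcases le_or_gt 0 k with h | h
          · rw [oddDisp_of_nonneg α h]
            exact hb k h (by rwa [abs_of_nonneg h] at hk)
          · rw [oddDisp_of_neg α h]
            have := hb (-k) (by linarith) (by rwa [abs_of_neg h] at hk)
            rw [disp_neg hα, abs_neg] at this
            rw [← abs_neg]
            convert this using 2
            ring
        · intro d hd
          refine ⟨disp α (min d (1 / 2)), ?_, fun k hk hdk => ?_⟩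
          · rw [gt_iff_lt, hz]
            exact disp_lt_of_lt hα le_rfl (by positivity) (min_le_right _ _)
          · rw [sub_zero, abs_oddDisp]
            rw [sub_zero] at hdk
            have : disp α k = disp α |k| := by
              rcases abs_choice k with e | e <;> rw [e]
              rw [disp_neg hα]
            rw [this]
            refine disp_le_of_le hα (by positivity) ((min_le_left _ _).trans hdk) ?_
            rw [abs_le]
            constructor <;> linarith [hk.1, hk.2]
    · obtain ⟨C, hC⟩ := exists_disp_sub_le_of_gap hα hz
      have hC0 : 0 ≤ C := by
        have := (abs_nonneg _).trans (hC (1 / 2) ⟨by norm_num, le_rfl⟩)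
        exact nonneg_of_mul_nonneg_left this (by norm_num)
      refine hasConeLimit_of_contact hα hγ hC0 (d := 1 / 2) (by norm_num)
        (Or.inl fun k hk => ?_)
      have hk' : k ∈ Icc (0 : ℝ) (1 / 2) := ⟨hk.1.le, by linarith [hk.2]⟩
      exact ⟨hk', hC k hk'⟩
  · obtain ⟨C, δ, hC, hδ, hb⟩ := exists_disp_taylor hα (k₀ := k₀) ⟨h0, by linarith [hk.2]⟩
    by_cases hd0 : deriv (disp α) k₀ = 0
    · simp_rw [hd0, zero_mul, sub_zero] at hb
      rcases hk.2.eq_or_lt with h12 | h12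
      · refine hasConeLimit_of_contact hα hγ hC (d := min δ k₀) (by positivity)
          (Or.inr fun k hk' => ?_)
        have h1 := min_le_left δ k₀
        have h2 := min_le_right δ k₀
        refine ⟨⟨by linarith [hk'.1], by linarith [hk'.2]⟩, hb k ?_⟩
        rw [abs_of_neg (by linarith [hk'.2])]
        linarith [hk'.1]
      · refine hasConeLimit_of_contact hα hγ hC (d := min δ (1 / 2 - k₀))
          (lt_min hδ (by linarith)) (Or.inl fun k hk' => ?_)
        have h1 := min_le_left δ (1 / 2 - k₀)
        have h2 := min_le_right δ (1 / 2 - k₀)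
        refine ⟨⟨by linarith [hk'.1], by linarith [hk'.2]⟩, hb k ?_⟩
        rw [abs_of_pos (by linarith [hk'.1])]
        linarith [hk'.2]
    · have h12 : k₀ < 1 / 2 := by
        refine lt_of_le_of_ne hk.2 fun h => hd0 ?_
        rw [h, deriv_disp_half hα]
      have hdpos : 0 < deriv (disp α) k₀ := by
        refine lt_of_le_of_ne ?_ (Ne.symm hd0)
        have hmono : MonotoneOn (disp α) (Icc 0 (1 / 2)) := hα.unimodal.monotoneOn
        have hnhds : Icc (0 : ℝ) (1 / 2) ∈ 𝓝 k₀ := Icc_mem_nhds h0 h12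
        rw [← derivWithin_of_mem_nhds hnhds]
        exact hmono.derivWithin_nonneg
      refine hasConeLimit_of_local_regular hα hγ (k₀ := k₀) (δ := min δ k₀)
        ⟨by linarith, h12⟩ hdpos hC (by positivity) ?_ ?_ ?_
      · rw [abs_of_nonneg (disp_nonneg _ _)]
        exact disp_le_half hα _
      · intro k hk'
        have h1 : 0 ≤ k := by
          have := (abs_lt.1 (hk'.trans_le (min_le_right _ _))).1
          linarith
        rw [oddDisp_of_nonneg α h1]
        exact hb k (hk'.trans_le (min_le_left _ _))
      · intro d hd
        have hβ : 0 < disp α k₀ :=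
          (disp_nonneg α 0).trans_lt (disp_lt_of_lt hα le_rfl h0 hk.2)
        set p := min d (k₀ / 2) with hp
        have hp0 : 0 < p := by positivity
        have hp1 : p ≤ k₀ / 2 := min_le_right _ _
        set q := min d ((1 / 2 - k₀) / 2) with hq
        have hq0 : 0 < q := lt_min hd (by linarith)
        have hq1 : q ≤ (1 / 2 - k₀) / 2 := min_le_right _ _
        -- The three terms bound the distance to β = ω(k₀) on negative k, to the left of k₀ and to
        -- the right of k₀; the last two come from strict monotonicity, with p and q cut down so
        -- that k₀ − p and k₀ + q stay in [0, 1/2].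
        refine ⟨min (disp α k₀) (min (disp α k₀ - disp α (k₀ - p))
          (disp α (k₀ + q) - disp α k₀)), ?_, fun k hkm hdk => ?_⟩
        · refine lt_min hβ (lt_min ?_ ?_)
          · linarith [disp_lt_of_lt hα (a := k₀ - p) (b := k₀) (by linarith) (by linarith) hk.2]
          · linarith [disp_lt_of_lt hα (a := k₀) (b := k₀ + q) h0.le (by linarith) (by linarith)]
        · rcases lt_or_ge k 0 with hkn | hkn
          · refine (min_le_left _ _).trans ?_
            rw [oddDisp_of_neg α hkn, abs_sub_comm]
            refine le_trans ?_ (le_abs_self _)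
            linarith [disp_nonneg α k]
          · rw [oddDisp_of_nonneg α hkn]
            refine (min_le_right _ _).trans ?_
            rcases le_or_gt k k₀ with hkk | hkk
            · refine (min_le_left _ _).trans ?_
              rw [abs_sub_comm, abs_of_nonneg (by linarith)] at hdk
              have := disp_le_of_le hα (a := k) (b := k₀ - p) hkn
                (by linarith [min_le_left d (k₀ / 2)]) (by linarith)
              rw [abs_sub_comm]
              exact le_trans (by linarith) (le_abs_self _)
            · refine (min_le_right _ _).trans ?_
              rw [abs_of_pos (by linarith)] at hdk
              have := disp_le_of_le hα (a := k₀ + q) (b := k) (by linarith)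
                (by linarith [min_le_left d ((1 / 2 - k₀) / 2)]) hkm.2
              exact le_trans (by linarith) (le_abs_self _)

/-- J is real, so g̃ commutes with conjugation, which exchanges the cones at iβ and −iβ. -/
theorem hasConeLimit_neg {γ β : ℝ} (h : HasConeLimit α γ β) : HasConeLimit α γ (-β) := by
  obtain ⟨c, hc⟩ := h
  refine ⟨starRingEnd ℂ c, fun M hM => ?_⟩
  have h1 : Tendsto (starRingEnd ℂ) (𝓝[cone M (-β)] (Complex.I * ((-β : ℝ) : ℂ)))
      (𝓝[cone M β] (Complex.I * (β : ℂ))) := by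
    rw [tendsto_nhdsWithin_iff]
    constructor
    · have := (Complex.continuous_conj.tendsto (Complex.I * ((-β : ℝ) : ℂ)))
      simp only [map_mul, Complex.conj_I, Complex.conj_ofReal] at this
      refine Tendsto.mono_left ?_ nhdsWithin_le_nhds
      convert this using 2
      push_cast
      ring
    · filter_upwards [eventually_mem_cone M (-β)] with z hz
      refine ⟨by simpa using hz.1, ?_⟩
      have := hz.2
      rw [← abs_neg] at this
      simp only [Complex.conj_im, Complex.conj_re]
      convert this using 2
      ring
  have h2 := (Complex.continuous_conj.tendsto c).comp ((hc M hM).comp h1)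
  refine h2.congr (fun z => ?_)
  simp only [Function.comp_apply]
  rw [gt_conj, Complex.conj_conj]

/-- `g̃` has a nontangential boundary value at every point of the imaginary axis. -/
theorem hasConeLimit (hα : AdmissibleCoupling α) {γ : ℝ} (hγ : 0 < γ) (β : ℝ) :
    HasConeLimit α γ β := by
  have hpos : ∀ β : ℝ, 0 ≤ β → HasConeLimit α γ β := by
    intro β hβ
    -- β lies below the band, above it, or in it; in the last case the intermediate value theorem
    -- presents it as a value of ω on [0, 1/2].
    rcases lt_or_ge β (disp α 0) with h1 | h1
    · refine hasConeLimit_of_gap hα hγ (m := disp α 0 - β) (by linarith) fun k => ?_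
      have h2 : disp α 0 ≤ disp α k := by
        obtain ⟨k', hk', e⟩ := exists_disp_eq_of_mem hα k
        rw [e]
        exact disp_le_of_le hα le_rfl hk'.1 hk'.2
      have h3 := abs_sub_abs_le_abs_sub (oddDisp α k) β
      rw [abs_oddDisp, abs_of_nonneg hβ] at h3
      linarith
    · rcases lt_or_ge (disp α (1 / 2)) β with h2 | h2
      · refine hasConeLimit_of_gap hα hγ (m := β - disp α (1 / 2)) (by linarith) fun k => ?_
        have h3 := abs_sub_abs_le_abs_sub β (oddDisp α k)
        rw [abs_oddDisp, abs_of_nonneg hβ, abs_sub_comm] at h3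
        linarith [disp_le_half hα k]
      · obtain ⟨k, hk, rfl⟩ := intermediate_value_Icc (by norm_num : (0 : ℝ) ≤ 1 / 2)
          hα.continuous.continuousOn ⟨h1, h2⟩
        exact hasConeLimit_disp hα hγ hk
  rcases le_total 0 β with h | h
  · exact hpos β h
  · simpa using hasConeLimit_neg (hpos (-β) (by linarith))

/-- The vertical approach to `iβ` stays inside every cone. -/
theorem tendsto_vertical_cone (M β : ℝ) (hM : 0 ≤ M) :
    Tendsto (fun ε : ℝ => (ε : ℂ) + Complex.I * (β : ℂ)) (𝓝[>] 0)
      (𝓝[cone M β] (Complex.I * (β : ℂ))) := by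
  rw [tendsto_nhdsWithin_iff]
  constructor
  · have : Tendsto (fun ε : ℝ => (ε : ℂ) + Complex.I * (β : ℂ)) (𝓝 0)
        (𝓝 (((0 : ℝ) : ℂ) + Complex.I * (β : ℂ))) := Continuous.tendsto (by fun_prop) 0
    simpa using this.mono_left nhdsWithin_le_nhds
  · filter_upwards [self_mem_nhdsWithin] with ε hε
    have hε : 0 < ε := hε
    refine ⟨by simpa using hε, ?_⟩
    simp
    positivity

theorem tendsto_bdry_of_hasBdry {f : ℂ → ℂ} {β : ℝ} (h : HasBdry f β) :
    Tendsto (fun ε : ℝ => f ((ε : ℂ) + Complex.I * (β : ℂ))) (𝓝[>] 0) (𝓝 (bdry f β)) :=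
  tendsto_nhds_limUnder h

theorem hasBdry_gt (hα : AdmissibleCoupling α) {γ : ℝ} (hγ : 0 < γ) (β : ℝ) :
    HasBdry (gt α γ) β := by
  obtain ⟨c, hc⟩ := hasConeLimit hα hγ β
  exact ⟨c, (hc 0 le_rfl).comp (tendsto_vertical_cone 0 β le_rfl)⟩

theorem tendsto_gt_cone (hα : AdmissibleCoupling α) {γ : ℝ} (hγ : 0 < γ) (β : ℝ) {M : ℝ}
    (hM : 0 ≤ M) :
    Tendsto (gt α γ) (𝓝[cone M β] (Complex.I * (β : ℂ))) (𝓝 (bdry (gt α γ) β)) := by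
  obtain ⟨c, hc⟩ := hasConeLimit hα hγ β
  have h1 := (hc 0 le_rfl).comp (tendsto_vertical_cone 0 β le_rfl)
  rw [tendsto_nhds_unique (tendsto_bdry_of_hasBdry (hasBdry_gt hα hγ β)) h1]
  exact hc M hM

theorem bdry_gt_neg (hα : AdmissibleCoupling α) {γ : ℝ} (hγ : 0 < γ) (β : ℝ) :
    bdry (gt α γ) (-β) = starRingEnd ℂ (bdry (gt α γ) β) := by
  have h1 := tendsto_bdry_of_hasBdry (hasBdry_gt hα hγ (-β))
  have h2 := (Complex.continuous_conj.tendsto _).comp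
    (tendsto_bdry_of_hasBdry (hasBdry_gt hα hγ β))
  refine tendsto_nhds_unique h1 (h2.congr fun ε => ?_)
  rw [Function.comp_apply, ← gt_conj]
  congr 1
  simp

theorem hasBdry_Jgt (hα : AdmissibleCoupling α) {γ : ℝ} (hγ : 0 < γ) (β : ℝ) :
    HasBdry (Jgt α γ) β := by
  obtain ⟨c, hc⟩ := hasBdry_gt hα hγ β
  refine ⟨(1 - c) / γ, ((tendsto_const_nhds.sub hc).div_const _).congr' ?_⟩
  filter_upwards [self_mem_nhdsWithin] with ε hε
  have hε : 0 < ε := hε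
  rw [← mul_Jgt hα hγ (by simpa using hε), mul_div_cancel_left₀]
  exact Complex.ofReal_ne_zero.2 hγ.ne'

end BoundaryValues


/-! ### Flows of bounded operators and their comparison -/

section ExponentialFlow

variable {E : Type*} [NormedAddCommGroup E] [NormedSpace ℝ E]

/-- The flow `t ↦ exp(tA)v` of a bounded operator. -/
def expFlow (A : E →L[ℝ] E) (v : E) (t : ℝ) : E := NormedSpace.exp (t • A) v

theorem hasDerivAt_expFlow [CompleteSpace E] (A : E →L[ℝ] E) (v : E) (t : ℝ) :
    HasDerivAt (expFlow A v) (A (expFlow A v t)) t :=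
  ((hasDerivAt_exp_smul_const' (𝕂 := ℝ) A t).clm_apply
    (hasDerivAt_const t v)).congr_deriv (by simp [expFlow])

theorem expFlow_zero (A : E →L[ℝ] E) (v : E) : expFlow A v 0 = v := by
  rw [expFlow, zero_smul, NormedSpace.exp_zero]
  rfl

/-- Duhamel's device: the interpolation e^{(t−s)A}e^{sB}v runs from one flow to the other as s goes
from 0 to t, and its derivative involves only B − A. -/
theorem hasDerivAt_expFlow_interpolation [CompleteSpace E] (A B : E →L[ℝ] E) (v : E) (t s : ℝ) :
    HasDerivAt (fun s => expFlow A (expFlow B v s) (t - s))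
      (expFlow A (B (expFlow B v s) - A (expFlow B v s)) (t - s)) s := by
  have h := (hasDerivAt_exp_smul_const (𝕂 := ℝ) A (t - s)).comp_const_sub t s
  refine (h.clm_apply (hasDerivAt_expFlow B v s)).congr_deriv ?_
  simp only [expFlow, map_sub, neg_apply, mul_apply_eq_comp]
  abel

theorem expFlow_smul (A : E →L[ℝ] E) (c : ℝ) (v : E) (t : ℝ) :
    expFlow A (c • v) t = c • expFlow A v t := by
  simp [expFlow]

end ExponentialFlow

/-! ### Response of the chain damped at one site -/

section Response

open scoped BoundedContinuousFunction

variable {α : ℤ → ℝ}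

theorem continuous_J (hα : AdmissibleCoupling α) : Continuous (J α) := by
  have := hα.continuous
  apply intervalIntegral.continuous_parametric_intervalIntegral_of_continuous'
  unfold Function.uncurry
  fun_prop

theorem J_zero (α : ℤ → ℝ) : J α 0 = 1 := by
  simp [J]; norm_num

theorem abs_J_le_one (α : ℤ → ℝ) (t : ℝ) : |J α t| ≤ 1 := by
  have h := intervalIntegral.norm_integral_le_of_norm_le_const (a := (-1 / 2 : ℝ)) (b := 1 / 2)
    (f := fun k => Real.cos (disp α k * t)) (C := 1) (fun k _ => Real.abs_cos_le_one _)
  norm_num at h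
  simpa [J, neg_div] using h

/-- The solution with initial value `i` of `φ' = -iωφ - iγh`. -/
def resp (α : ℤ → ℝ) (γ : ℝ) (h : ℝ → ℝ) (t k : ℝ) : ℂ :=
  Complex.I * Complex.exp (-(Complex.I * disp α k) * t) - Complex.I * γ *
    ∫ s in (0 : ℝ)..t, Complex.exp (-(Complex.I * disp α k) * (t - s)) * (h s : ℂ)

/-- `h` is the momentum response of the damped chain to a unit kick. -/
structure IsResponse (α : ℤ → ℝ) (γ : ℝ) (h : ℝ → ℝ) : Prop where
  continuous : Continuous h
  volterra : ∀ t, h t = J α t - γ * ∫ s in (0 : ℝ)..t, J α (t - s) * h s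
  resolvent : ∀ t k : ℝ, Complex.I * Complex.exp (-(Complex.I * disp α k) * t) =
    resp α γ h t k + γ * ∫ s in (0 : ℝ)..t, (J α s : ℂ) * resp α γ h (t - s) k
  energy : ∀ t, 0 ≤ t → γ * ∫ s in (0 : ℝ)..t, h s ^ 2 ≤ 1 / 2
  abs_le_one : ∀ t, 0 ≤ t → |h t| ≤ 1

/-- The momentum functional on bounded continuous wave functions. -/
def momentumCLM : (ℝ →ᵇ ℂ) →L[ℝ] ℝ :=
  LinearMap.mkContinuous
    { toFun := fun f => ∫ k in (-1 / 2 : ℝ)..(1 / 2), (f k).im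
      map_add' := fun f g => by
        simp only [BoundedContinuousFunction.coe_add, Pi.add_apply, Complex.add_im]
        exact intervalIntegral.integral_add
          (Complex.continuous_im.comp f.continuous).continuousOn.intervalIntegrable
          (Complex.continuous_im.comp g.continuous).continuousOn.intervalIntegrable
      map_smul' := fun c f => by
        simp [intervalIntegral.integral_const_mul] } 1 (fun f => by
    have h := intervalIntegral.norm_integral_le_of_norm_le_const (a := (-1 / 2 : ℝ)) (b := 1 / 2)
      (f := fun k => (f k).im) (C := ‖f‖)
      (fun k _ => (Complex.abs_im_le_norm _).trans (f.norm_coe_le_norm k))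
    norm_num at h
    simpa [neg_div] using h)

theorem momentumCLM_apply (f : ℝ →ᵇ ℂ) :
    momentumCLM f = ∫ k in (-1 / 2 : ℝ)..(1 / 2), (f k).im := rfl

/-- Multiplication by `-iω`, as a bounded continuous function. -/
def freeSymbol (hα : AdmissibleCoupling α) : ℝ →ᵇ ℂ :=
  BoundedContinuousFunction.ofNormedAddCommGroup (fun k => -(Complex.I * disp α k))
    (by have := hα.continuous; fun_prop) (disp α (1 / 2)) (fun k => by
      simp only [norm_neg, norm_mul, Complex.norm_I, one_mul, Complex.norm_real,
        Real.norm_of_nonneg (disp_nonneg α k)]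
      exact disp_le_half hα k)

/-- The generator of the chain damped at one site. -/
def dampedGen (hα : AdmissibleCoupling α) (γ : ℝ) : (ℝ →ᵇ ℂ) →L[ℝ] (ℝ →ᵇ ℂ) :=
  ContinuousLinearMap.mul ℝ (ℝ →ᵇ ℂ) (freeSymbol hα) -
    momentumCLM.smulRight (BoundedContinuousFunction.const ℝ (Complex.I * γ))

theorem dampedGen_apply (hα : AdmissibleCoupling α) (γ : ℝ) (f : ℝ →ᵇ ℂ) (k : ℝ) :
    dampedGen hα γ f k = -(Complex.I * disp α k) * f k - Complex.I * γ * momentumCLM f := by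
  simp [dampedGen, freeSymbol]
  ring

/-- The damped evolution of the unit kick. -/
def dampedFlow (hα : AdmissibleCoupling α) (γ t : ℝ) : ℝ →ᵇ ℂ :=
  expFlow (dampedGen hα γ) (BoundedContinuousFunction.const ℝ Complex.I) t

theorem hasDerivAt_dampedFlow (hα : AdmissibleCoupling α) (γ t : ℝ) :
    HasDerivAt (dampedFlow hα γ) (dampedGen hα γ (dampedFlow hα γ t)) t :=
  hasDerivAt_expFlow _ _ t

theorem continuous_dampedFlow (hα : AdmissibleCoupling α) (γ : ℝ) :
    Continuous (dampedFlow hα γ) :=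
  continuous_iff_continuousAt.2 fun t => (hasDerivAt_dampedFlow hα γ t).continuousAt

theorem hasDerivAt_dampedFlow_apply (hα : AdmissibleCoupling α) (γ t k : ℝ) :
    HasDerivAt (fun s => dampedFlow hα γ s k) (-(Complex.I * disp α k) * dampedFlow hα γ t k -
      Complex.I * γ * momentumCLM (dampedFlow hα γ t)) t := by
  rw [← dampedGen_apply]
  exact (BoundedContinuousFunction.evalCLM ℝ k).hasFDerivAt.comp_hasDerivAt t
    (hasDerivAt_dampedFlow hα γ t)

theorem dampedFlow_zero (hα : AdmissibleCoupling α) (γ k : ℝ) :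
    dampedFlow hα γ 0 k = Complex.I := by
  rw [dampedFlow, expFlow_zero]
  rfl

/-- Variation of constants at fixed k, with the momentum treated as a given forcing: e^{iωs} removes
the free rotation and the rest is integrated. -/
theorem dampedFlow_eq_resp (hα : AdmissibleCoupling α) (γ t k : ℝ) :
    dampedFlow hα γ t k = resp α γ (fun s => momentumCLM (dampedFlow hα γ s)) t k := by
  set w : ℂ := Complex.I * disp α k with hw
  have hexp : ∀ s : ℝ, HasDerivAt (fun s : ℝ => Complex.exp (w * s)) (Complex.exp (w * s) * w) s :=
    fun s => by
      have := ((hasDerivAt_id (s : ℂ)).const_mul w).cexp.comp_ofReal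
      simpa using this
  have hd : ∀ s : ℝ, HasDerivAt (fun s : ℝ => Complex.exp (w * s) * dampedFlow hα γ s k)
      (-(Complex.I * γ) * (Complex.exp (w * s) * (momentumCLM (dampedFlow hα γ s) : ℂ))) s :=
    fun s => ((hexp s).mul (hasDerivAt_dampedFlow_apply hα γ s k)).congr_deriv (by ring)
  have hcont : Continuous (fun s : ℝ =>
      Complex.exp (w * s) * (momentumCLM (dampedFlow hα γ s) : ℂ)) := by
    have := momentumCLM.continuous.comp (continuous_dampedFlow hα γ)
    exact (by fun_prop : Continuous fun s : ℝ => Complex.exp (w * s)).mul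
      (Complex.continuous_ofReal.comp this)
  have hint := intervalIntegral.integral_eq_sub_of_hasDerivAt (a := 0) (b := t) (fun s _ => hd s)
    ((hcont.const_mul _).intervalIntegrable 0 t)
  rw [intervalIntegral.integral_const_mul, dampedFlow_zero] at hint
  simp only [Complex.ofReal_zero, mul_zero, Complex.exp_zero, one_mul] at hint
  have h1 : Complex.exp (-w * t) * Complex.exp (w * t) = 1 := by
    rw [← Complex.exp_add]; simp
  have h2 : ∀ s : ℝ, Complex.exp (-w * (t - s)) * (momentumCLM (dampedFlow hα γ s) : ℂ) =
      Complex.exp (-w * t) * (Complex.exp (w * s) * (momentumCLM (dampedFlow hα γ s) : ℂ)) := by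
    intro s
    rw [← mul_assoc, ← Complex.exp_add]
    ring_nf
  rw [resp, ← hw]
  simp_rw [h2]
  rw [intervalIntegral.integral_const_mul]
  linear_combination (-dampedFlow hα γ t k) * h1 - Complex.exp (-w * t) * hint

theorem dampedFlow_undamped (hα : AdmissibleCoupling α) (t k : ℝ) :
    dampedFlow hα 0 t k = Complex.I * Complex.exp (-(Complex.I * disp α k) * t) := by
  rw [dampedFlow_eq_resp, resp]
  simp

theorem im_I_mul_exp (w t : ℝ) :
    (Complex.I * Complex.exp (-(Complex.I * w) * t)).im = Real.cos (w * t) := by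
  rw [show -(Complex.I * (w : ℂ)) * (t : ℂ) = ((-(w * t) : ℝ) : ℂ) * Complex.I by push_cast; ring,
    Complex.I_mul_im, Complex.exp_ofReal_mul_I_re, Real.cos_neg]

theorem momentumCLM_undamped (hα : AdmissibleCoupling α) (t : ℝ) :
    momentumCLM (dampedFlow hα 0 t) = J α t := by
  rw [momentumCLM_apply, J]
  congr 1 with k
  rw [dampedFlow_undamped, im_I_mul_exp]

/-- Duhamel between the free and the damped flow. On the free wave the two generators differ by the
constant function iγJ(s), a multiple of the initial kick i, so the damped flow of the difference is
the damped flow itself and the equation closes. Evaluation at k and the momentum functional then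
give the two convolution identities of `IsResponse`. -/
theorem dampedFlow_resolvent (hα : AdmissibleCoupling α) (γ t : ℝ) :
    dampedFlow hα 0 t - dampedFlow hα γ t =
      ∫ s in (0 : ℝ)..t, (γ * J α s) • dampedFlow hα γ (t - s) := by
  have hd : ∀ s : ℝ, HasDerivAt (fun s : ℝ => expFlow (dampedGen hα γ) (dampedFlow hα 0 s) (t - s))
      ((γ * J α s) • dampedFlow hα γ (t - s)) s := by
    intro s
    refine (hasDerivAt_expFlow_interpolation (dampedGen hα γ) (dampedGen hα 0)
      (BoundedContinuousFunction.const ℝ Complex.I) t s).congr_deriv ?_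
    rw [dampedFlow, ← expFlow_smul]
    congr 1
    ext k
    have h1 := dampedGen_apply hα 0 (dampedFlow hα 0 s) k
    have h2 := dampedGen_apply hα γ (dampedFlow hα 0 s) k
    rw [momentumCLM_undamped] at h1 h2
    simp only [dampedFlow] at h1 h2
    rw [BoundedContinuousFunction.coe_sub, Pi.sub_apply, h1, h2,
      BoundedContinuousFunction.coe_smul]
    beta_reduce
    rw [BoundedContinuousFunction.const_apply, Complex.real_smul]
    push_cast
    ring
  have hcont : Continuous fun s => (γ * J α s) • dampedFlow hα γ (t - s) :=
    (continuous_const.mul (continuous_J hα)).smul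
      ((continuous_dampedFlow hα γ).comp (continuous_const.sub continuous_id))
  have := intervalIntegral.integral_eq_sub_of_hasDerivAt (a := 0) (b := t) (fun s _ => hd s)
    (hcont.intervalIntegrable 0 t)
  rw [this]
  simp [dampedFlow, expFlow_zero]

theorem continuous_dampedFlow_uncurry (hα : AdmissibleCoupling α) (γ : ℝ) :
    Continuous (fun p : ℝ × ℝ => dampedFlow hα γ p.1 p.2) :=
  continuous_eval.comp
    (((continuous_dampedFlow hα γ).comp continuous_fst).prodMk continuous_snd)

/-- The rotation −iω does not change |φ|², so d|φ|²/dt = −2γ h Im φ at each k; integrating over k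
turns Im φ into h. The initial energy is 1. -/
theorem dampedFlow_energy (hα : AdmissibleCoupling α) (γ t : ℝ) :
    ∫ k in (-1 / 2 : ℝ)..(1 / 2), ‖dampedFlow hα γ t k‖ ^ 2 =
      1 - 2 * γ * ∫ s in (0 : ℝ)..t, momentumCLM (dampedFlow hα γ s) ^ 2 := by
  set h := fun s => momentumCLM (dampedFlow hα γ s) with hh
  have hhc : Continuous h := momentumCLM.continuous.comp (continuous_dampedFlow hα γ)
  have hFc := continuous_dampedFlow_uncurry hα γ
  have hpt : ∀ k, ‖dampedFlow hα γ t k‖ ^ 2 =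
      1 - 2 * γ * ∫ s in (0 : ℝ)..t, h s * (dampedFlow hα γ s k).im := by
    intro k
    have hd : ∀ s : ℝ, HasDerivAt (fun s => ‖dampedFlow hα γ s k‖ ^ 2)
        (-(2 * γ) * (h s * (dampedFlow hα γ s k).im)) s := by
      intro s
      have h1 := (hasDerivAt_dampedFlow_apply hα γ s k).norm_sq
      refine h1.congr_deriv ?_
      rw [Complex.inner, Complex.mul_re]
      simp
      ring
    have hc : Continuous fun s => h s * (dampedFlow hα γ s k).im :=
      hhc.mul (Complex.continuous_im.comp (hFc.comp (continuous_id.prodMk continuous_const)))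
    have := intervalIntegral.integral_eq_sub_of_hasDerivAt (a := 0) (b := t) (fun s _ => hd s)
      ((hc.const_mul _).intervalIntegrable 0 t)
    rw [intervalIntegral.integral_const_mul, dampedFlow_zero] at this
    simp at this
    linarith
  simp_rw [hpt]
  have hc2 : Continuous fun p : ℝ × ℝ => h p.2 * (dampedFlow hα γ p.2 p.1).im :=
    (hhc.comp continuous_snd).mul
      (Complex.continuous_im.comp (hFc.comp (continuous_snd.prodMk continuous_fst)))
  have hc3 : Continuous fun k : ℝ => ∫ s in (0 : ℝ)..t, h s * (dampedFlow hα γ s k).im :=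
    intervalIntegral.continuous_parametric_intervalIntegral_of_continuous' hc2 0 t
  rw [intervalIntegral.integral_sub intervalIntegrable_const
    ((hc3.const_mul _).intervalIntegrable _ _), intervalIntegral.integral_const_mul,
    intervalIntegral_intervalIntegral_swap]
  · have : ∀ s, ∫ k in (-1 / 2 : ℝ)..(1 / 2), h s * (dampedFlow hα γ s k).im = h s ^ 2 := by
      intro s
      rw [intervalIntegral.integral_const_mul, ← momentumCLM_apply, sq]
    simp_rw [this]
    norm_num [hh]
  · apply IntegrableOn.mono_set (t := uIcc (-1 / 2 : ℝ) (1 / 2) ×ˢ uIcc 0 t)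
    · exact hc2.continuousOn.integrableOn_compact (isCompact_uIcc.prod isCompact_uIcc)
    · exact prod_mono uIoc_subset_uIcc uIoc_subset_uIcc

theorem dampedFlow_volterra (hα : AdmissibleCoupling α) (γ t : ℝ) :
    momentumCLM (dampedFlow hα γ t) = J α t - γ *
      ∫ s in (0 : ℝ)..t, J α (t - s) * momentumCLM (dampedFlow hα γ s) := by
  have h1 := congrArg momentumCLM (dampedFlow_resolvent hα γ t)
  have hcont : Continuous fun s => (γ * J α s) • dampedFlow hα γ (t - s) :=
    (continuous_const.mul (continuous_J hα)).smul
      ((continuous_dampedFlow hα γ).comp (continuous_const.sub continuous_id))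
  rw [map_sub, momentumCLM_undamped,
    ← momentumCLM.intervalIntegral_comp_comm (hcont.intervalIntegrable 0 t)] at h1
  simp only [map_smul, smul_eq_mul] at h1
  have h2 := intervalIntegral.integral_comp_sub_left (a := 0) (b := t)
    (fun s => J α s * momentumCLM (dampedFlow hα γ (t - s))) t
  simp only [sub_sub_cancel, sub_self, sub_zero] at h2
  rw [h2, ← intervalIntegral.integral_const_mul]
  simp_rw [mul_assoc] at h1
  linarith

/-- Existence of the response function. -/
theorem exists_isResponse (hα : AdmissibleCoupling α) {γ : ℝ} (hγ : 0 < γ) :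
    ∃ h : ℝ → ℝ, IsResponse α γ h := by
  have hhc : Continuous fun s => momentumCLM (dampedFlow hα γ s) :=
    momentumCLM.continuous.comp (continuous_dampedFlow hα γ)
  refine ⟨fun s => momentumCLM (dampedFlow hα γ s), hhc, dampedFlow_volterra hα γ, ?_, ?_, ?_⟩
  · intro t k
    have hcont : Continuous fun s => (γ * J α s) • dampedFlow hα γ (t - s) :=
      (continuous_const.mul (continuous_J hα)).smul
        ((continuous_dampedFlow hα γ).comp (continuous_const.sub continuous_id))
    have h1 := congrArg (BoundedContinuousFunction.evalCLM ℝ k) (dampedFlow_resolvent hα γ t)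
    rw [← (BoundedContinuousFunction.evalCLM ℝ k).intervalIntegral_comp_comm
      (hcont.intervalIntegrable 0 t)] at h1
    simp only [BoundedContinuousFunction.evalCLM_apply, BoundedContinuousFunction.coe_sub,
      Pi.sub_apply, BoundedContinuousFunction.coe_smul, Complex.real_smul] at h1
    have h3 : ∀ s : ℝ, resp α γ (fun s => momentumCLM (dampedFlow hα γ s)) s k =
      dampedFlow hα γ s k := fun s => (dampedFlow_eq_resp hα γ s k).symm
    simp_rw [h3]
    rw [← dampedFlow_undamped hα, ← intervalIntegral.integral_const_mul]
    push_cast at h1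
    simp_rw [mul_assoc] at h1
    rw [← h1]
    ring
  · intro t ht
    have h1 := dampedFlow_energy hα γ t
    have h2 : 0 ≤ ∫ k in (-1 / 2 : ℝ)..(1 / 2), ‖dampedFlow hα γ t k‖ ^ 2 :=
      intervalIntegral.integral_nonneg (by norm_num) (fun k _ => by positivity)
    linarith
  · intro t ht
    set x := momentumCLM (dampedFlow hα γ t) with hx
    have h1 := dampedFlow_energy hα γ t
    have h2 : 0 ≤ ∫ s in (0 : ℝ)..t, momentumCLM (dampedFlow hα γ s) ^ 2 :=
      intervalIntegral.integral_nonneg ht (fun k _ => by positivity)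
    have hF : Continuous (dampedFlow hα γ t) := (dampedFlow hα γ t).continuous
    have hFi : Continuous fun k => (dampedFlow hα γ t k).im := Complex.continuous_im.comp hF
    have hF2 : Continuous fun k => ‖dampedFlow hα γ t k‖ ^ 2 := hF.norm.pow 2
    have hF3 : Continuous fun k => 2 * x * (dampedFlow hα γ t k).im - x ^ 2 :=
      (hFi.const_mul _).sub continuous_const
    -- Pointwise 2x Im φ − x² ≤ (Im φ)² ≤ |φ|². Integrating with x = h(t) gives h(t)² ≤ ∫|φ|², and
    -- the energy never exceeds 1.
    have h3 : ∫ k in (-1 / 2 : ℝ)..(1 / 2), (2 * x * (dampedFlow hα γ t k).im - x ^ 2) ≤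
        ∫ k in (-1 / 2 : ℝ)..(1 / 2), ‖dampedFlow hα γ t k‖ ^ 2 := by
      apply intervalIntegral.integral_mono_on (by norm_num)
        (hF3.intervalIntegrable _ _) (hF2.intervalIntegrable _ _)
      intro k _
      rw [← Complex.normSq_eq_norm_sq, Complex.normSq_apply]
      nlinarith [sq_nonneg ((dampedFlow hα γ t k).im - x), sq_nonneg (dampedFlow hα γ t k).re]
    rw [intervalIntegral.integral_sub ((hFi.const_mul _).intervalIntegrable _ _)
      intervalIntegrable_const, intervalIntegral.integral_const_mul, ← momentumCLM_apply,
      ← hx] at h3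
    norm_num at h3
    have h4 := mul_nonneg hγ.le h2
    rw [← sq_le_one_iff_abs_le_one]
    nlinarith

end Response


/-! ### Laplace transforms of the response and the formula Γ = γ∫h² -/

section Laplace

variable {α : ℤ → ℝ} {γ : ℝ} {h : ℝ → ℝ}

theorem norm_exp_neg_I_mul (w t : ℝ) : ‖Complex.exp (-(Complex.I * w) * t)‖ = 1 := by
  rw [norm_exp_neg_mul]; simp

/-- Exponential damping makes functions of quadratic growth integrable. -/
theorem integrableOn_exp_neg_mul_of_bound {z : ℂ} (hz : 0 < z.re) {f : ℝ → ℂ} {C : ℝ}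
    (hf : AEStronglyMeasurable f (volume.restrict (Ioi 0)))
    (hb : ∀ t, 0 < t → ‖f t‖ ≤ C * (1 + t) ^ 2) :
    IntegrableOn (fun t : ℝ => Complex.exp (-z * t) * f t) (Ioi 0) := by
  -- The polynomial is absorbed by e^{2δt} = e^{(Re z)t/2}, which leaves half of the exponential
  -- decay.
  set δ := z.re / 4 with hδ
  have hδ0 : 0 < δ := by positivity
  have hC : 0 ≤ C := by
    have := (norm_nonneg _).trans (hb 1 one_pos)
    exact nonneg_of_mul_nonneg_left this (by norm_num)
  have hdom : IntegrableOn (fun t : ℝ => C * (1 + 1 / δ) ^ 2 * Real.exp (-(2 * δ) * t)) (Ioi 0) :=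
    (exp_neg_integrableOn_Ioi 0 (by positivity)).const_mul _
  refine hdom.mono' (((by fun_prop : Continuous fun t : ℝ =>
    Complex.exp (-z * t)).aestronglyMeasurable).mul hf) ?_
  refine (ae_restrict_iff' measurableSet_Ioi).2 (Eventually.of_forall fun t ht => ?_)
  have ht : 0 < t := ht
  have h1 : 1 + t ≤ (1 + 1 / δ) * Real.exp (δ * t) := by
    have h2 := Real.add_one_le_exp (δ * t)
    have h3 : (1 : ℝ) ≤ Real.exp (δ * t) := Real.one_le_exp (by positivity)
    have h4 : t ≤ 1 / δ * Real.exp (δ * t) := by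
      rw [one_div, ← div_eq_inv_mul, le_div_iff₀ hδ0]
      linarith
    linarith
  calc ‖Complex.exp (-z * t) * f t‖ ≤ Real.exp (-z.re * t) * (C * (1 + t) ^ 2) := by
        rw [norm_mul, norm_exp_neg_mul]
        gcongr
        exact hb t ht
    _ ≤ Real.exp (-z.re * t) * (C * ((1 + 1 / δ) * Real.exp (δ * t)) ^ 2) := by gcongr
    _ = C * (1 + 1 / δ) ^ 2 * (Real.exp (-z.re * t) * (Real.exp (δ * t)) ^ 2) := by ring
    _ = _ := by
        rw [← Real.exp_nat_mul, ← Real.exp_add]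
        congr 2
        rw [hδ]
        push_cast
        ring

theorem integrableOn_exp_neg_mul_of_le_one {z : ℂ} (hz : 0 < z.re) {f : ℝ → ℝ}
    (hf : Continuous f) (hb : ∀ t, 0 ≤ t → |f t| ≤ 1) :
    IntegrableOn (fun t : ℝ => Complex.exp (-z * t) * (f t : ℂ)) (Ioi 0) := by
  refine integrableOn_exp_neg_mul_of_bound hz (C := 1)
    (Complex.continuous_ofReal.comp hf).aestronglyMeasurable fun t ht => ?_
  rw [Complex.norm_real]
  refine (hb t ht.le).trans ?_
  nlinarith

/-- The Laplace transform of a convolution. -/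
theorem laplace_convolution {z : ℂ} {f g : ℝ → ℂ}
    (hf : IntegrableOn (fun t : ℝ => Complex.exp (-z * t) * f t) (Ioi 0))
    (hg : IntegrableOn (fun t : ℝ => Complex.exp (-z * t) * g t) (Ioi 0)) :
    IntegrableOn (fun t : ℝ => Complex.exp (-z * t) * ∫ s in (0 : ℝ)..t, f s * g (t - s)) (Ioi 0) ∧
    ∫ t in Ioi (0 : ℝ), Complex.exp (-z * t) * ∫ s in (0 : ℝ)..t, f s * g (t - s) =
      (∫ t in Ioi (0 : ℝ), Complex.exp (-z * t) * f t) *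
        ∫ t in Ioi (0 : ℝ), Complex.exp (-z * t) * g t := by
  have h1 := integral_posConvolution hf hg (ContinuousLinearMap.mul ℝ ℂ)
  have h2 := integrable_posConvolution hf hg (ContinuousLinearMap.mul ℝ ℂ)
  have key : ∀ x : ℝ, ∫ t in (0 : ℝ)..x, (ContinuousLinearMap.mul ℝ ℂ)
      (Complex.exp (-z * t) * f t) (Complex.exp (-z * (x - t : ℝ)) * g (x - t)) =
      Complex.exp (-z * x) * ∫ s in (0 : ℝ)..x, f s * g (x - s) := by
    intro x
    rw [← intervalIntegral.integral_const_mul]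
    congr 1 with t
    rw [ContinuousLinearMap.mul_apply']
    have : Complex.exp (-z * x) = Complex.exp (-z * t) * Complex.exp (-z * (x - t : ℝ)) := by
      rw [← Complex.exp_add]
      congr 1
      push_cast
      ring
    rw [this]
    ring
  simp_rw [key] at h1
  refine ⟨?_, h1⟩
  rw [posConvolution] at h2
  simp_rw [key] at h2
  exact (integrable_indicator_iff measurableSet_Ioi).1 h2

theorem integrableOn_exp_mul_response (hh : IsResponse α γ h) {z : ℂ} (hz : 0 < z.re) :
    IntegrableOn (fun t : ℝ => Complex.exp (-z * t) * (h t : ℂ)) (Ioi 0) :=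
  integrableOn_exp_neg_mul_of_le_one hz hh.continuous hh.abs_le_one

/-- The Volterra equation becomes h̃ = J̃ − γh̃J̃, solved by division by 1 + γJ̃ ≠ 0. -/
theorem laplace_response (hα : AdmissibleCoupling α) (hγ : 0 < γ) (hh : IsResponse α γ h)
    {z : ℂ} (hz : 0 < z.re) :
    ∫ t in Ioi (0 : ℝ), Complex.exp (-z * t) * (h t : ℂ) = Jgt α γ z := by
  have hJi := integrableOn_exp_neg_mul_of_le_one hz (continuous_J hα) (fun t _ => abs_J_le_one α t)
  have hhi := integrableOn_exp_mul_response hh hz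
  obtain ⟨hci, hc⟩ := laplace_convolution hhi hJi
  have hv : ∀ t : ℝ, Complex.exp (-z * t) * (h t : ℂ) = Complex.exp (-z * t) * (J α t : ℂ) -
      γ * (Complex.exp (-z * t) * ∫ s in (0 : ℝ)..t, (h s : ℂ) * (J α (t - s) : ℂ)) := by
    intro t
    have : ∫ s in (0 : ℝ)..t, (h s : ℂ) * (J α (t - s) : ℂ) =
        ((∫ s in (0 : ℝ)..t, J α (t - s) * h s : ℝ) : ℂ) := by
      rw [← intervalIntegral.integral_ofReal]
      congr 1 with s
      push_cast
      ring
    rw [this, hh.volterra t]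
    push_cast
    ring
  have hL : ∫ t in Ioi (0 : ℝ), Complex.exp (-z * t) * (h t : ℂ) =
      Jt α z - γ * ((∫ t in Ioi (0 : ℝ), Complex.exp (-z * t) * (h t : ℂ)) * Jt α z) := by
    conv_lhs => rw [integral_congr_ae (Eventually.of_forall hv),
      integral_sub hJi (hci.const_mul _), integral_const_mul, hc]
    rfl
  have hne := one_add_Jt_ne_zero hα hγ hz
  rw [Jgt, gt, ← div_eq_mul_inv, eq_div_iff hne]
  linear_combination hL

theorem continuous_resp (hα : AdmissibleCoupling α) (hh : Continuous h) :
    Continuous (fun p : ℝ × ℝ => resp α γ h p.1 p.2) := by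
  have hd := hα.continuous
  unfold resp
  refine Continuous.sub (by fun_prop) (continuous_const.mul ?_)
  apply intervalIntegral.continuous_parametric_intervalIntegral_of_continuous
    (f := fun (p : ℝ × ℝ) (s : ℝ) =>
      Complex.exp (-(Complex.I * disp α p.2) * (p.1 - s)) * (h s : ℂ)) _ continuous_fst
  unfold Function.uncurry
  fun_prop

theorem norm_resp_le (hγ : 0 < γ) (hh : IsResponse α γ h) {t : ℝ} (ht : 0 ≤ t) (k : ℝ) :
    ‖resp α γ h t k‖ ≤ 1 + γ * t := by
  have h1 := intervalIntegral.norm_integral_le_of_norm_le_const (a := 0) (b := t)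
    (f := fun s => Complex.exp (-(Complex.I * disp α k) * (t - s)) * (h s : ℂ)) (C := 1)
    (fun s hs => by
      rw [uIoc_of_le ht] at hs
      have := norm_exp_neg_I_mul (disp α k) (t - s)
      push_cast at this
      rw [norm_mul, this, one_mul, Complex.norm_real]
      exact hh.abs_le_one s hs.1.le)
  rw [sub_zero, one_mul, abs_of_nonneg ht] at h1
  refine (norm_sub_le _ _).trans ?_
  rw [norm_mul, norm_mul, norm_mul, norm_exp_neg_I_mul, Complex.norm_I, Complex.norm_real,
    Real.norm_of_nonneg hγ.le]
  gcongr <;> simp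

/-- Variation of constants transforms to i(1 − γh̃)/(z + iω), and 1 − γJ̃g̃ = g̃. -/
theorem laplace_resp (hα : AdmissibleCoupling α) (hγ : 0 < γ) (hh : IsResponse α γ h)
    {z : ℂ} (hz : 0 < z.re) (k : ℝ) :
    IntegrableOn (fun t : ℝ => Complex.exp (-z * t) * resp α γ h t k) (Ioi 0) ∧
    ∫ t in Ioi (0 : ℝ), Complex.exp (-z * t) * resp α γ h t k =
      Complex.I * gt α γ z * (z + Complex.I * disp α k)⁻¹ := by
  have hz' : 0 < (z + Complex.I * disp α k).re := by simpa using hz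
  have e1 : ∀ t : ℝ, Complex.exp (-z * t) * Complex.exp (-(Complex.I * disp α k) * t) =
      Complex.exp (-(z + Complex.I * disp α k) * t) := fun t => by
    rw [← Complex.exp_add]; ring_nf
  have hEi : IntegrableOn (fun t : ℝ => Complex.exp (-z * t) *
      Complex.exp (-(Complex.I * disp α k) * t)) (Ioi 0) := by
    simp_rw [e1]
    exact integrableOn_exp_neg_mul_Ioi hz'
  have hhi := integrableOn_exp_mul_response hh hz
  obtain ⟨hci, hc⟩ := laplace_convolution hhi hEi
  have e2 : ∀ t : ℝ, Complex.exp (-z * t) * resp α γ h t k =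
      Complex.I * (Complex.exp (-z * t) * Complex.exp (-(Complex.I * disp α k) * t)) -
      Complex.I * γ * (Complex.exp (-z * t) * ∫ s in (0 : ℝ)..t, (h s : ℂ) *
        Complex.exp (-(Complex.I * disp α k) * (t - s : ℝ))) := by
    intro t
    rw [resp]
    have : ∀ s : ℝ, Complex.exp (-(Complex.I * disp α k) * (t - s)) * (h s : ℂ) =
      (h s : ℂ) * Complex.exp (-(Complex.I * disp α k) * (t - s : ℝ)) := fun s => by
      push_cast; ring
    simp_rw [this]
    ring
  simp_rw [e2]
  refine ⟨(hEi.const_mul _).sub (hci.const_mul _), ?_⟩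
  rw [integral_sub (hEi.const_mul _) (hci.const_mul _), integral_const_mul, integral_const_mul, hc,
    laplace_response hα hγ hh hz]
  simp_rw [e1]
  rw [integral_exp_neg_mul_Ioi hz']
  linear_combination (-Complex.I * (z + Complex.I * disp α k)⁻¹) * mul_Jgt hα hγ hz

theorem continuous_Jt_line (hα : AdmissibleCoupling α) {x : ℝ} (hx : 0 < x) :
    Continuous (fun β : ℝ => Jt α (x + Complex.I * β)) := by
  unfold Jt
  apply continuous_of_dominated (bound := fun t => Real.exp (-x * t))
  · intro β
    have := continuous_J hα
    exact (by fun_prop : Continuous fun t : ℝ => Complex.exp (-(x + Complex.I * β) * t) *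
      (J α t : ℂ)).aestronglyMeasurable
  · intro β
    refine Eventually.of_forall fun t => ?_
    rw [norm_mul, norm_exp_neg_mul, Complex.norm_real]
    simp only [Complex.add_re, Complex.ofReal_re, Complex.mul_re, Complex.I_re, zero_mul,
      Complex.I_im, Complex.ofReal_im, mul_zero, sub_zero, add_zero]
    exact mul_le_of_le_one_right (Real.exp_pos _).le (abs_J_le_one α t)
  · exact exp_neg_integrableOn_Ioi 0 hx
  · exact Eventually.of_forall fun t => by fun_prop

theorem continuous_gt_line (hα : AdmissibleCoupling α) (hγ : 0 < γ) {x : ℝ} (hx : 0 < x) :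
    Continuous (fun β : ℝ => gt α γ (x + Complex.I * β)) := by
  unfold gt
  exact (continuous_const.add (continuous_const.mul (continuous_Jt_line hα hx))).inv₀
    fun β => one_add_Jt_ne_zero hα hγ (by simpa using hx)

theorem integrableOn_sq_response (hγ : 0 < γ) (hh : IsResponse α γ h) :
    IntegrableOn (fun t => h t ^ 2) (Ioi 0) ∧ γ * ∫ t in Ioi (0 : ℝ), h t ^ 2 ≤ 1 / 2 := by
  have hc : Continuous fun t => h t ^ 2 := hh.continuous.pow 2
  have hi : IntegrableOn (fun t => h t ^ 2) (Ioi 0) := by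
    refine integrableOn_Ioi_of_intervalIntegral_norm_bounded (1 / 2 / γ) 0
      (b := fun n : ℕ => (n : ℝ)) (l := atTop) (fun n => hc.integrableOn_Ioc)
      tendsto_natCast_atTop_atTop (Eventually.of_forall fun n => ?_)
    rw [le_div_iff₀ hγ, mul_comm]
    have := hh.energy n n.cast_nonneg
    simpa using this
  refine ⟨hi, ?_⟩
  have ht := (intervalIntegral_tendsto_integral_Ioi 0 hi tendsto_id).const_mul γ
  exact le_of_tendsto ht ((eventually_ge_atTop 0).mono fun t ht => hh.energy t ht)

/-- A majorant uniform in Re z, integrable along vertical lines. For |Im z| ≤ 2W + 1 the identity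
γJ̃g̃ = 1 − g̃ gives |J̃g̃| ≤ 2/γ; farther away |Im z ∓ ω| ≥ |Im z|/2 gives |J̃| ≤ 2/|Im z|. -/
theorem norm_Jgt_le (hα : AdmissibleCoupling α) (hγ : 0 < γ) :
    ∃ K : ℝ, 0 ≤ K ∧ ∀ z : ℂ, 0 < z.re → ‖Jgt α γ z‖ ^ 2 ≤ K * (1 + z.im ^ 2)⁻¹ := by
  set W := disp α (1 / 2) with hW
  have hW0 : 0 ≤ W := disp_nonneg _ _
  refine ⟨(2 / γ) ^ 2 * (1 + (2 * W + 1) ^ 2) + 8, by positivity, fun z hz => ?_⟩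
  rw [← div_eq_mul_inv, le_div_iff₀ (by positivity)]
  rcases le_or_gt |z.im| (2 * W + 1) with h1 | h1
  · have h2 : ‖Jgt α γ z‖ ≤ 2 / γ := by
      rw [le_div_iff₀ hγ]
      have h3 := congrArg norm (mul_Jgt hα hγ hz)
      rw [norm_mul, Complex.norm_real, Real.norm_of_nonneg hγ.le] at h3
      have h4 := norm_sub_le 1 (gt α γ z)
      rw [norm_one] at h4
      linarith [norm_gt_le_one hα hγ hz]
    have h3 : z.im ^ 2 ≤ (2 * W + 1) ^ 2 := by
      rw [← sq_abs]; gcongr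
    calc ‖Jgt α γ z‖ ^ 2 * (1 + z.im ^ 2) ≤ (2 / γ) ^ 2 * (1 + (2 * W + 1) ^ 2) := by gcongr
      _ ≤ _ := by linarith
  · have him : 0 < |z.im| := by linarith
    have h2 : ‖Jt α z‖ ≤ 2 / |z.im| := by
      rw [Jt_eq_integral_inv hα hz]
      have := intervalIntegral.norm_integral_le_of_norm_le_const (a := (-1 / 2 : ℝ)) (b := 1 / 2)
        (f := fun k => (z - Complex.I * (oddDisp α k : ℂ))⁻¹) (C := 2 / |z.im|) (fun k _ => by
          rw [norm_inv, inv_eq_one_div, div_le_div_iff₀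
            (norm_pos_iff.2 (sub_I_mul_ne_zero hz _)) him]
          have h3 := Complex.abs_im_le_norm (z - Complex.I * (oddDisp α k : ℂ))
          simp at h3
          have h4 := abs_sub_abs_le_abs_sub z.im (oddDisp α k)
          rw [abs_oddDisp] at h4
          linarith [disp_le_half hα k])
      norm_num at this
      simpa [neg_div] using this
    have h3 : ‖Jgt α γ z‖ ≤ 2 / |z.im| := by
      rw [Jgt, norm_mul]
      exact (mul_le_of_le_one_right (norm_nonneg _) (norm_gt_le_one hα hγ hz)).trans h2
    have h4 : 1 ≤ z.im ^ 2 := by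
      rw [← sq_abs]
      nlinarith
    calc ‖Jgt α γ z‖ ^ 2 * (1 + z.im ^ 2) ≤ (2 / |z.im|) ^ 2 * (2 * z.im ^ 2) := by
          gcongr; linarith
      _ = 8 := by
          rw [div_pow, sq_abs]
          have : z.im ≠ 0 := abs_pos.1 him
          field_simp
          norm_num
      _ ≤ _ := by linarith [show 0 ≤ (2 / γ) ^ 2 * (1 + (2 * W + 1) ^ 2) by positivity]

theorem integral_norm_sq_Jgt (hα : AdmissibleCoupling α) (hγ : 0 < γ) (hh : IsResponse α γ h)
    {ε : ℝ} (hε : 0 < ε) :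
    ∫ β : ℝ, ‖Jgt α γ ((ε : ℂ) + Complex.I * (β : ℂ))‖ ^ 2 =
      2 * Real.pi * ∫ t in Ioi (0 : ℝ), Real.exp (-(2 * ε) * t) * h t ^ 2 := by
  have hre : 0 < ((ε : ℂ)).re := by simpa using hε
  have h1 := integrableOn_exp_mul_response hh hre
  have hn : ∀ t : ℝ, ‖Complex.exp (-(ε : ℂ) * (t : ℂ)) * (h t : ℂ)‖ ^ 2 =
      Real.exp (-(2 * ε) * t) * h t ^ 2 := by
    intro t
    rw [norm_mul, norm_exp_neg_mul, Complex.norm_real, Real.norm_eq_abs, mul_pow, sq_abs,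
      ← Real.exp_nat_mul]
    congr 2
    simp
    ring
  have h2 : IntegrableOn (fun t : ℝ => ‖Complex.exp (-(ε : ℂ) * t) * (h t : ℂ)‖ ^ 2) (Ioi 0) := by
    refine (integrableOn_sq_response hγ hh).1.mono' ?_ ?_
    · have := hh.continuous
      exact (by fun_prop : Continuous fun t : ℝ =>
        ‖Complex.exp (-(ε : ℂ) * t) * (h t : ℂ)‖ ^ 2).aestronglyMeasurable
    · refine (ae_restrict_iff' measurableSet_Ioi).2 (Eventually.of_forall fun t ht => ?_)
      have ht : 0 < t := ht
      rw [hn, Real.norm_of_nonneg (by positivity)]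
      refine mul_le_of_le_one_left (sq_nonneg _) (Real.exp_le_one_iff.2 ?_)
      nlinarith
  have h3 := (plancherel_laplace h1 h2).2
  simp_rw [hn] at h3
  rw [← h3]
  congr 1 with β
  rw [← laplace_response hα hγ hh (by simpa using hε)]
  congr 3 with t
  rw [← mul_assoc, ← Complex.exp_add]
  congr 2
  ring

/-- Plancherel is applied on the lines Re z = ε, because h is known to be square integrable but not
integrable. Then ε → 0 under the majorants of `norm_Jgt_le` on one side and h² on the other. -/
theorem bdry_Jgt_sq (hα : AdmissibleCoupling α) (hγ : 0 < γ) (hh : IsResponse α γ h) :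
    Integrable (fun β : ℝ => ‖bdry (Jgt α γ) β‖ ^ 2) ∧
      Gam α γ = γ * ∫ t in Ioi (0 : ℝ), h t ^ 2 := by
  obtain ⟨K, hK0, hK⟩ := norm_Jgt_le hα hγ
  have hlim : ∀ β : ℝ, Tendsto (fun ε : ℝ => ‖Jgt α γ ((ε : ℂ) + Complex.I * (β : ℂ))‖ ^ 2)
      (𝓝[>] 0) (𝓝 (‖bdry (Jgt α γ) β‖ ^ 2)) := fun β =>
    (tendsto_bdry_of_hasBdry (hasBdry_Jgt hα hγ β)).norm.pow 2
  have hdomi : Integrable (fun β : ℝ => K * (1 + β ^ 2)⁻¹) :=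
    integrable_inv_one_add_sq.const_mul K
  have hmeas : ∀ ε : ℝ, 0 < ε →
      Continuous fun β : ℝ => ‖Jgt α γ ((ε : ℂ) + Complex.I * (β : ℂ))‖ ^ 2 := fun ε hε =>
    ((continuous_Jt_line hα hε).mul (continuous_gt_line hα hγ hε)).norm.pow 2
  have hbd : ∀ ε : ℝ, 0 < ε → ∀ β : ℝ,
      ‖‖Jgt α γ ((ε : ℂ) + Complex.I * (β : ℂ))‖ ^ 2‖ ≤ K * (1 + β ^ 2)⁻¹ := by
    intro ε hε β
    rw [Real.norm_of_nonneg (by positivity)]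
    simpa using hK ((ε : ℂ) + Complex.I * (β : ℂ)) (by simpa using hε)
  have hpos : ∀ᶠ ε : ℝ in 𝓝[>] 0, 0 < ε := self_mem_nhdsWithin
  have h1 := tendsto_integral_filter_of_dominated_convergence (μ := volume) (l := 𝓝[>] (0 : ℝ))
    (F := fun (ε : ℝ) (β : ℝ) => ‖Jgt α γ ((ε : ℂ) + Complex.I * (β : ℂ))‖ ^ 2)
    (f := fun β => ‖bdry (Jgt α γ) β‖ ^ 2)
    (fun β : ℝ => K * (1 + β ^ 2)⁻¹)
    (hpos.mono fun ε hε => (hmeas ε hε).aestronglyMeasurable)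
    (hpos.mono fun ε hε => Eventually.of_forall (hbd ε hε)) hdomi
    (Eventually.of_forall hlim)
  have h2 : Tendsto (fun ε : ℝ => 2 * Real.pi *
      ∫ t in Ioi (0 : ℝ), Real.exp (-(2 * ε) * t) * h t ^ 2) (𝓝[>] 0)
      (𝓝 (2 * Real.pi * ∫ t in Ioi (0 : ℝ), h t ^ 2)) := by
    refine Tendsto.const_mul _ ?_
    have hhc := hh.continuous
    refine tendsto_integral_filter_of_dominated_convergence (fun t => h t ^ 2)
      (Eventually.of_forall fun ε => (by fun_prop : Continuous fun t : ℝ =>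
        Real.exp (-(2 * ε) * t) * h t ^ 2).aestronglyMeasurable) ?_
      (integrableOn_sq_response hγ hh).1 ?_
    · refine hpos.mono fun ε hε => ?_
      refine (ae_restrict_iff' measurableSet_Ioi).2 (Eventually.of_forall fun t ht => ?_)
      have ht : 0 < t := ht
      rw [Real.norm_of_nonneg (by positivity)]
      refine mul_le_of_le_one_left (sq_nonneg _) (Real.exp_le_one_iff.2 ?_)
      nlinarith
    · refine Eventually.of_forall fun t => ?_
      have : Tendsto (fun ε : ℝ => Real.exp (-(2 * ε) * t) * h t ^ 2) (𝓝 0)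
          (𝓝 (Real.exp (-(2 * 0) * t) * h t ^ 2)) := Continuous.tendsto (by fun_prop) 0
      simpa using this.mono_left nhdsWithin_le_nhds
  have h3 : ∫ β : ℝ, ‖bdry (Jgt α γ) β‖ ^ 2 = 2 * Real.pi * ∫ t in Ioi (0 : ℝ), h t ^ 2 :=
    tendsto_nhds_unique h1 (h2.congr' (hpos.mono fun ε hε =>
      (integral_norm_sq_Jgt hα hγ hh hε).symm))
  refine ⟨?_, ?_⟩
  · refine hdomi.mono' ?_ (Eventually.of_forall fun β => ?_)
    · have hseq : Tendsto (fun n : ℕ => 1 / ((n : ℝ) + 1)) atTop (𝓝[>] 0) :=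
        tendsto_nhdsWithin_iff.2 ⟨tendsto_one_div_add_atTop_nhds_zero_nat,
          Eventually.of_forall fun n => mem_Ioi.2 Nat.one_div_pos_of_nat⟩
      exact aestronglyMeasurable_of_tendsto_ae atTop
        (fun n : ℕ => (hmeas (1 / ((n : ℝ) + 1)) Nat.one_div_pos_of_nat).aestronglyMeasurable)
        (Eventually.of_forall fun β => (hlim β).comp hseq)
    · exact le_of_tendsto (hlim β).norm (hpos.mono fun ε hε => hbd ε hε β)
  · rw [Gam, h3]
    field_simp

/-- The upper bound is the energy budget: the damping removes 2γ∫h², at most the initial energy 1.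
Positivity comes from h(0) = 1 and continuity. -/
theorem Gam_mem (hα : AdmissibleCoupling α) (hγ : 0 < γ) : Gam α γ ∈ Ioc (0 : ℝ) (1 / 2) := by
  obtain ⟨h, hh⟩ := exists_isResponse hα hγ
  rw [(bdry_Jgt_sq hα hγ hh).2]
  obtain ⟨hi, hle⟩ := integrableOn_sq_response hγ hh
  refine ⟨mul_pos hγ ?_, hle⟩
  have h0 : h 0 = 1 := by
    have := hh.volterra 0
    simpa [J_zero] using this
  have hev : ∀ᶠ t in 𝓝 (0 : ℝ), 1 / 2 < h t :=
    hh.continuous.continuousAt.eventually (lt_mem_nhds (by rw [h0]; norm_num))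
  obtain ⟨δ, hδ, hb⟩ := Metric.eventually_nhds_iff.1 hev
  calc (0 : ℝ) < δ * (1 / 4) := by positivity
    _ = ∫ t in Ioo 0 δ, (1 / 4 : ℝ) := by
        rw [setIntegral_const, measureReal_def, Real.volume_Ioo, sub_zero,
          ENNReal.toReal_ofReal hδ.le, smul_eq_mul]
    _ ≤ ∫ t in Ioo 0 δ, h t ^ 2 := by
        refine setIntegral_mono_on (integrableOn_const (by simp))
          (hi.mono_set Ioo_subset_Ioi_self) measurableSet_Ioo fun t ht => ?_
        have := hb (y := t) (by rw [Real.dist_eq, sub_zero, abs_of_pos ht.1]; exact ht.2)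
        nlinarith
    _ ≤ _ := setIntegral_mono_set hi (Eventually.of_forall fun t => sq_nonneg _)
        Ioo_subset_Ioi_self.eventuallyLE

end Laplace


/-! ### Damped waves are asymptotically free waves of amplitude ν -/

section HighFrequencyLimit

variable {α : ℤ → ℝ} {γ : ℝ} {h : ℝ → ℝ}

theorem integral_comp_affine (F : ℝ → ℝ) {ε : ℝ} (hε : 0 < ε) (c : ℝ) :
    ∫ β, F β = ε * ∫ b, F (ε * b + c) := by
  have h1 := Measure.integral_comp_mul_left (fun x => F (x + c)) ε
  rw [integral_add_right_eq_self, abs_of_pos (inv_pos.2 hε), smul_eq_mul] at h1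
  rw [h1, ← mul_assoc, mul_inv_cancel₀ hε.ne', one_mul]

/-- An integrable majorant, common to all Lorentzians whose centres are shifted by a bounded amount.
-/
theorem inv_sq_le_of_shift {x d b L : ℝ} (hx : 0 < x) (hd : |d| ≤ L) :
    (x ^ 2 + (b + d) ^ 2)⁻¹ ≤ (2 + (2 * L ^ 2 + 1) / x ^ 2) * (1 + b ^ 2)⁻¹ := by
  have hd2 : d ^ 2 ≤ L ^ 2 := by
    rw [← sq_abs d]; gcongr
  rw [← div_eq_mul_inv, le_div_iff₀ (by positivity), ← div_eq_inv_mul,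
    div_le_iff₀ (by positivity)]
  have e : (2 + (2 * L ^ 2 + 1) / x ^ 2) * (x ^ 2 + (b + d) ^ 2) =
      2 * x ^ 2 + 2 * (b + d) ^ 2 + (2 * L ^ 2 + 1) + (2 * L ^ 2 + 1) / x ^ 2 * (b + d) ^ 2 := by
    field_simp
    ring
  rw [e]
  have : 0 ≤ (2 * L ^ 2 + 1) / x ^ 2 * (b + d) ^ 2 := by positivity
  nlinarith [sq_nonneg (b + 2 * d), sq_nonneg x]

theorem norm_bdry_gt_le_one (hα : AdmissibleCoupling α) (hγ : 0 < γ) (β : ℝ) :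
    ‖bdry (gt α γ) β‖ ≤ 1 := by
  refine le_of_tendsto (tendsto_bdry_of_hasBdry (hasBdry_gt hα hγ β)).norm ?_
  filter_upwards [self_mem_nhdsWithin] with ε hε
  have hε : 0 < ε := hε
  exact norm_gt_le_one hα hγ (by simpa using hε)

/-- The free wave of complex amplitude `I * c`. -/
def freeWave (α : ℤ → ℝ) (c : ℂ) (t k : ℝ) : ℂ :=
  Complex.I * c * Complex.exp (-(Complex.I * disp α k) * t)

theorem norm_freeWave (c : ℂ) (t k : ℝ) : ‖freeWave α c t k‖ = ‖c‖ := by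
  rw [freeWave, norm_mul, norm_mul, norm_exp_neg_I_mul, Complex.norm_I, one_mul, mul_one]

theorem continuous_freeWave (c : ℂ) (k : ℝ) : Continuous fun t => freeWave α c t k := by
  unfold freeWave
  fun_prop

/-- The deviation of the damped wave from its free asymptotics. -/
def waveError (α : ℤ → ℝ) (γ : ℝ) (h : ℝ → ℝ) (c : ℂ) (t k : ℝ) : ℂ :=
  resp α γ h t k - freeWave α c t k

theorem continuous_waveError (hα : AdmissibleCoupling α) (hh : Continuous h) (c : ℂ) (k : ℝ) :
    Continuous fun t => waveError α γ h c t k :=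
  ((continuous_resp hα hh).comp (continuous_id.prodMk continuous_const)).sub
    (continuous_freeWave c k)

theorem norm_waveError_le (hγ : 0 < γ) (hh : IsResponse α γ h) {c : ℂ} (hc : ‖c‖ ≤ 1)
    {t : ℝ} (ht : 0 ≤ t) (k : ℝ) : ‖waveError α γ h c t k‖ ≤ (2 + γ) * (1 + t) := by
  refine (norm_sub_le _ _).trans ?_
  rw [norm_freeWave]
  have := norm_resp_le hγ hh ht k
  nlinarith

theorem integrableOn_exp_mul_waveError_sq (hα : AdmissibleCoupling α) (hγ : 0 < γ)
    (hh : IsResponse α γ h) {c : ℂ} (hc : ‖c‖ ≤ 1) {x : ℝ} (hx : 0 < x) (k : ℝ) :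
    IntegrableOn (fun t => Real.exp (-x * t) * ‖waveError α γ h c t k‖ ^ 2) (Ioi 0) := by
  have hcont := continuous_waveError (γ := γ) hα hh.continuous c k
  have h1 := integrableOn_exp_neg_mul_of_bound (z := (x : ℂ)) (by simpa using hx)
    (f := fun t => ((‖waveError α γ h c t k‖ ^ 2 : ℝ) : ℂ)) (C := (2 + γ) ^ 2)
    (Complex.continuous_ofReal.comp (hcont.norm.pow 2)).aestronglyMeasurable (fun t ht => by
      rw [Complex.norm_real, Real.norm_of_nonneg (by positivity), ← mul_pow]
      gcongr
      exact norm_waveError_le hγ hh hc ht.le k)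
  have h2 := h1.re
  refine h2.congr (Eventually.of_forall fun t => ?_)
  beta_reduce
  rw [show -(x : ℂ) * (t : ℂ) = ((-x * t : ℝ) : ℂ) by push_cast; ring, ← Complex.ofReal_exp,
    ← Complex.ofReal_mul]
  exact Complex.ofReal_re _

/-- The Laplace transform of the error is i(g̃(z) − c)/(z + iω(k)); Plancherel on Re z = x turns its
modulus squared into the right-hand side. -/
theorem integral_waveError_sq (hα : AdmissibleCoupling α) (hγ : 0 < γ) (hh : IsResponse α γ h)
    {c : ℂ} (hc : ‖c‖ ≤ 1) {x : ℝ} (hx : 0 < x) (k : ℝ) :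
    2 * Real.pi * ∫ t in Ioi (0 : ℝ), Real.exp (-(2 * x) * t) * ‖waveError α γ h c t k‖ ^ 2 =
      ∫ β : ℝ, ‖gt α γ (x + Complex.I * β) - c‖ ^ 2 * (x ^ 2 + (β + disp α k) ^ 2)⁻¹ := by
  have hre : 0 < (x : ℂ).re := by simpa using hx
  have hcont := continuous_waveError (γ := γ) hα hh.continuous c k
  have hi : IntegrableOn (fun t : ℝ => Complex.exp (-(x : ℂ) * t) * waveError α γ h c t k)
      (Ioi 0) := by
    refine integrableOn_exp_neg_mul_of_bound hre (C := 2 + γ) hcont.aestronglyMeasurable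
      fun t ht => (norm_waveError_le hγ hh hc ht.le k).trans ?_
    gcongr
    nlinarith
  have hsq : ∀ t : ℝ, ‖Complex.exp (-(x : ℂ) * t) * waveError α γ h c t k‖ ^ 2 =
      Real.exp (-(2 * x) * t) * ‖waveError α γ h c t k‖ ^ 2 := by
    intro t
    rw [norm_mul, norm_exp_neg_mul, mul_pow, ← Real.exp_nat_mul]
    congr 2
    simp
    ring
  have hi2 : IntegrableOn
      (fun t : ℝ => ‖Complex.exp (-(x : ℂ) * t) * waveError α γ h c t k‖ ^ 2) (Ioi 0) := by
    simp_rw [hsq]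
    exact integrableOn_exp_mul_waveError_sq hα hγ hh hc (by positivity) k
  have h1 := (plancherel_laplace hi hi2).2
  simp_rw [hsq] at h1
  rw [← h1]
  congr 1 with β
  have hz : 0 < ((x : ℂ) + Complex.I * β).re := by simpa using hx
  have hz' : 0 < ((x : ℂ) + Complex.I * β + Complex.I * disp α k).re := by simpa using hx
  have e : ∀ t : ℝ, Complex.exp (-(Complex.I * β) * t) *
      (Complex.exp (-(x : ℂ) * t) * waveError α γ h c t k) =
      Complex.exp (-((x : ℂ) + Complex.I * β) * t) * resp α γ h t k -
        Complex.I * c * Complex.exp (-((x : ℂ) + Complex.I * β + Complex.I * disp α k) * t) := by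
    intro t
    have e1 : Complex.exp (-((x : ℂ) + Complex.I * β) * t) =
        Complex.exp (-(Complex.I * β) * t) * Complex.exp (-(x : ℂ) * t) := by
      rw [← Complex.exp_add]; ring_nf
    have e2 : Complex.exp (-((x : ℂ) + Complex.I * β + Complex.I * disp α k) * t) =
        Complex.exp (-(Complex.I * β) * t) * Complex.exp (-(x : ℂ) * t) *
          Complex.exp (-(Complex.I * disp α k) * t) := by
      rw [← Complex.exp_add, ← Complex.exp_add]; ring_nf
    rw [e1, e2, waveError, freeWave]
    ring
  simp_rw [e]
  obtain ⟨hr1, hr2⟩ := laplace_resp hα hγ hh hz k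
  rw [integral_sub hr1 ((integrableOn_exp_neg_mul_Ioi hz').const_mul _), hr2, integral_const_mul,
    integral_exp_neg_mul_Ioi hz', ← sub_mul, ← mul_sub, norm_mul, norm_mul, Complex.norm_I,
    one_mul, mul_pow, norm_inv, inv_pow, ← Complex.normSq_eq_norm_sq
      ((x : ℂ) + Complex.I * β + Complex.I * disp α k), Complex.normSq_apply]
  simp [sq]

/-- Under β = εb − ω(k), the point where g̃ is evaluated tends to −iω(k) inside a fixed cone for
each b, so g̃ − c → 0. The Lorentzian keeps width y and is shifted by (ω(k + εθ) − ω(k))/ε, which is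
bounded since ω is Lipschitz at k. Dominated convergence in b concludes. -/
theorem tendsto_waveError (hα : AdmissibleCoupling α) (hγ : 0 < γ) (hh : IsResponse α γ h)
    {x : ℝ} (hx : 0 < x) (k θ : ℝ) :
    Tendsto (fun ε : ℝ => ε * ∫ t in Ioi (0 : ℝ), Real.exp (-(ε * x) * t) *
      ‖waveError α γ h (bdry (gt α γ) (-disp α k)) t (k + ε * θ)‖ ^ 2) (𝓝[>] 0) (𝓝 0) := by
  set c := bdry (gt α γ) (-disp α k) with hc
  have hc1 : ‖c‖ ≤ 1 := norm_bdry_gt_le_one hα hγ _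
  -- Plancherel on the line Re z = εy produces the weight e^{−2εyt}, hence the halving.
  set y := x / 2 with hy
  have hy0 : 0 < y := by positivity
  have hpos : ∀ᶠ ε : ℝ in 𝓝[>] 0, 0 < ε := self_mem_nhdsWithin
  obtain ⟨C, δ, hC, hδ, hLip⟩ := exists_disp_lipschitz_at hα k
  have hsmall : ∀ᶠ ε : ℝ in 𝓝[>] 0, |ε * θ| < δ := by
    have : Tendsto (fun ε : ℝ => |ε * θ|) (𝓝 0) (𝓝 |0 * θ|) := Continuous.tendsto (by fun_prop) 0
    rw [zero_mul, abs_zero] at this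
    exact (this.mono_left nhdsWithin_le_nhds).eventually (gt_mem_nhds hδ)
  set G : ℝ → ℝ → ℝ := fun ε b => ‖gt α γ ((ε * y : ℝ) + Complex.I * ((ε * b - disp α k : ℝ) : ℂ))
    - c‖ ^ 2 * (y ^ 2 + (b + (disp α (k + ε * θ) - disp α k) / ε) ^ 2)⁻¹ with hG
  have heq : ∀ ε : ℝ, 0 < ε → ε * ∫ t in Ioi (0 : ℝ), Real.exp (-(ε * x) * t) *
      ‖waveError α γ h c t (k + ε * θ)‖ ^ 2 = (2 * Real.pi)⁻¹ * ∫ b, G ε b := by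
    intro ε hε
    have h1 := integral_waveError_sq hα hγ hh hc1 (x := ε * y) (by positivity) (k + ε * θ)
    rw [integral_comp_affine _ hε (-disp α k)] at h1
    rw [show ε * x = 2 * (ε * y) by rw [hy]; ring]
    have h2 : ∀ b : ℝ, ‖gt α γ ((ε * y : ℝ) + Complex.I * ((ε * b + -disp α k : ℝ) : ℂ)) - c‖ ^ 2 *
        ((ε * y) ^ 2 + (ε * b + -disp α k + disp α (k + ε * θ)) ^ 2)⁻¹ = (ε ^ 2)⁻¹ * G ε b := by
      intro b
      rw [hG]
      dsimp only
      rw [mul_left_comm, ← mul_inv, ← sub_eq_add_neg]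
      congr 2
      field_simp
      ring
    simp_rw [h2] at h1
    rw [integral_const_mul] at h1
    field_simp at h1 ⊢
    linarith
  have hlim : Tendsto (fun ε : ℝ => ∫ b, G ε b) (𝓝[>] 0) (𝓝 (∫ _ : ℝ, (0 : ℝ))) := by
    refine tendsto_integral_filter_of_dominated_convergence
      (fun b => 4 * ((2 + (2 * (C * |θ|) ^ 2 + 1) / y ^ 2) * (1 + b ^ 2)⁻¹)) ?_ ?_
      ((integrable_inv_one_add_sq.const_mul _).const_mul _) ?_
    · refine hpos.mono fun ε hε => ?_
      have h1 : Continuous fun b : ℝ =>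
          gt α γ ((ε * y : ℝ) + Complex.I * ((ε * b - disp α k : ℝ) : ℂ)) :=
        (continuous_gt_line hα hγ (x := ε * y) (by positivity)).comp (by fun_prop)
      refine ((h1.sub continuous_const).norm.pow 2).aestronglyMeasurable.mul ?_
      exact Measurable.aestronglyMeasurable (by fun_prop)
    · filter_upwards [hpos, hsmall] with ε hε hεs
      refine Eventually.of_forall fun b => ?_
      rw [Real.norm_of_nonneg (by positivity)]
      have h1 : ‖gt α γ ((ε * y : ℝ) + Complex.I * ((ε * b - disp α k : ℝ) : ℂ)) - c‖ ^ 2 ≤ 4 := by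
        have h2 := norm_gt_le_one hα hγ
          (z := ((ε * y : ℝ) + Complex.I * ((ε * b - disp α k : ℝ) : ℂ)))
          (by simpa using mul_pos hε hy0)
        have h3 := (norm_sub_le (gt α γ ((ε * y : ℝ) +
          Complex.I * ((ε * b - disp α k : ℝ) : ℂ))) c).trans (add_le_add h2 hc1)
        have h4 := norm_nonneg (gt α γ ((ε * y : ℝ) +
          Complex.I * ((ε * b - disp α k : ℝ) : ℂ)) - c)
        nlinarith
      have h5 : |(disp α (k + ε * θ) - disp α k) / ε| ≤ C * |θ| := by
        rw [abs_div, abs_of_pos hε, div_le_iff₀ hε]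
        have := hLip (ε * θ) hεs
        rw [abs_mul, abs_of_pos hε] at this
        linarith
      have h6 := inv_sq_le_of_shift (b := b) hy0 h5
      exact mul_le_mul h1 h6 (by positivity) (by norm_num)
    · refine Eventually.of_forall fun b => ?_
      -- The approach to the vertex has slope b/y, so every aperture is needed as b varies; vertical
      -- limits of g̃ would not suffice.
      have hcone : Tendsto (fun ε : ℝ => ((ε * y : ℝ) : ℂ) +
          Complex.I * ((ε * b - disp α k : ℝ) : ℂ)) (𝓝[>] 0)
          (𝓝[cone (|b| / y) (-disp α k)] (Complex.I * ((-disp α k : ℝ) : ℂ))) := by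
        rw [tendsto_nhdsWithin_iff]
        constructor
        · have : Tendsto (fun ε : ℝ => ((ε * y : ℝ) : ℂ) +
              Complex.I * ((ε * b - disp α k : ℝ) : ℂ)) (𝓝 0)
              (𝓝 (((0 * y : ℝ) : ℂ) + Complex.I * ((0 * b - disp α k : ℝ) : ℂ))) :=
            Continuous.tendsto (by fun_prop) 0
          simpa using this.mono_left nhdsWithin_le_nhds
        · refine hpos.mono fun ε hε => ⟨by simpa using mul_pos hε hy0, ?_⟩
          simp only [Complex.add_im, Complex.ofReal_im, Complex.mul_im, Complex.I_re, zero_mul,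
            Complex.I_im, Complex.ofReal_re, one_mul, zero_add, Complex.add_re, Complex.mul_re,
            mul_zero, sub_zero, add_zero]
          rw [sub_neg_eq_add, sub_add_cancel, abs_mul, abs_of_pos hε]
          apply le_of_eq
          field_simp
      have h1 := (tendsto_gt_cone hα hγ (-disp α k) (M := |b| / y) (by positivity)).comp hcone
      have h2 : Tendsto (fun ε : ℝ => ‖gt α γ ((ε * y : ℝ) +
          Complex.I * ((ε * b - disp α k : ℝ) : ℂ)) - c‖ ^ 2 * (y ^ 2)⁻¹) (𝓝[>] 0)
          (𝓝 (‖c - c‖ ^ 2 * (y ^ 2)⁻¹)) :=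
        ((h1.sub tendsto_const_nhds).norm.pow 2).mul_const _
      rw [sub_self, norm_zero, zero_pow two_ne_zero, zero_mul] at h2
      refine squeeze_zero (fun ε => by positivity) (fun ε => ?_) h2
      rw [hG]
      dsimp only
      gcongr
      nlinarith [sq_nonneg (b + (disp α (k + ε * θ) - disp α k) / ε)]
  rw [integral_zero] at hlim
  have := hlim.const_mul (2 * Real.pi)⁻¹
  rw [mul_zero] at this
  exact this.congr' (hpos.mono fun ε hε => (heq ε hε).symm)

theorem integral_exp_neg_mul_Ioi_zero {x : ℝ} (hx : 0 < x) :
    ∫ t in Ioi (0 : ℝ), Real.exp (-x * t) = 1 / x := by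
  rw [integral_exp_mul_Ioi (by linarith)]
  simp

/-- Only squares of the wave errors are controlled; Young's inequality s ≤ s²/(2δ) + δ/2 trades the
linear terms for squares and a small constant. -/
theorem norm_conj_mul_sub_le {A A₀ B B₀ : ℂ} (hA : ‖A₀‖ ≤ 1) (hB : ‖B₀‖ ≤ 1) {δ : ℝ} (hδ : 0 < δ) :
    ‖starRingEnd ℂ A * B - starRingEnd ℂ A₀ * B₀‖ ≤
      (1 / 2 + 1 / (2 * δ)) * (‖A - A₀‖ ^ 2 + ‖B - B₀‖ ^ 2) + δ := by
  have e : starRingEnd ℂ A * B - starRingEnd ℂ A₀ * B₀ =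
      starRingEnd ℂ (A - A₀) * (B - B₀) + starRingEnd ℂ (A - A₀) * B₀ +
        starRingEnd ℂ A₀ * (B - B₀) := by
    rw [map_sub]; ring
  rw [e]
  set u := ‖A - A₀‖ with hu
  set v := ‖B - B₀‖ with hv
  have hu0 : 0 ≤ u := norm_nonneg _
  have hv0 : 0 ≤ v := norm_nonneg _
  have h1 : ‖starRingEnd ℂ (A - A₀) * (B - B₀) + starRingEnd ℂ (A - A₀) * B₀ +
        starRingEnd ℂ A₀ * (B - B₀)‖ ≤ u * v + u + v := by
    refine (norm_add₃_le).trans ?_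
    simp only [norm_mul, RCLike.norm_conj]
    have h2 : ‖A - A₀‖ * ‖B₀‖ ≤ u := mul_le_of_le_one_right hu0 hB
    have h3 : ‖A₀‖ * ‖B - B₀‖ ≤ v := mul_le_of_le_one_left hv0 hA
    linarith
  have key : ∀ s : ℝ, s ≤ 1 / (2 * δ) * s ^ 2 + δ / 2 := by
    intro s
    have : 1 / (2 * δ) * s ^ 2 + δ / 2 - s = (s - δ) ^ 2 / (2 * δ) := by
      field_simp; ring
    have h4 : 0 ≤ (s - δ) ^ 2 / (2 * δ) := by positivity
    linarith
  nlinarith [key u, key v, sq_nonneg (u - v)]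

theorem conj_freeWave_mul (c : ℂ) (t k₁ k₂ : ℝ) :
    starRingEnd ℂ (freeWave α c t k₁) * freeWave α c t k₂ =
      (‖c‖ ^ 2 : ℝ) * Complex.exp (-(Complex.I * ((disp α k₂ - disp α k₁ : ℝ) : ℂ)) * t) := by
  have e1 : starRingEnd ℂ (Complex.exp (-(Complex.I * disp α k₁) * t)) =
      Complex.exp ((Complex.I * disp α k₁) * t) := by
    rw [← Complex.exp_conj]; simp
  have e2 : starRingEnd ℂ c * c = (‖c‖ ^ 2 : ℝ) := by
    rw [Complex.conj_mul']; push_cast; rfl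
  have e3 : Complex.exp (-(Complex.I * ((disp α k₂ - disp α k₁ : ℝ) : ℂ)) * t) =
      Complex.exp ((Complex.I * disp α k₁) * t) * Complex.exp (-(Complex.I * disp α k₂) * t) := by
    rw [← Complex.exp_add]; push_cast; ring_nf
  unfold freeWave
  simp only [map_mul, Complex.conj_I, e1]
  rw [← e2, e3]
  linear_combination (-starRingEnd ℂ c * c * Complex.exp ((Complex.I * disp α k₁) * t) *
    Complex.exp (-(Complex.I * disp α k₂) * t)) * Complex.I_mul_I

/-- The two waves beat at the frequency ω(k₂) − ω(k₁); at wave numbers a distance O(ε) apart this is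
comparable with the damping ε Re z, so a nontrivial limit remains. -/
theorem laplace_freeWave_mul (c : ℂ) {z : ℂ} (hz : 0 < z.re) {ε : ℝ} (hε : 0 < ε) (k₁ k₂ : ℝ) :
    (ε : ℂ) * ∫ t in Ioi (0 : ℝ), Complex.exp (-(ε * z) * t) *
      (starRingEnd ℂ (freeWave α c t k₁) * freeWave α c t k₂) =
      (‖c‖ ^ 2 : ℝ) / (z + Complex.I * (((disp α k₂ - disp α k₁) / ε : ℝ) : ℂ)) := by
  have hre : 0 < ((ε : ℂ) * z + Complex.I * ((disp α k₂ - disp α k₁ : ℝ) : ℂ)).re := by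
    simpa using mul_pos hε hz
  have e : ∀ t : ℝ, Complex.exp (-(ε * z) * t) *
      (starRingEnd ℂ (freeWave α c t k₁) * freeWave α c t k₂) =
      (‖c‖ ^ 2 : ℝ) * Complex.exp (-((ε : ℂ) * z + Complex.I *
      ((disp α k₂ - disp α k₁ : ℝ) : ℂ)) * t) := by
    intro t
    rw [conj_freeWave_mul, mul_left_comm, ← Complex.exp_add]
    ring_nf
  simp_rw [e]
  rw [integral_const_mul, integral_exp_neg_mul_Ioi hre]
  have hε' : (ε : ℂ) ≠ 0 := Complex.ofReal_ne_zero.2 hε.ne'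
  have e4 : (ε : ℂ) * z + Complex.I * ((disp α k₂ - disp α k₁ : ℝ) : ℂ) =
      ε * (z + Complex.I * (((disp α k₂ - disp α k₁) / ε : ℝ) : ℂ)) := by
    push_cast
    field_simp
  rw [e4, mul_inv, div_eq_mul_inv]
  field_simp

theorem integrableOn_exp_mul_conj_resp_mul (hα : AdmissibleCoupling α) (hγ : 0 < γ)
    (hh : IsResponse α γ h) {z : ℂ} (hz : 0 < z.re) (k₁ k₂ : ℝ) :
    IntegrableOn (fun t : ℝ => Complex.exp (-z * t) *
      (starRingEnd ℂ (resp α γ h t k₁) * resp α γ h t k₂)) (Ioi 0) := by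
  have hr : ∀ κ : ℝ, Continuous fun t => resp α γ h t κ := fun κ =>
    (continuous_resp (γ := γ) hα hh.continuous).comp (f := fun t : ℝ => (t, κ)) (by fun_prop)
  refine integrableOn_exp_neg_mul_of_bound hz (C := (1 + γ) ^ 2)
    ((Complex.continuous_conj.comp (hr k₁)).mul (hr k₂)).aestronglyMeasurable fun t ht => ?_
  rw [norm_mul, RCLike.norm_conj, ← mul_pow, sq]
  have h1 : ∀ κ, ‖resp α γ h t κ‖ ≤ (1 + γ) * (1 + t) := fun κ =>
    (norm_resp_le hγ hh ht.le κ).trans (by nlinarith)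
  have h2 : 0 ≤ (1 + γ) * (1 + t) := (norm_nonneg _).trans (h1 0)
  exact mul_le_mul (h1 k₁) (h1 k₂) (norm_nonneg _) h2

theorem integrableOn_exp_mul_conj_freeWave_mul {c : ℂ} (hc : ‖c‖ ≤ 1) {z : ℂ} (hz : 0 < z.re)
    (k₁ k₂ : ℝ) :
    IntegrableOn (fun t : ℝ => Complex.exp (-z * t) *
      (starRingEnd ℂ (freeWave α c t k₁) * freeWave α c t k₂)) (Ioi 0) := by
  refine integrableOn_exp_neg_mul_of_bound hz (C := 1)
    ((Complex.continuous_conj.comp (continuous_freeWave c k₁)).mul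
      (continuous_freeWave c k₂)).aestronglyMeasurable fun t ht => ?_
  rw [norm_mul, RCLike.norm_conj, norm_freeWave, norm_freeWave]
  have := mul_le_one₀ hc (norm_nonneg _) hc
  nlinarith

theorem norm_laplace_resp_mul_sub_le (hα : AdmissibleCoupling α) (hγ : 0 < γ)
    (hh : IsResponse α γ h) {c : ℂ} (hc : ‖c‖ ≤ 1) {z : ℂ} (hz : 0 < z.re) {δ : ℝ} (hδ : 0 < δ)
    (k₁ k₂ : ℝ) :
    ‖(∫ t in Ioi (0 : ℝ), Complex.exp (-z * t) *
      (starRingEnd ℂ (resp α γ h t k₁) * resp α γ h t k₂)) -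
      ∫ t in Ioi (0 : ℝ), Complex.exp (-z * t) *
      (starRingEnd ℂ (freeWave α c t k₁) * freeWave α c t k₂)‖ ≤
      (1 / 2 + 1 / (2 * δ)) * ((∫ t in Ioi (0 : ℝ), Real.exp (-z.re * t) *
        ‖waveError α γ h c t k₁‖ ^ 2) +
        ∫ t in Ioi (0 : ℝ), Real.exp (-z.re * t) * ‖waveError α γ h c t k₂‖ ^ 2) + δ / z.re := by
  rw [← integral_sub (integrableOn_exp_mul_conj_resp_mul hα hγ hh hz k₁ k₂)
    (integrableOn_exp_mul_conj_freeWave_mul hc hz k₁ k₂)]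
  have hw1 := integrableOn_exp_mul_waveError_sq hα hγ hh hc hz k₁
  have hw2 := integrableOn_exp_mul_waveError_sq hα hγ hh hc hz k₂
  have hw12 : IntegrableOn (fun t => (1 / 2 + 1 / (2 * δ)) *
      (Real.exp (-z.re * t) * ‖waveError α γ h c t k₁‖ ^ 2 +
      Real.exp (-z.re * t) * ‖waveError α γ h c t k₂‖ ^ 2)) (Ioi 0) := (hw1.add hw2).const_mul _
  have hw3 : IntegrableOn (fun t : ℝ => δ * Real.exp (-z.re * t)) (Ioi 0) :=
    (exp_neg_integrableOn_Ioi 0 hz).const_mul δ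
  have hval : ∫ t in Ioi (0 : ℝ), ((1 / 2 + 1 / (2 * δ)) *
      (Real.exp (-z.re * t) * ‖waveError α γ h c t k₁‖ ^ 2 +
      Real.exp (-z.re * t) * ‖waveError α γ h c t k₂‖ ^ 2) + δ * Real.exp (-z.re * t)) =
      (1 / 2 + 1 / (2 * δ)) * ((∫ t in Ioi (0 : ℝ), Real.exp (-z.re * t) *
        ‖waveError α γ h c t k₁‖ ^ 2) +
        ∫ t in Ioi (0 : ℝ), Real.exp (-z.re * t) * ‖waveError α γ h c t k₂‖ ^ 2) + δ / z.re := by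
    rw [integral_add hw12 hw3, integral_const_mul, integral_const_mul,
      integral_add hw1 hw2, integral_exp_neg_mul_Ioi_zero hz, mul_one_div]
  rw [← hval]
  refine norm_integral_le_of_norm_le (hw12.add hw3)
    (Eventually.of_forall fun t => ?_)
  rw [← mul_sub, norm_mul, norm_exp_neg_mul]
  have h1 := norm_conj_mul_sub_le (A := resp α γ h t k₁) (B := resp α γ h t k₂)
    ((norm_freeWave (α := α) c t k₁).le.trans hc) ((norm_freeWave (α := α) c t k₂).le.trans hc) hδ
  rw [← waveError, ← waveError] at h1
  refine (mul_le_mul_of_nonneg_left h1 (Real.exp_pos _).le).trans (le_of_eq ?_)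
  ring

/-- The high-frequency limit of the Laplace transform of the bilinear product of two damped
waves. -/
theorem tendsto_laplace_resp_mul (hα : AdmissibleCoupling α) (hγ : 0 < γ) (hh : IsResponse α γ h)
    {z : ℂ} (hz : 0 < z.re) (η k : ℝ) :
    Tendsto (fun ε : ℝ => (ε : ℂ) * ∫ t in Ioi (0 : ℝ), Complex.exp (-(ε * z) * t) *
      (starRingEnd ℂ (resp α γ h t (k - ε * η / 2)) * resp α γ h t (k + ε * η / 2))) (𝓝[>] 0)
      (𝓝 ((‖nu α γ k‖ ^ 2 : ℝ) / (z + Complex.I * (dispDeriv α k * η : ℝ)))) := by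
  set c := bdry (gt α γ) (-disp α k) with hc
  have hc1 : ‖c‖ ≤ 1 := norm_bdry_gt_le_one hα hγ _
  -- The wave rotates as e^{−iωt}, so its amplitude is the boundary value of g̃ at −iω(k), the
  -- conjugate of ν(k).
  have hcν : ‖nu α γ k‖ = ‖c‖ := by
    rw [hc, bdry_gt_neg hα hγ, RCLike.norm_conj]; rfl
  have hpos : ∀ᶠ ε : ℝ in 𝓝[>] 0, 0 < ε := self_mem_nhdsWithin
  have hmainlim : Tendsto (fun ε : ℝ => (ε : ℂ) * ∫ t in Ioi (0 : ℝ), Complex.exp (-(ε * z) * t) *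
      (starRingEnd ℂ (freeWave α c t (k - ε * η / 2)) * freeWave α c t (k + ε * η / 2))) (𝓝[>] 0)
      (𝓝 ((‖nu α γ k‖ ^ 2 : ℝ) / (z + Complex.I * (dispDeriv α k * η : ℝ)))) := by
    rw [hcν]
    refine Tendsto.congr' (hpos.mono fun ε hε => (laplace_freeWave_mul c hz hε _ _).symm) ?_
    refine Tendsto.div tendsto_const_nhds (tendsto_const_nhds.add (Tendsto.const_mul _ ?_)) ?_
    · exact (Complex.continuous_ofReal.tendsto _).comp (tendsto_disp_symm_diff hα k η)
    · intro h0
      have := congrArg Complex.re h0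
      simp at this
      linarith
  have hE := (tendsto_waveError hα hγ hh hz k (-(η / 2))).add
    (tendsto_waveError hα hγ hh hz k (η / 2))
  rw [← hc, add_zero] at hE
  have hdiff : Tendsto (fun ε : ℝ => (ε : ℂ) * (∫ t in Ioi (0 : ℝ), Complex.exp (-(ε * z) * t) *
      (starRingEnd ℂ (resp α γ h t (k - ε * η / 2)) * resp α γ h t (k + ε * η / 2))) -
      (ε : ℂ) * ∫ t in Ioi (0 : ℝ), Complex.exp (-(ε * z) * t) *
      (starRingEnd ℂ (freeWave α c t (k - ε * η / 2)) * freeWave α c t (k + ε * η / 2)))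
      (𝓝[>] 0) (𝓝 0) := by
    rw [Metric.tendsto_nhds]
    intro τ hτ
    -- With δ = (Re z)τ/2 the Young remainder ε·δ/(ε Re z) is exactly τ/2.
    have hδ : 0 < z.re * (τ / 2) := by positivity
    have h1 := hE.const_mul (1 / 2 + 1 / (2 * (z.re * (τ / 2))))
    rw [mul_zero] at h1
    filter_upwards [hpos, h1.eventually (gt_mem_nhds (show (0 : ℝ) < τ / 2 by positivity))]
      with ε hε hεs
    have hre : ((ε : ℂ) * z).re = ε * z.re := by simp
    have h2 := norm_laplace_resp_mul_sub_le hα hγ hh hc1 (z := ε * z)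
      (by rw [hre]; positivity) hδ (k - ε * η / 2) (k + ε * η / 2)
    rw [hre] at h2
    rw [dist_zero_right, ← mul_sub, norm_mul, Complex.norm_real, Real.norm_of_nonneg hε.le]
    refine (mul_le_mul_of_nonneg_left h2 hε.le).trans_lt ?_
    rw [show k + ε * -(η / 2) = k - ε * η / 2 by ring,
      show k + ε * (η / 2) = k + ε * η / 2 by ring] at hεs
    have h3 : ε * (z.re * (τ / 2) / (ε * z.re)) = τ / 2 := by
      field_simp
    rw [mul_add, h3, mul_left_comm, mul_add ε]
    linarith
  have := hdiff.add hmainlim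
  simpa using this

end HighFrequencyLimit

/-! ### Counting paths and their jump times -/

section CountingPath

/-- A right-continuous monotone path with values in `ℕ`, started at `0`. -/
structure IsCountingPath (n : ℝ≥0 → ℕ) : Prop where
  zero : n 0 = 0
  mono : Monotone n
  right_cont : ∀ t, ContinuousWithinAt n (Ici t) t

/-- The time of the jump from `j` to `j + 1`, if there is one. -/
def jumpTime (n : ℝ≥0 → ℕ) (j : ℕ) : ℝ≥0 := sInf {u | j < n u}

variable {n : ℝ≥0 → ℕ} {j : ℕ} {s t u : ℝ≥0}

/-- Right-continuity makes the infimum attained. The hypothesis j < n t makes the set nonempty;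
otherwise its infimum would be the default 0. -/
theorem IsCountingPath.lt_iff_jumpTime_le (hn : IsCountingPath n) (hj : j < n t) (u : ℝ≥0) :
    j < n u ↔ jumpTime n j ≤ u := by
  refine ⟨fun h => csInf_le (OrderBot.bddBelow _) h, fun h => ?_⟩
  suffices h0 : j < n (jumpTime n j) from h0.trans_le (hn.mono h)
  have h1 : ∀ᶠ v in 𝓝[≥] jumpTime n j, n v = n (jumpTime n j) := by
    have := hn.right_cont (jumpTime n j)
    rw [ContinuousWithinAt, nhds_discrete, tendsto_pure] at this
    exact this
  obtain ⟨v, hv, hv'⟩ := (mem_nhdsGE_iff_exists_Ico_subset' (lt_add_one (jumpTime n j))).1 h1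
  obtain ⟨w, hw, hwv⟩ := exists_lt_of_csInf_lt (s := {u | j < n u}) ⟨t, hj⟩ hv
  have hw2 : n w = n (jumpTime n j) := hv' ⟨csInf_le (OrderBot.bddBelow _) hw, hwv⟩
  rw [← hw2]
  exact hw

theorem IsCountingPath.jumpTime_le (hn : IsCountingPath n) (hj : j < n t) : jumpTime n j ≤ t :=
  (hn.lt_iff_jumpTime_le hj t).1 hj

theorem IsCountingPath.jumpTime_pos (hn : IsCountingPath n) (hj : j < n t) : 0 < jumpTime n j := by
  by_contra h
  have h0 := (hn.lt_iff_jumpTime_le hj 0).2 (not_lt.1 h)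
  rw [hn.zero] at h0
  omega

theorem IsCountingPath.jumpTime_le_jumpTime (hn : IsCountingPath n) {i : ℕ} (hij : i ≤ j)
    (hj : j < n t) : jumpTime n i ≤ jumpTime n j := by
  rw [← hn.lt_iff_jumpTime_le (hij.trans_lt hj)]
  exact hij.trans_lt ((hn.lt_iff_jumpTime_le hj _).2 le_rfl)

theorem IsCountingPath.filter_jumpTime_le (hn : IsCountingPath n) (hu : u ≤ t) :
    (Finset.range (n t)).filter (fun j => jumpTime n j ≤ u) = Finset.range (n u) := by
  ext j
  simp only [Finset.mem_filter, Finset.mem_range]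
  constructor
  · rintro ⟨h1, h2⟩
    exact (hn.lt_iff_jumpTime_le h1 u).2 h2
  · intro h
    have h1 := h.trans_le (hn.mono hu)
    exact ⟨h1, (hn.lt_iff_jumpTime_le h1 u).1 h⟩

/-- Immediately to the left of s no further time of a finite family occurs, so quantities built from
past jumps have explicit left limits. -/
theorem eventually_le_iff_lt {ι X : Type*} [LinearOrder X] [TopologicalSpace X] [OrderTopology X]
    (F : Finset ι) (S : ι → X) (s : X) :
    ∀ᶠ u in 𝓝[<] s, ∀ j ∈ F, (S j ≤ u ↔ S j < s) := by
  rw [Filter.eventually_all_finset]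
  intro j _
  by_cases h : S j < s
  · filter_upwards [Ioo_mem_nhdsLT h] with u hu
    exact ⟨fun _ => h, fun _ => hu.1.le⟩
  · filter_upwards [self_mem_nhdsWithin] with u hu
    exact ⟨fun h' => h'.trans_lt hu, fun h' => absurd h' h⟩

theorem IsCountingPath.eventually_eq (hn : IsCountingPath n) (hs : s ≤ t) :
    ∀ᶠ u in 𝓝[<] s, n u = ((Finset.range (n t)).filter (fun j => jumpTime n j < s)).card := by
  filter_upwards [eventually_le_iff_lt (Finset.range (n t)) (jumpTime n) s, self_mem_nhdsWithin]
    with u hu hus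
  rw [← Finset.filter_congr hu, hn.filter_jumpTime_le (hus.le.trans hs), Finset.card_range]

theorem leftLim_eq_of_tendsto_pos {F : ℝ≥0 → ℝ} {a : ℝ} (hs : 0 < s)
    (h : Tendsto F (𝓝[<] s) (𝓝 a)) : Function.leftLim F s = a :=
  have := nhdsLT_neBot_of_exists_lt ⟨0, hs⟩
  leftLim_eq_of_tendsto h

theorem IsCountingPath.leftLim_cast (hn : IsCountingPath n) (h0 : 0 < s) (hs : s ≤ t) :
    Function.leftLim (fun r => (n r : ℝ)) s =
      ((Finset.range (n t)).filter (fun j => jumpTime n j < s)).card := by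
  refine leftLim_eq_of_tendsto_pos h0 (tendsto_const_nhds.congr' ?_)
  filter_upwards [hn.eventually_eq hs] with u hu
  rw [hu]

/-- A jump of size greater than one appears as several indices with the same jump time, so
multiplicity replaces the size. Simplicity of the jumps is never required. -/
theorem IsCountingPath.jump_eq (hn : IsCountingPath n) (h0 : 0 < s) (hs : s ≤ t) :
    (n s : ℝ) - Function.leftLim (fun r => (n r : ℝ)) s =
      ((Finset.range (n t)).filter (fun j => jumpTime n j = s)).card := by
  rw [hn.leftLim_cast h0 hs, ← Finset.card_range (n s), ← hn.filter_jumpTime_le hs,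
    sub_eq_iff_eq_add, ← Nat.cast_add, ← Finset.card_union_of_disjoint]
  · congr 2
    ext j
    simp only [Finset.mem_filter, Finset.mem_union, le_iff_eq_or_lt]
    tauto
  · rw [Finset.disjoint_filter]
    intro j _ h1 h2
    exact absurd h1 h2.ne

/-- Only the finitely many jump times contribute, so the `finsum` has finite support and is a
genuine sum; grouping the indices by jump time restores the jump sizes. -/
theorem IsCountingPath.jumpIntegral_eq (hn : IsCountingPath n) (F : ℝ≥0 → ℝ) (t : ℝ≥0) :
    jumpIntegral n F t = ∑ j ∈ Finset.range (n t), Function.leftLim F (jumpTime n j) := by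
  have hmaps : ∀ j ∈ Finset.range (n t), jumpTime n j ∈ (Finset.range (n t)).image (jumpTime n) :=
    fun j hj => Finset.mem_image_of_mem _ hj
  rw [jumpIntegral, ← Finset.sum_fiberwise_of_maps_to hmaps,
    finsum_mem_eq_sum_of_inter_support_eq (t := (Finset.range (n t)).image (jumpTime n))]
  · refine Finset.sum_congr rfl fun s hs => ?_
    obtain ⟨i, hi, rfl⟩ := Finset.mem_image.1 hs
    rw [Finset.mem_range] at hi
    rw [hn.jump_eq (hn.jumpTime_pos hi) (hn.jumpTime_le hi), ← nsmul_eq_mul]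
    refine (Finset.sum_eq_card_nsmul fun j hj => ?_).symm
    rw [(Finset.mem_filter.1 hj).2]
  · ext s
    simp only [mem_inter_iff, Function.mem_support, mem_Ioc, Finset.coe_image, Set.mem_image,
      Finset.mem_coe, Finset.mem_range]
    constructor
    · rintro ⟨⟨h0, hs⟩, hne⟩
      refine ⟨?_, hne⟩
      rw [hn.jump_eq h0 hs] at hne
      have h1 := left_ne_zero_of_mul hne
      rw [Nat.cast_ne_zero, Finset.card_ne_zero] at h1
      obtain ⟨i, hi⟩ := h1
      rw [Finset.mem_filter, Finset.mem_range] at hi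
      exact ⟨i, hi⟩
    · rintro ⟨⟨i, hi, rfl⟩, hne⟩
      exact ⟨⟨hn.jumpTime_pos hi, hn.jumpTime_le hi⟩, hne⟩

end CountingPath

/-! ### Shot noise and the passage from free to damped propagation -/

section ShotNoise

/-- The shot noise `∑_{j < m, S_j ≤ s} x_j e(s - S_j)`. -/
def shot {E : Type*} [AddCommMonoid E] [SMul ℝ E] (m : ℕ) (S x : ℕ → ℝ) (e : ℝ → E) (s : ℝ) : E :=
  ∑ j ∈ Finset.range m, if S j ≤ s then x j • e (s - S j) else 0

/-- The integral of `f` against the jumps `x_j` at the times `S_j`, compensated by the drift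
`γ * q`, where `q` is the shot noise with kernel `J`. -/
def driven (α : ℤ → ℝ) (γ : ℝ) (m : ℕ) (S x : ℕ → ℝ) (f : ℝ → ℂ) (t : ℝ) : ℂ :=
  ∑ j ∈ Finset.range m, (x j : ℂ) * f (S j) +
    γ * ∫ s in (0 : ℝ)..t, ((shot m S x (J α) s : ℝ) : ℂ) * f s

theorem shot_of_le {E : Type*} [AddCommMonoid E] [SMul ℝ E] {m : ℕ} {S x : ℕ → ℝ} {e : ℝ → E}
    {s : ℝ} (hS : ∀ j < m, S j ≤ s) :
    shot m S x e s = ∑ j ∈ Finset.range m, x j • e (s - S j) :=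
  Finset.sum_congr rfl fun j hj => if_pos (hS j (Finset.mem_range.1 hj))

theorem intervalIntegrable_step {E : Type*} [NormedAddCommGroup E] {g : ℝ → E} (hg : Continuous g)
    (a b c : ℝ) : IntervalIntegrable (fun s => if a ≤ s then g s else 0) volume b c := by
  rw [intervalIntegrable_iff]
  exact ((hg.intervalIntegrable b c).def').indicator (measurableSet_Ici (a := a))

theorem integral_step {E : Type*} [NormedAddCommGroup E] [NormedSpace ℝ E] {g : ℝ → E}
    (hg : Continuous g) {a t : ℝ} (h0 : 0 ≤ a) (ht : a ≤ t) :
    ∫ s in (0 : ℝ)..t, (if a ≤ s then g s else 0) = ∫ s in a..t, g s := by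
  rw [← intervalIntegral.integral_add_adjacent_intervals (intervalIntegrable_step hg a 0 a)
    (intervalIntegrable_step hg a a t)]
  have h1 : ∫ s in (0 : ℝ)..a, (if a ≤ s then g s else 0) = ∫ _ in (0 : ℝ)..a, (0 : E) := by
    refine intervalIntegral.integral_congr_ae ?_
    filter_upwards [compl_mem_ae_iff.2 (measure_singleton a)] with s hs hs'
    rw [uIoc_of_le h0] at hs'
    exact if_neg (not_le.2 (lt_of_le_of_ne hs'.2 hs))
  have h2 : ∫ s in a..t, (if a ≤ s then g s else 0) = ∫ s in a..t, g s := by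
    refine intervalIntegral.integral_congr fun s hs => ?_
    rw [uIcc_of_le ht] at hs
    exact if_pos hs.1
  rw [h1, h2, intervalIntegral.integral_zero, zero_add]

theorem intervalIntegrable_shot {E : Type*} [NormedAddCommGroup E] [NormedSpace ℝ E] {m : ℕ}
    {S x : ℕ → ℝ} {e : ℝ → E} (he : Continuous e) (b c : ℝ) :
    IntervalIntegrable (shot m S x e) volume b c := by
  have := IntervalIntegrable.sum (μ := volume) (a := b) (b := c) (Finset.range m)
    (f := fun j s => if S j ≤ s then x j • e (s - S j) else 0)
    fun j _ => intervalIntegrable_step (by fun_prop) _ _ _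
  refine this.congr fun s _ => ?_
  simp [shot]

theorem integral_shot_mul {m : ℕ} {S x : ℕ → ℝ} {e : ℝ → ℝ} (he : Continuous e) {f : ℝ → ℂ}
    (hf : Continuous f) {t : ℝ} (hS : ∀ j < m, 0 ≤ S j ∧ S j ≤ t) :
    ∫ s in (0 : ℝ)..t, ((shot m S x e s : ℝ) : ℂ) * f s =
      ∑ j ∈ Finset.range m, (x j : ℂ) * ∫ s in S j..t, (e (s - S j) : ℂ) * f s := by
  have h1 : ∀ s, ((shot m S x e s : ℝ) : ℂ) * f s =
      ∑ j ∈ Finset.range m, if S j ≤ s then (x j : ℂ) * ((e (s - S j) : ℂ) * f s) else 0 := by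
    intro s
    rw [shot, Complex.ofReal_sum, Finset.sum_mul]
    refine Finset.sum_congr rfl fun j _ => ?_
    split_ifs
    · rw [smul_eq_mul, Complex.ofReal_mul, mul_assoc]
    · simp
  simp_rw [h1]
  rw [intervalIntegral.integral_finsetSum fun j _ => intervalIntegrable_step (by fun_prop) _ _ _]
  refine Finset.sum_congr rfl fun j hj => ?_
  obtain ⟨h2, h3⟩ := hS j (Finset.mem_range.1 hj)
  rw [integral_step (by fun_prop) h2 h3, intervalIntegral.integral_const_mul]

theorem integral_shot {m : ℕ} {S x : ℕ → ℝ} {e : ℝ → ℂ} (he : Continuous e) {t : ℝ}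
    (hS : ∀ j < m, 0 ≤ S j ∧ S j ≤ t) :
    ∫ s in (0 : ℝ)..t, shot m S x e s =
      ∑ j ∈ Finset.range m, x j • ∫ s in (0 : ℝ)..(t - S j), e s := by
  unfold shot
  rw [intervalIntegral.integral_finsetSum fun j _ => intervalIntegrable_step (by fun_prop) _ _ _]
  refine Finset.sum_congr rfl fun j hj => ?_
  obtain ⟨h2, h3⟩ := hS j (Finset.mem_range.1 hj)
  rw [integral_step (by fun_prop) h2 h3, intervalIntegral.integral_smul,
    intervalIntegral.integral_comp_sub_right (fun s => e s), sub_self]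

/-- Inserting e = f + γ J∗f in each summand and exchanging sum and integral collects Σ x_j J(s −
S_j), the momentum. So a sum of freely propagated kicks is a compensated integral with the damped
kernel f. -/
theorem shot_eq_driven {α : ℤ → ℝ} (hα : AdmissibleCoupling α) {γ : ℝ} {m : ℕ} {S x : ℕ → ℝ}
    {e f : ℝ → ℂ} (hf : Continuous f)
    (he : ∀ u, e u = f u + γ * ∫ s in (0 : ℝ)..u, (J α s : ℂ) * f (u - s)) {t : ℝ}
    (hS : ∀ j < m, 0 ≤ S j ∧ S j ≤ t) :
    shot m S x e t = driven α γ m S x (fun s => f (t - s)) t := by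
  rw [shot_of_le fun j hj => (hS j hj).2, driven, integral_shot_mul (continuous_J hα)
    (f := fun s => f (t - s)) (by fun_prop) hS, Finset.mul_sum, ← Finset.sum_add_distrib]
  refine Finset.sum_congr rfl fun j _ => ?_
  have h1 : ∫ s in S j..t, (J α (s - S j) : ℂ) * f (t - s) =
      ∫ s in (0 : ℝ)..(t - S j), (J α s : ℂ) * f (t - S j - s) := by
    have := intervalIntegral.integral_comp_sub_right (a := S j) (b := t)
      (fun s => (J α s : ℂ) * f (t - S j - s)) (S j)
    rw [sub_self] at this
    rw [← this]
    congr 1 with s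
    ring_nf
  rw [h1, he, Complex.real_smul]
  ring

end ShotNoise

/-! ### Pathwise solution of the wave equation -/

section WaveEquation

variable {n : ℝ≥0 → ℕ} {j : ℕ} {s t : ℝ≥0}

theorem IsCountingPath.shot_eq (hn : IsCountingPath n) {E : Type*} [AddCommMonoid E] [SMul ℝ E]
    {x : ℕ → ℝ} {e : ℝ → E} (hs : s ≤ t) :
    shot (n s) (fun j => jumpTime n j) x e s = shot (n t) (fun j => jumpTime n j) x e s := by
  unfold shot
  rw [← Finset.sum_filter, ← Finset.sum_filter]
  refine Finset.sum_congr ?_ fun _ _ => rfl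
  simp only [NNReal.coe_le_coe]
  rw [hn.filter_jumpTime_le hs, hn.filter_jumpTime_le le_rfl]

theorem IsCountingPath.jumpTime_mem (hn : IsCountingPath n) :
    ∀ j < n t, 0 ≤ (jumpTime n j : ℝ) ∧ (jumpTime n j : ℝ) ≤ t :=
  fun _ hj => ⟨NNReal.coe_nonneg _, NNReal.coe_le_coe.2 (hn.jumpTime_le hj)⟩

/-- The jump terms cancel in the difference d, which satisfies d = c∫d. A primitive is continuous,
so d is continuous; then its primitive D is differentiable with D' = cD, and D e^{−cs} is constant
and vanishes at 0. -/
theorem eq_of_linear_integral_eq {c : ℂ} {φ₁ φ₂ a : ℝ≥0 → ℂ}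
    (h1 : ∀ t : ℝ≥0, IntervalIntegrable (fun s : ℝ => φ₁ s.toNNReal) volume 0 t)
    (h2 : ∀ t : ℝ≥0, IntervalIntegrable (fun s : ℝ => φ₂ s.toNNReal) volume 0 t)
    (e1 : ∀ t : ℝ≥0, φ₁ t = c * (∫ s in (0 : ℝ)..t, φ₁ s.toNNReal) + a t)
    (e2 : ∀ t : ℝ≥0, φ₂ t = c * (∫ s in (0 : ℝ)..t, φ₂ s.toNNReal) + a t) (t : ℝ≥0) :
    φ₁ t = φ₂ t := by
  set d : ℝ → ℂ := fun s => φ₁ s.toNNReal - φ₂ s.toNNReal with hd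
  have hd0 : ∀ s ≤ 0, d s = 0 := by
    intro s hs
    simp only [hd, Real.toNNReal_of_nonpos hs, e1 0, e2 0]
    simp
  have hdi : ∀ a b : ℝ, IntervalIntegrable d volume a b := by
    have h0 : ∀ b : ℝ, IntervalIntegrable d volume 0 b := by
      intro b
      rcases le_total 0 b with hb | hb
      · have := (h1 b.toNNReal).sub (h2 b.toNNReal)
        rwa [Real.coe_toNNReal _ hb] at this
      · refine (intervalIntegrable_const (c := (0 : ℂ))).congr fun s hs => ?_
        rw [uIoc_of_ge hb] at hs
        exact (hd0 s hs.2).symm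
    exact fun a b => (h0 a).symm.trans (h0 b)
  set D : ℝ → ℂ := fun s => ∫ r in (0 : ℝ)..s, d r with hD
  have hDd : ∀ s, d s = c * D s := by
    intro s
    rcases le_total 0 s with hs | hs
    · have e3 := e1 s.toNNReal
      have e4 := e2 s.toNNReal
      have h3 := h1 s.toNNReal
      have h4 := h2 s.toNNReal
      rw [Real.coe_toNNReal _ hs] at e3 e4 h3 h4
      simp only [hD, hd]
      rw [intervalIntegral.integral_sub h3 h4, e3, e4]
      ring
    · have : D s = ∫ r in (0 : ℝ)..s, (0 : ℂ) := by
        refine intervalIntegral.integral_congr fun r hr => ?_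
        rw [uIcc_of_ge hs] at hr
        exact hd0 r hr.2
      rw [hd0 s hs, this]
      simp
  have hDc : Continuous D := intervalIntegral.continuous_primitive hdi 0
  have hdc : Continuous d := by
    rw [show d = fun s => c * D s from funext hDd]
    fun_prop
  have hder : ∀ s, HasDerivAt (fun s : ℝ => D s * Complex.exp (-c * s)) 0 s := by
    intro s
    have h3 : HasDerivAt D (d s) s := hdc.integral_hasStrictDerivAt 0 s |>.hasDerivAt
    have h4 : HasDerivAt (fun s : ℝ => Complex.exp (-c * s)) (Complex.exp (-c * s) * (-c)) s := by
      have := ((Complex.ofRealCLM.hasDerivAt (x := s)).const_mul (-c)).cexp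
      simpa using this
    have h5 := h3.mul h4
    rw [hDd, show c * D s * Complex.exp (-c * s) + D s * (Complex.exp (-c * s) * -c) = 0 by ring]
      at h5
    exact h5
  have hconst := is_const_of_deriv_eq_zero (fun s => (hder s).differentiableAt)
    (fun s => (hder s).deriv) t 0
  have hD0 : D 0 = 0 := intervalIntegral.integral_same
  rw [hD0, zero_mul, mul_eq_zero, or_iff_left (Complex.exp_ne_zero _)] at hconst
  have := hDd t
  rw [hconst, mul_zero] at this
  simpa [hd, sub_eq_zero] using this

theorem exp_eq_integral (c : ℂ) (u : ℝ) :
    Complex.exp (c * u) = 1 + c * ∫ s in (0 : ℝ)..u, Complex.exp (c * s) := by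
  have h := intervalIntegral.integral_eq_sub_of_hasDerivAt (a := 0) (b := u)
    (f := fun s : ℝ => Complex.exp (c * s)) (f' := fun s : ℝ => c * Complex.exp (c * s))
    (fun s _ => by
      have := ((Complex.ofRealCLM.hasDerivAt (x := s)).const_mul c).cexp
      simpa [mul_comm] using this)
    (Continuous.intervalIntegrable (by fun_prop) _ _)
  rw [← intervalIntegral.integral_const_mul, h]
  simp

/-- A solution of the wave equation with jumps at the times of the clock is a shot noise. -/
theorem IsCountingPath.eq_shot (hn : IsCountingPath n) {w : ℝ} {φ : ℝ≥0 → ℂ} {F : ℝ≥0 → ℝ}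
    (hi : ∀ t : ℝ≥0, IntervalIntegrable (fun s : ℝ => φ s.toNNReal) volume 0 t)
    (h : ∀ t : ℝ≥0, φ t = -(Complex.I * w) * (∫ s in (0 : ℝ)..t, φ s.toNNReal) +
      Complex.I * (jumpIntegral n F t : ℂ)) (t : ℝ≥0) :
    φ t = shot (n t) (fun j => jumpTime n j) (fun j => Function.leftLim F (jumpTime n j))
      (fun u => Complex.I * Complex.exp (-(Complex.I * w) * u)) t := by
  set x := fun j => Function.leftLim F (jumpTime n j) with hx
  set e : ℝ → ℂ := fun u => Complex.I * Complex.exp (-(Complex.I * w) * u) with he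
  have hec : Continuous e := by rw [he]; fun_prop
  have hcongr : ∀ t : ℝ≥0, ∀ s ∈ uIcc (0 : ℝ) t,
      shot (n s.toNNReal) (fun j => jumpTime n j) x e s.toNNReal =
      shot (n t) (fun j => jumpTime n j) x e s := by
    intro t s hs
    rw [uIcc_of_le (NNReal.coe_nonneg t)] at hs
    rw [hn.shot_eq (Real.toNNReal_le_iff_le_coe.2 hs.2), Real.coe_toNNReal _ hs.1]
  refine eq_of_linear_integral_eq (φ₂ := fun t => shot (n t) (fun j => jumpTime n j) x e t)
    hi (fun t => ?_) h (fun t => ?_) t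
  · refine (intervalIntegrable_shot (m := n t) (S := fun j => jumpTime n j) (x := x)
      hec 0 t).congr fun s hs => ?_
    exact (hcongr t s (uIoc_subset_uIcc hs)).symm
  · rw [intervalIntegral.integral_congr (hcongr t), integral_shot hec hn.jumpTime_mem,
      shot_of_le fun j hj => (hn.jumpTime_mem j hj).2, hn.jumpIntegral_eq, Complex.ofReal_sum,
      Finset.mul_sum, Finset.mul_sum, ← Finset.sum_add_distrib]
    refine Finset.sum_congr rfl fun j _ => ?_
    simp only [he]
    rw [exp_eq_integral, intervalIntegral.integral_const_mul, Complex.real_smul, Complex.real_smul]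
    ring

theorem momentum_shot {α : ℤ → ℝ} (hα : AdmissibleCoupling α) (m : ℕ) (S x : ℕ → ℝ) (t : ℝ) :
    momentum (fun k => shot m S x
      (fun u => Complex.I * Complex.exp (-(Complex.I * disp α k) * u)) t) =
      shot m S x (J α) t := by
  have hd := hα.continuous
  have h1 : ∀ k, (shot m S x
      (fun u => Complex.I * Complex.exp (-(Complex.I * disp α k) * u)) t).im =
      ∑ j ∈ Finset.range m, if S j ≤ t then x j * Real.cos (disp α k * (t - S j)) else 0 := by
    intro k
    rw [shot, Complex.im_sum]
    refine Finset.sum_congr rfl fun j _ => ?_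
    split_ifs
    · rw [Complex.smul_im, im_I_mul_exp, smul_eq_mul]
    · rfl
  unfold momentum
  simp_rw [h1]
  rw [intervalIntegral.integral_finsetSum]
  · refine Finset.sum_congr rfl fun j _ => ?_
    split_ifs
    · rw [intervalIntegral.integral_const_mul]
      rfl
    · simp
  · intro j _
    split_ifs
    · exact Continuous.intervalIntegrable (by fun_prop) _ _
    · exact intervalIntegrable_const

/-- The number of jump times before the `j`-th one. -/
def precCount (S : ℕ → ℝ) (j : ℕ) : ℕ := ((Finset.range j).filter fun i => S i < S j).card

/-- The size of the kick of the particle at the `j`-th jump time. -/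
def kick (α : ℤ → ℝ) (μ : ℝ) (S p : ℕ → ℝ) (j : ℕ) : ℝ :=
  rho μ * p (precCount S j + 1) -
    (∑ i : Fin j, if S i < S j then kick α μ S p i * J α (S j - S i) else 0) / μ
termination_by j
decreasing_by exact i.2

theorem IsCountingPath.filter_jumpTime_lt (hn : IsCountingPath n) (hj : j < n t) :
    (Finset.range (n t)).filter (fun i => jumpTime n i < jumpTime n j) =
      (Finset.range j).filter (fun i => jumpTime n i < jumpTime n j) := by
  ext i
  simp only [Finset.mem_filter, Finset.mem_range]
  refine and_congr_left fun h => ⟨fun hi => ?_, fun hi => hi.trans hj⟩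
  by_contra hij
  exact absurd (hn.jumpTime_le_jumpTime (not_lt.1 hij) hi) (not_le.2 h)

theorem IsCountingPath.tendsto_shot (hn : IsCountingPath n) {α : ℤ → ℝ}
    (hα : AdmissibleCoupling α) (x : ℕ → ℝ) (hj : j < n t) :
    Tendsto (fun s : ℝ≥0 => shot (n s) (fun j => jumpTime n j) x (J α) s)
      (𝓝[<] jumpTime n j) (𝓝 (∑ i : Fin j, if (jumpTime n i : ℝ) < jumpTime n j then
        x i * J α (jumpTime n j - jumpTime n i) else 0)) := by
  have hc := continuous_J hα
  have h1 : Tendsto (fun s : ℝ≥0 => ∑ i ∈ (Finset.range j).filter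
      (fun i => jumpTime n i < jumpTime n j), x i * J α (s - jumpTime n i)) (𝓝[<] jumpTime n j)
      (𝓝 (∑ i ∈ (Finset.range j).filter
      (fun i => jumpTime n i < jumpTime n j), x i * J α (jumpTime n j - jumpTime n i))) := by
    refine (Continuous.tendsto ?_ _).mono_left nhdsWithin_le_nhds
    exact continuous_finsetSum _ fun i _ => by fun_prop
  have h2 := Finset.sum_filter (s := Finset.range j) (fun i => jumpTime n i < jumpTime n j)
    (fun i => x i * J α (jumpTime n j - jumpTime n i))
  rw [Finset.sum_range] at h2
  rw [h2] at h1
  simp only [NNReal.coe_lt_coe]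
  refine h1.congr' ?_
  filter_upwards [eventually_le_iff_lt (Finset.range (n t)) (jumpTime n) (jumpTime n j),
    self_mem_nhdsWithin] with s hs hsj
  rw [hn.shot_eq (hsj.le.trans (hn.jumpTime_le hj)), shot, ← Finset.sum_filter]
  simp only [NNReal.coe_le_coe, smul_eq_mul]
  rw [Finset.filter_congr hs, hn.filter_jumpTime_lt hj]

/-- The current just before a jump involves only kicks at strictly earlier times, so the implicit
equation for the kicks is the recursion defining `kick`; strong induction on j. -/
theorem IsCountingPath.leftLim_eq_kick (hn : IsCountingPath n) {α : ℤ → ℝ}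
    (hα : AdmissibleCoupling α) {μ : ℝ} {p : ℕ → ℝ} {F : ℝ≥0 → ℝ}
    (hF : ∀ s, F s = rho μ * p (n s + 1) - shot (n s) (fun j => jumpTime n j)
      (fun j => Function.leftLim F (jumpTime n j)) (J α) s / μ) (j : ℕ) (hj : j < n t) :
    Function.leftLim F (jumpTime n j) = kick α μ (fun j => jumpTime n j) p j := by
  induction j using Nat.strong_induction_on with
  | _ j ih =>
    have h1 := hn.tendsto_shot hα (fun j => Function.leftLim F (jumpTime n j)) hj
    have h2 : Tendsto (fun s => rho μ * p (n s + 1)) (𝓝[<] jumpTime n j)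
        (𝓝 (rho μ * p (precCount (fun j => jumpTime n j) j + 1))) := by
      refine tendsto_const_nhds.congr' ?_
      filter_upwards [hn.eventually_eq (hn.jumpTime_le hj)] with s hs
      rw [hs, hn.filter_jumpTime_lt hj]
      simp [precCount]
    have h3 := leftLim_eq_of_tendsto_pos (F := F) (hn.jumpTime_pos hj)
      ((h2.sub (h1.div_const μ)).congr fun s => (hF s).symm)
    rw [h3, kick]
    congr 2
    refine Finset.sum_congr rfl fun i _ => ?_
    rw [ih i i.2 (i.2.trans hj)]

/-- The solution of the stochastic wave equation with null initial datum, path by path. -/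
theorem IsCountingPath.wave_eq_shot (hn : IsCountingPath n) {α : ℤ → ℝ}
    (hα : AdmissibleCoupling α) {μ : ℝ} {p : ℕ → ℝ} {φ : ℝ≥0 → ℝ → ℂ}
    (hi : ∀ (t : ℝ≥0) k, IntervalIntegrable (fun s : ℝ => φ s.toNNReal k) volume 0 t)
    (h : ∀ (t : ℝ≥0) k, φ t k =
      -(Complex.I * disp α k) * (∫ s in (0 : ℝ)..t, φ s.toNNReal k) +
      Complex.I * (jumpIntegral n (fun s => rho μ * p (n s + 1) - momentum (φ s) / μ) t : ℂ))
    (t : ℝ≥0) (k : ℝ) :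
    φ t k = shot (n t) (fun j => jumpTime n j) (kick α μ (fun j => jumpTime n j) p)
      (fun u => Complex.I * Complex.exp (-(Complex.I * disp α k) * u)) t := by
  have h1 := fun t k => hn.eq_shot (fun t => hi t k) (fun t => h t k) t
  rw [h1 t k]
  refine Finset.sum_congr rfl fun j hj => ?_
  beta_reduce
  rw [hn.leftLim_eq_kick hα (p := p) (μ := μ) (fun s => ?_) j (Finset.mem_range.1 hj)]
  conv_lhs => rw [show φ s = _ from funext fun k => h1 s k]
  rw [momentum_shot hα]

end WaveEquation

/-! ### Riemann sums of the compensated integral along a path -/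

section RiemannSums

/-- The number of jumps up to time `s`. -/
def cnt (m : ℕ) (S : ℕ → ℝ) (s : ℝ) : ℕ := ((Finset.range m).filter fun i => S i ≤ s).card

/-- The current `p̃ - 𝔭₀ / μ` as a function of the jump times and the thermostat variables. -/
def current (α : ℤ → ℝ) (μ : ℝ) (m : ℕ) (S p : ℕ → ℝ) (s : ℝ) : ℝ :=
  rho μ * p (cnt m S s + 1) - shot m S (kick α μ S p) (J α) s / μ

/-- The increment over `(s, u]` of the compensated current. -/
def drivenIncr (α : ℤ → ℝ) (γ μ : ℝ) (m : ℕ) (S p : ℕ → ℝ) (s u : ℝ) : ℝ :=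
  current α μ m S p s * (cnt m S u - cnt m S s : ℝ) +
    γ * (u - s) * shot m S (kick α μ S p) (J α) s

theorem cnt_mono {m : ℕ} {S : ℕ → ℝ} : Monotone (cnt m S) := fun _ _ h =>
  Finset.card_le_card (Finset.monotone_filter_right _ fun _ _ hi => le_trans hi h)

theorem cnt_le (m : ℕ) (S : ℕ → ℝ) (s : ℝ) : cnt m S s ≤ m :=
  (Finset.card_filter_le _ _).trans (Finset.card_range m).le

theorem cast_cnt (m : ℕ) (S : ℕ → ℝ) (s : ℝ) :
    (cnt m S s : ℝ) = ∑ j ∈ Finset.range m, if S j ≤ s then 1 else 0 := by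
  rw [cnt, Finset.sum_boole]

theorem tendsto_grid_floor {s t : ℝ} (ht : 0 < t) (hs : 0 ≤ s) :
    Tendsto (fun M : ℕ => (⌊s / t * M⌋₊ : ℝ) * (t / M)) atTop (𝓝 s) := by
  have h := ((tendsto_nat_floor_mul_div_atTop (R := ℝ) (a := s / t) (by positivity)).comp
    tendsto_natCast_atTop_atTop).mul_const t
  rw [div_mul_cancel₀ _ ht.ne'] at h
  refine h.congr fun M => ?_
  simp only [Function.comp_apply]
  ring

theorem sum_grid_eq_integral (G : ℝ → ℂ) {t : ℝ} (ht : 0 < t) {M : ℕ} (hM : 0 < M) :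
    ∑ k ∈ Finset.range M, ((t / M : ℝ) : ℂ) * G (k * (t / M)) =
      ∫ s in (0 : ℝ)..t, G (⌊s / t * M⌋₊ * (t / M)) := by
  have hM' : (0 : ℝ) < M := Nat.cast_pos.2 hM
  have hcongr : ∀ k : ℕ, ∀ᵐ s : ℝ, s ∈ uIoc (k * (t / M)) ((k + 1 : ℕ) * (t / M)) →
      G (⌊s / t * M⌋₊ * (t / M)) = G (k * (t / M)) := by
    intro k
    filter_upwards [compl_mem_ae_iff.2 (measure_singleton (((k + 1 : ℕ) : ℝ) * (t / M)))]
      with s hs hs'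
    rw [uIoc_of_le (by gcongr; omega)] at hs'
    have hs2 : s < (k + 1 : ℕ) * (t / M) := lt_of_le_of_ne hs'.2 hs
    have h3 : ⌊s / t * M⌋₊ = k := by
      have e : s / t * M = s / (t / M) := by field_simp
      rw [e, Nat.floor_eq_iff (div_nonneg (le_trans (by positivity) hs'.1.le) (by positivity)),
        le_div_iff₀ (by positivity), div_lt_iff₀ (by positivity)]
      exact ⟨hs'.1.le, by push_cast at hs2; exact hs2⟩
    rw [h3]
  have h1 := intervalIntegral.sum_integral_adjacent_intervals (μ := volume)
    (f := fun s => G (⌊s / t * M⌋₊ * (t / M)))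
    (a := fun k : ℕ => (k : ℝ) * (t / M)) (n := M) fun k _ => by
      refine (intervalIntegrable_const (c := G (k * (t / M)))).congr_ae ?_
      rw [EventuallyEq, ae_restrict_iff' measurableSet_uIoc]
      filter_upwards [hcongr k] with s hs hs'
      exact (hs hs').symm
  simp only [Nat.cast_zero, zero_mul] at h1
  rw [mul_div_cancel₀ _ hM'.ne'] at h1
  rw [← h1]
  refine Finset.sum_congr rfl fun k _ => ?_
  rw [intervalIntegral.integral_congr_ae (hcongr k), intervalIntegral.integral_const,
    Complex.real_smul]
  congr 2
  push_cast
  ring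

/-- The sum is the integral of G at the grid point to the left of s. A countable set of
discontinuities is negligible, so bounded convergence applies. -/
theorem tendsto_riemann_sum {G : ℝ → ℂ} {t C : ℝ} (ht : 0 < t) {B : Set ℝ} (hB : B.Countable)
    (hG : ∀ s ∈ Ioc 0 t, s ∉ B → ContinuousAt G s) (hC : ∀ s ∈ Icc 0 t, ‖G s‖ ≤ C) :
    Tendsto (fun M : ℕ => ∑ k ∈ Finset.range M, ((t / M : ℝ) : ℂ) * G (k * (t / M))) atTop
      (𝓝 (∫ s in (0 : ℝ)..t, G s)) := by
  have h1 : Tendsto (fun M : ℕ => ∫ s in (0 : ℝ)..t, G (⌊s / t * M⌋₊ * (t / M))) atTop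
      (𝓝 (∫ s in (0 : ℝ)..t, G s)) := by
    refine intervalIntegral.tendsto_integral_filter_of_dominated_convergence (fun _ => C)
      (Eventually.of_forall fun M => ?_) (Eventually.of_forall fun M =>
        Eventually.of_forall fun s hs => hC _ ?_) intervalIntegrable_const ?_
    · exact ((measurable_from_nat (f := fun k : ℕ => G (k * (t / M)))).comp
        (Nat.measurable_floor.comp (by fun_prop))).aestronglyMeasurable
    · rw [uIoc_of_le ht.le] at hs
      refine ⟨by positivity, le_trans ?_ hs.2⟩
      rcases M.eq_zero_or_pos with rfl | hM
      · simpa using hs.1.le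
      · have hM' : (0 : ℝ) < M := Nat.cast_pos.2 hM
        have h2 := mul_le_mul_of_nonneg_right
          (Nat.floor_le (a := s / t * M) (by have := hs.1; positivity))
          (show 0 ≤ t / M by positivity)
        have h3 : s / t * M * (t / M) = s := by field_simp
        rwa [h3] at h2
    · filter_upwards [compl_mem_ae_iff.2 (hB.measure_zero volume)] with s hs hs'
      rw [uIoc_of_le ht.le] at hs'
      exact (hG s hs' hs).tendsto.comp (tendsto_grid_floor ht hs'.1.le)
  refine h1.congr' ?_
  filter_upwards [eventually_gt_atTop 0] with M hM
  exact (sum_grid_eq_integral G ht hM).symm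

/-- Exactly one cell, open on the left and closed on the right, contains s, with index ⌈sM/t⌉ − 1.
Its left endpoint tends to s strictly from below and thus selects the left limit. -/
theorem tendsto_sum_left_grid {F : ℝ → ℂ} {L : ℂ} {s t : ℝ} (hs : 0 < s) (hst : s ≤ t)
    (hF : Tendsto F (𝓝[<] s) (𝓝 L)) :
    Tendsto (fun M : ℕ => ∑ k ∈ Finset.range M,
      if (k : ℝ) * (t / M) < s ∧ s ≤ (k + 1 : ℕ) * (t / M) then F (k * (t / M)) else 0) atTop
      (𝓝 L) := by
  have ht : 0 < t := hs.trans_le hst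
  have hlim : Tendsto (fun M : ℕ => ((⌈s / t * M⌉₊ : ℝ) - 1) * (t / M)) atTop (𝓝[<] s) := by
    rw [tendsto_nhdsWithin_iff]
    constructor
    · have h := (((tendsto_nat_ceil_mul_div_atTop (R := ℝ) (a := s / t) (by positivity)).comp
        tendsto_natCast_atTop_atTop).mul_const t).sub (tendsto_const_div_atTop_nhds_zero_nat t)
      rw [div_mul_cancel₀ _ ht.ne', sub_zero] at h
      refine h.congr fun M => ?_
      simp only [Function.comp_apply]
      ring
    · filter_upwards [eventually_gt_atTop 0] with M hM
      have hM' : (0 : ℝ) < M := Nat.cast_pos.2 hM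
      have h1 : (⌈s / t * M⌉₊ : ℝ) < s / t * M + 1 := Nat.ceil_lt_add_one (by positivity)
      have h2 : ((⌈s / t * M⌉₊ : ℝ) - 1) * (t / M) < (s / t * M) * (t / M) := by
        gcongr
        linarith
      have h3 : (s / t * M) * (t / M) = s := by field_simp
      rw [h3] at h2
      exact h2
  refine (hF.comp hlim).congr' ?_
  filter_upwards [eventually_gt_atTop 0] with M hM
  have hM' : (0 : ℝ) < M := Nat.cast_pos.2 hM
  have hpos : 0 < ⌈s / t * M⌉₊ := Nat.ceil_pos.2 (by positivity)
  have hiff : ∀ k : ℕ, ((k : ℝ) * (t / M) < s ∧ s ≤ (k + 1 : ℕ) * (t / M)) ↔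
      k = ⌈s / t * M⌉₊ - 1 := by
    intro k
    have e : s / t * M = s / (t / M) := by field_simp
    rw [← lt_div_iff₀ (by positivity), ← div_le_iff₀ (by positivity), ← e, ← Nat.lt_ceil,
      ← Nat.ceil_le]
    omega
  have hle : ⌈s / t * M⌉₊ ≤ M := by
    rw [Nat.ceil_le]
    have : s / t ≤ 1 := (div_le_one ht).2 hst
    nlinarith
  simp only [hiff]
  rw [Finset.sum_ite_eq', if_pos (Finset.mem_range.2 (by omega)), Function.comp_apply,
    Nat.cast_sub hpos, Nat.cast_one]

variable {α : ℤ → ℝ} {γ μ t : ℝ} {m : ℕ} {S p : ℕ → ℝ}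

theorem continuousAt_step {g : ℝ → ℝ} (hg : Continuous g) {a s : ℝ} (h : a ≠ s) :
    ContinuousAt (fun u => if a ≤ u then g u else 0) s := by
  rcases lt_or_gt_of_ne h with h | h
  · refine hg.continuousAt.congr ?_
    filter_upwards [lt_mem_nhds h] with u hu
    exact (if_pos hu.le).symm
  · refine (continuousAt_const (y := (0 : ℝ))).congr ?_
    filter_upwards [gt_mem_nhds h] with u hu
    exact (if_neg (not_le.2 hu)).symm

theorem continuousAt_shot (hα : AdmissibleCoupling α) {x : ℕ → ℝ} {s : ℝ}
    (hs : s ∉ (fun j => S j) '' (Finset.range m : Set ℕ)) :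
    ContinuousAt (shot m S x (J α)) s := by
  have hc := continuous_J hα
  unfold shot
  refine tendsto_finsetSum _ fun j hj => ?_
  refine continuousAt_step (g := fun u => x j • J α (u - S j)) (by fun_prop) fun h => hs ?_
  exact ⟨j, hj, h⟩

theorem abs_shot_le (x : ℕ → ℝ) (s : ℝ) :
    |shot m S x (J α) s| ≤ ∑ j ∈ Finset.range m, |x j| := by
  refine (Finset.abs_sum_le_sum_abs _ _).trans (Finset.sum_le_sum fun j _ => ?_)
  split_ifs
  · rw [smul_eq_mul, abs_mul]
    exact mul_le_of_le_one_right (abs_nonneg _) (abs_J_le_one _ _)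
  · rw [abs_zero]
    exact abs_nonneg _

theorem tendsto_current (hα : AdmissibleCoupling α) (hm : ∀ i j, i ≤ j → j < m → S i ≤ S j)
    {j : ℕ} (hj : j < m) :
    Tendsto (current α μ m S p) (𝓝[<] S j) (𝓝 (kick α μ S p j)) := by
  have hc := continuous_J hα
  have hfilter : (Finset.range m).filter (fun i => S i < S j) =
      (Finset.range j).filter (fun i => S i < S j) := by
    ext i
    simp only [Finset.mem_filter, Finset.mem_range]
    refine and_congr_left fun h => ⟨fun hi => ?_, fun hi => hi.trans hj⟩
    by_contra hij
    exact absurd (hm j i (not_lt.1 hij) hi) (not_le.2 h)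
  have hev := eventually_le_iff_lt (Finset.range m) S (S j)
  have h1 : Tendsto (shot m S (kick α μ S p) (J α)) (𝓝[<] S j)
      (𝓝 (∑ i : Fin j, if S i < S j then kick α μ S p i * J α (S j - S i) else 0)) := by
    have h2 := Finset.sum_filter (s := Finset.range j) (fun i => S i < S j)
      (fun i => kick α μ S p i * J α (S j - S i))
    rw [Finset.sum_range] at h2
    rw [← h2]
    have h3 : Tendsto (fun s => ∑ i ∈ (Finset.range j).filter (fun i => S i < S j),
        kick α μ S p i * J α (s - S i)) (𝓝[<] S j)
        (𝓝 (∑ i ∈ (Finset.range j).filter (fun i => S i < S j),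
        kick α μ S p i * J α (S j - S i))) :=
      (Continuous.tendsto (continuous_finsetSum _ fun i _ => by fun_prop) _).mono_left
        nhdsWithin_le_nhds
    refine h3.congr' ?_
    filter_upwards [hev] with s hs
    rw [shot, ← Finset.sum_filter, Finset.filter_congr hs, hfilter]
    rfl
  rw [kick]
  refine Tendsto.sub (tendsto_const_nhds.congr' ?_) (h1.div_const μ)
  filter_upwards [hev] with s hs
  rw [cnt, Finset.filter_congr hs, hfilter, precCount]

theorem sum_drivenIncr_eq (ht : 0 ≤ t) (f : ℝ → ℂ) (M : ℕ) :
    ∑ k ∈ Finset.range M, f (k * (t / M)) *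
      (drivenIncr α γ μ m S p (k * (t / M)) ((k + 1 : ℕ) * (t / M)) : ℂ) =
    ∑ j ∈ Finset.range m, (∑ k ∈ Finset.range M,
      if (k : ℝ) * (t / M) < S j ∧ S j ≤ (k + 1 : ℕ) * (t / M) then
        f (k * (t / M)) * (current α μ m S p (k * (t / M)) : ℂ) else 0) +
    γ * ∑ k ∈ Finset.range M, ((t / M : ℝ) : ℂ) *
      (((shot m S (kick α μ S p) (J α) (k * (t / M)) : ℝ) : ℂ) * f (k * (t / M))) := by
  rw [Finset.sum_comm, Finset.mul_sum, ← Finset.sum_add_distrib]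
  refine Finset.sum_congr rfl fun k _ => ?_
  have h1 : (cnt m S ((k + 1 : ℕ) * (t / M)) : ℝ) - cnt m S (k * (t / M)) =
      ∑ j ∈ Finset.range m,
        if (k : ℝ) * (t / M) < S j ∧ S j ≤ (k + 1 : ℕ) * (t / M) then 1 else 0 := by
    rw [cast_cnt, cast_cnt, ← Finset.sum_sub_distrib]
    refine Finset.sum_congr rfl fun j _ => ?_
    have h2 : (k : ℝ) * (t / M) ≤ (k + 1 : ℕ) * (t / M) := by
      gcongr
      omega
    by_cases h3 : S j ≤ k * (t / M)
    · rw [if_pos (h3.trans h2), if_pos h3, if_neg fun h => absurd h.1 (not_lt.2 h3), sub_self]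
    · simp [h3, not_le.1 h3]
  rw [drivenIncr, h1, Finset.mul_sum]
  push_cast
  rw [mul_add, Finset.mul_sum]
  congr 1
  · refine Finset.sum_congr rfl fun j _ => ?_
    split_ifs <;> simp
  · ring

/-- The jump part picks the current just before each jump, which is the kick; the drift part is an
ordinary Riemann sum of the momentum. -/
theorem tendsto_sum_drivenIncr (hα : AdmissibleCoupling α) {f : ℝ → ℂ} (hf : Continuous f)
    (ht : 0 < t) (hS : ∀ j < m, 0 < S j ∧ S j ≤ t) (hm : ∀ i j, i ≤ j → j < m → S i ≤ S j) :
    Tendsto (fun M : ℕ => ∑ k ∈ Finset.range M, f (k * (t / M)) *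
      (drivenIncr α γ μ m S p (k * (t / M)) ((k + 1 : ℕ) * (t / M)) : ℂ)) atTop
      (𝓝 (driven α γ m S (kick α μ S p) f t)) := by
  simp only [sum_drivenIncr_eq ht.le]
  unfold driven
  refine Tendsto.add (tendsto_finsetSum _ fun j hj => ?_) (Tendsto.const_mul _ ?_)
  · obtain ⟨h1, h2⟩ := hS j (Finset.mem_range.1 hj)
    have h3 := tendsto_current (μ := μ) (p := p) hα hm (Finset.mem_range.1 hj)
    have h4 : Tendsto (fun s => f s * (current α μ m S p s : ℂ)) (𝓝[<] S j)
        (𝓝 (f (S j) * (kick α μ S p j : ℂ))) :=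
      ((hf.tendsto _).mono_left nhdsWithin_le_nhds).mul
        ((Complex.continuous_ofReal.tendsto _).comp h3)
    rw [mul_comm (f (S j))] at h4
    exact tendsto_sum_left_grid (F := fun s => f s * (current α μ m S p s : ℂ)) h1 h2 h4
  · obtain ⟨C, hC⟩ := isCompact_Icc.exists_bound_of_continuousOn (hf.continuousOn (s := Icc 0 t))
    refine tendsto_riemann_sum
      (G := fun s => ((shot m S (kick α μ S p) (J α) s : ℝ) : ℂ) * f s)
      (C := (∑ j ∈ Finset.range m, |kick α μ S p j|) * C) ht
      (((Finset.range m).finite_toSet.image S).countable) (fun s _ hs => ?_) fun s hs => ?_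
    · exact (Complex.continuous_ofReal.continuousAt.comp (continuousAt_shot hα hs)).mul
        hf.continuousAt
    · rw [norm_mul, Complex.norm_real, Real.norm_eq_abs]
      exact mul_le_mul (abs_shot_le _ _) (hC s hs) (norm_nonneg _)
        (Finset.sum_nonneg fun _ _ => abs_nonneg _)

theorem tendsto_sum_shot_sq (hα : AdmissibleCoupling α) {f : ℝ → ℂ} (hf : Continuous f)
    (ht : 0 < t) (x : ℕ → ℝ) :
    Tendsto (fun M : ℕ => ∑ k ∈ Finset.range M, ((t / M : ℝ) : ℂ) *
      (f (k * (t / M)) * ((shot m S x (J α) (k * (t / M)) ^ 2 : ℝ) : ℂ))) atTop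
      (𝓝 (∫ s in (0 : ℝ)..t, f s * ((shot m S x (J α) s ^ 2 : ℝ) : ℂ))) := by
  obtain ⟨C, hC⟩ := isCompact_Icc.exists_bound_of_continuousOn (hf.continuousOn (s := Icc 0 t))
  refine tendsto_riemann_sum (G := fun s => f s * ((shot m S x (J α) s ^ 2 : ℝ) : ℂ))
    (C := C * (∑ j ∈ Finset.range m, |x j|) ^ 2) ht
    (((Finset.range m).finite_toSet.image S).countable) (fun s _ hs => ?_) fun s hs => ?_
  · exact hf.continuousAt.mul
      (Complex.continuous_ofReal.continuousAt.comp ((continuousAt_shot hα hs).pow 2))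
  · rw [norm_mul, Complex.norm_real, Real.norm_of_nonneg (sq_nonneg _),
      ← sq_abs (shot m S x (J α) s)]
    have h1 := abs_shot_le (α := α) (m := m) (S := S) x s
    have h2 := hC s hs
    exact mul_le_mul h2 (by gcongr) (by positivity) ((norm_nonneg _).trans h2)

end RiemannSums

/-! ### Growth bounds in the number of jumps -/

section Bounds

variable {α : ℤ → ℝ} {γ μ e : ℝ} {m : ℕ} {S p : ℕ → ℝ}

theorem rho_nonneg (hμ : 0 < μ) : 0 ≤ rho μ := div_nonneg (Real.sqrt_nonneg _) hμ.le

theorem precCount_le (S : ℕ → ℝ) (j : ℕ) : precCount S j ≤ j :=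
  (Finset.card_filter_le _ _).trans (Finset.card_range j).le

theorem two_pow_add_geom_le {a : ℝ} (ha : 0 ≤ a) (j : ℕ) :
    2 ^ j + a * ∑ i ∈ Finset.range j, (2 + a) ^ i ≤ (2 + a) ^ j := by
  induction j with
  | zero => simp
  | succ j ih =>
    have h1 : (2 : ℝ) ^ j ≤ (2 + a) ^ j := by gcongr; linarith
    rw [Finset.sum_range_succ, pow_succ, pow_succ]
    nlinarith

/-- As |J| ≤ 1, |x_j| ≤ 2ρe·2^j + (1/μ)Σ_{i<j}|x_i|, a discrete Grönwall recursion dominated by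
powers of 2 + 1/μ. Geometric growth in the number of jumps is harmless, since Poisson variables have
all exponential moments. -/
theorem abs_kick_le (hμ : 0 < μ) (hp : ∀ i, |p i| ≤ 2 ^ i * e) (j : ℕ) :
    |kick α μ S p j| ≤ 2 * rho μ * e * (2 + 1 / μ) ^ j := by
  have hρ := rho_nonneg hμ
  have he : 0 ≤ e := by simpa using (abs_nonneg _).trans (hp 0)
  induction j using Nat.strong_induction_on with
  | _ j ih =>
    rw [kick]
    have h1 : |∑ i : Fin j, if S i < S j then kick α μ S p i * J α (S j - S i) else 0| ≤
        2 * rho μ * e * ∑ i ∈ Finset.range j, (2 + 1 / μ) ^ i := by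
      rw [Finset.mul_sum, Finset.sum_range]
      refine (Finset.abs_sum_le_sum_abs _ _).trans (Finset.sum_le_sum fun i _ => ?_)
      refine le_trans ?_ (ih i i.2)
      split_ifs
      · rw [abs_mul]
        exact mul_le_of_le_one_right (abs_nonneg _) (abs_J_le_one _ _)
      · rw [abs_zero]
        exact abs_nonneg _
    have h2 : |rho μ * p (precCount S j + 1)| ≤ 2 * rho μ * e * 2 ^ j := by
      rw [abs_mul, abs_of_nonneg hρ]
      have h3 : (2 : ℝ) ^ (precCount S j + 1) ≤ 2 ^ (j + 1) :=
        pow_le_pow_right₀ (by norm_num) (by have := precCount_le S j; omega)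
      calc rho μ * |p (precCount S j + 1)| ≤ rho μ * (2 ^ (j + 1) * e) := by
            gcongr
            exact (hp _).trans (by gcongr)
        _ = 2 * rho μ * e * 2 ^ j := by ring
    refine (abs_sub _ _).trans ((add_le_add h2 (le_of_eq (abs_div _ _))).trans ?_)
    rw [abs_of_pos hμ, div_eq_mul_one_div |_|]
    have h4 := two_pow_add_geom_le (a := 1 / μ) (by positivity) j
    calc _ ≤ 2 * rho μ * e * 2 ^ j +
          2 * rho μ * e * (∑ i ∈ Finset.range j, (2 + 1 / μ) ^ i) * (1 / μ) := by gcongr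
      _ = 2 * rho μ * e * (2 ^ j + 1 / μ * ∑ i ∈ Finset.range j, (2 + 1 / μ) ^ i) := by ring
      _ ≤ _ := by gcongr

theorem geom_sum_le_pow {b : ℝ} (hb : 2 ≤ b) (m : ℕ) :
    ∑ j ∈ Finset.range m, b ^ j ≤ b ^ m := by
  have h := mul_geom_sum b m
  have h2 : 0 ≤ ∑ j ∈ Finset.range m, b ^ j := Finset.sum_nonneg fun _ _ => by positivity
  nlinarith

theorem natCast_le_pow {b : ℝ} (hb : 2 ≤ b) (m : ℕ) : (m : ℝ) ≤ b ^ m := by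
  have h1 : (m : ℝ) ≤ 2 ^ m := by exact_mod_cast m.lt_two_pow_self.le
  exact h1.trans (by gcongr)

/-- A bound for all the quantities that depend on the first `m` jumps. -/
def growth (μ : ℝ) (m : ℕ) (e : ℝ) : ℝ := 2 * rho μ * e * (2 + 1 / μ) ^ (2 * m + 1)

theorem growth_nonneg (hμ : 0 < μ) (he : 0 ≤ e) : 0 ≤ growth μ m e := by
  have := rho_nonneg hμ
  unfold growth
  positivity

theorem abs_shot_kick_le_pow (hμ : 0 < μ) (hp : ∀ i, |p i| ≤ 2 ^ i * e) (s : ℝ) :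
    |shot m S (kick α μ S p) (J α) s| ≤ 2 * rho μ * e * (2 + 1 / μ) ^ m := by
  have hρ := rho_nonneg hμ
  have he : 0 ≤ e := by simpa using (abs_nonneg _).trans (hp 0)
  refine (abs_shot_le _ s).trans ((Finset.sum_le_sum fun j _ => abs_kick_le hμ hp j).trans ?_)
  rw [← Finset.mul_sum]
  have := geom_sum_le_pow (b := 2 + 1 / μ) (by have : 0 < 1 / μ := by positivity
                                               linarith) m
  gcongr

theorem abs_current_le_pow (hμ : 0 < μ) (hp : ∀ i, |p i| ≤ 2 ^ i * e) (s : ℝ) :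
    |current α μ m S p s| ≤ 2 * rho μ * e * (2 + 1 / μ) ^ (m + 1) := by
  have hρ := rho_nonneg hμ
  have he : 0 ≤ e := by simpa using (abs_nonneg _).trans (hp 0)
  have ha : 0 < 1 / μ := by positivity
  have h1 : |rho μ * p (cnt m S s + 1)| ≤ 2 * rho μ * e * (2 + 1 / μ) ^ m := by
    rw [abs_mul, abs_of_nonneg hρ]
    have h3 : (2 : ℝ) ^ (cnt m S s + 1) ≤ 2 ^ (m + 1) :=
      pow_le_pow_right₀ (by norm_num) (by have := cnt_le m S s; omega)
    have h4 : (2 : ℝ) ^ m ≤ (2 + 1 / μ) ^ m := by gcongr; linarith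
    calc rho μ * |p (cnt m S s + 1)| ≤ rho μ * (2 ^ (m + 1) * e) := by
          gcongr
          exact (hp _).trans (by gcongr)
      _ = 2 * rho μ * e * 2 ^ m := by ring
      _ ≤ _ := by gcongr
  refine (abs_sub _ _).trans ((add_le_add h1 (le_of_eq (abs_div _ _))).trans ?_)
  rw [abs_of_pos hμ, div_eq_mul_one_div |_|]
  have h2 := abs_shot_kick_le_pow (α := α) (m := m) (S := S) hμ hp s
  calc _ ≤ 2 * rho μ * e * (2 + 1 / μ) ^ m +
        2 * rho μ * e * (2 + 1 / μ) ^ m * (1 / μ) := by gcongr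
    _ ≤ 2 * rho μ * e * (2 + 1 / μ) ^ m * (2 + 1 / μ) := by
      have : 0 ≤ 2 * rho μ * e * (2 + 1 / μ) ^ m := by positivity
      nlinarith
    _ = _ := by rw [pow_succ]; ring

theorem abs_shot_kick_le (hμ : 0 < μ) (hp : ∀ i, |p i| ≤ 2 ^ i * e) (s : ℝ) :
    |shot m S (kick α μ S p) (J α) s| ≤ growth μ m e := by
  have hρ := rho_nonneg hμ
  have he : 0 ≤ e := by simpa using (abs_nonneg _).trans (hp 0)
  have ha : 0 < 1 / μ := by positivity
  refine (abs_shot_kick_le_pow hμ hp s).trans ?_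
  unfold growth
  gcongr
  · linarith
  · omega

theorem abs_current_le (hμ : 0 < μ) (hp : ∀ i, |p i| ≤ 2 ^ i * e) (s : ℝ) :
    |current α μ m S p s| ≤ growth μ m e := by
  have hρ := rho_nonneg hμ
  have he : 0 ≤ e := by simpa using (abs_nonneg _).trans (hp 0)
  have ha : 0 < 1 / μ := by positivity
  refine (abs_current_le_pow hμ hp s).trans ?_
  unfold growth
  gcongr
  · linarith
  · omega

theorem abs_current_mul_le (hμ : 0 < μ) (hp : ∀ i, |p i| ≤ 2 ^ i * e) (s : ℝ) :
    |current α μ m S p s| * m ≤ growth μ m e := by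
  have hρ := rho_nonneg hμ
  have he : 0 ≤ e := by simpa using (abs_nonneg _).trans (hp 0)
  have ha : 0 < 1 / μ := by positivity
  -- The exponent 2m + 1 in `growth` is m + 1 for the current plus m for the number of jumps.
  calc _ ≤ 2 * rho μ * e * (2 + 1 / μ) ^ (m + 1) * (2 + 1 / μ) ^ m :=
        mul_le_mul (abs_current_le_pow hμ hp s) (natCast_le_pow (by linarith) m) (by positivity)
          (by positivity)
    _ = growth μ m e := by rw [growth]; ring

/-- The bound is uniform in the mesh: the jump counts over the cells telescope to at most m, and the
drift lengths add up to t. -/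
theorem norm_sum_drivenIncr_le (hγ : 0 < γ) (hμ : 0 < μ) (hp : ∀ i, |p i| ≤ 2 ^ i * e)
    {t C : ℝ} (ht : 0 ≤ t) {f : ℝ → ℂ} (hf : ∀ s ∈ Icc 0 t, ‖f s‖ ≤ C) (M : ℕ) :
    ‖∑ k ∈ Finset.range M, f (k * (t / M)) *
      (drivenIncr α γ μ m S p (k * (t / M)) ((k + 1 : ℕ) * (t / M)) : ℂ)‖ ≤
      C * (1 + γ * t) * growth μ m e := by
  have hρ := rho_nonneg hμ
  have he : 0 ≤ e := by simpa using (abs_nonneg _).trans (hp 0)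
  have ha : 0 < 1 / μ := by positivity
  have hg := growth_nonneg (m := m) hμ he
  have hC : 0 ≤ C := (norm_nonneg _).trans (hf 0 ⟨le_rfl, ht⟩)
  set A := 2 * rho μ * e * (2 + 1 / μ) ^ (m + 1) with hA
  have hA0 : 0 ≤ A := by positivity
  have hAm : A * m ≤ growth μ m e := by
    calc _ ≤ A * (2 + 1 / μ) ^ m := by
          gcongr
          exact natCast_le_pow (by linarith) m
      _ = growth μ m e := by rw [growth, hA]; ring
  have hterm : ∀ k ∈ Finset.range M, ‖f (k * (t / M)) *
      (drivenIncr α γ μ m S p (k * (t / M)) ((k + 1 : ℕ) * (t / M)) : ℂ)‖ ≤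
      C * (A * ((cnt m S ((k + 1 : ℕ) * (t / M)) : ℝ) - cnt m S (k * (t / M))) +
        γ * (t / M) * growth μ m e) := by
    intro k hk
    have hkM : k < M := Finset.mem_range.1 hk
    have hM : (0 : ℝ) < M := Nat.cast_pos.2 (by omega)
    have hle : (k : ℝ) * (t / M) ≤ (k + 1 : ℕ) * (t / M) := by
      gcongr
      omega
    have hkt : (k : ℝ) * (t / M) ≤ t := by
      rw [mul_div_left_comm]
      refine mul_le_of_le_one_right ht ((div_le_one hM).2 (by exact_mod_cast hkM.le))
    have h2 : (cnt m S (k * (t / M)) : ℝ) ≤ cnt m S ((k + 1 : ℕ) * (t / M)) :=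
      Nat.cast_le.2 (cnt_mono hle)
    have hstep : ((k + 1 : ℕ) : ℝ) * (t / M) - k * (t / M) = t / M := by push_cast; ring
    rw [norm_mul, Complex.norm_real, Real.norm_eq_abs]
    refine mul_le_mul (hf _ ⟨by positivity, hkt⟩) ?_ (abs_nonneg _) hC
    unfold drivenIncr
    refine (abs_add_le _ _).trans ?_
    rw [abs_mul, abs_mul, hstep, abs_of_nonneg (sub_nonneg.2 h2),
      abs_of_nonneg (show 0 ≤ γ * (t / M) by positivity)]
    have h3 := abs_current_le_pow (α := α) (m := m) (S := S) hμ hp (k * (t / M))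
    have h4 := abs_shot_kick_le (α := α) (m := m) (S := S) hμ hp (k * (t / M))
    have h5 := sub_nonneg.2 h2
    gcongr
  refine (norm_sum_le_of_le _ hterm).trans ?_
  have htel := Finset.sum_range_sub (fun k : ℕ => (cnt m S (k * (t / M)) : ℝ)) M
  rw [← Finset.mul_sum, Finset.sum_add_distrib, ← Finset.mul_sum, htel, Finset.sum_const,
    Finset.card_range, nsmul_eq_mul, mul_assoc C]
  refine mul_le_mul_of_nonneg_left ?_ hC
  have h6 : (M : ℝ) * (γ * (t / M) * growth μ m e) ≤ γ * t * growth μ m e := by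
    rcases M.eq_zero_or_pos with rfl | hM
    · simp only [Nat.cast_zero, zero_mul]
      positivity
    · have hM' : (0 : ℝ) < M := Nat.cast_pos.2 hM
      apply le_of_eq
      field_simp
  have h7 : (cnt m S (M * (t / M)) : ℝ) - cnt m S ((0 : ℕ) * (t / M)) ≤ m := by
    have h8 : (cnt m S (M * (t / M)) : ℝ) ≤ m := Nat.cast_le.2 (cnt_le _ _ _)
    have h9 : (0 : ℝ) ≤ cnt m S ((0 : ℕ) * (t / M)) := Nat.cast_nonneg _
    linarith
  nlinarith

theorem abs_drivenIncr_le (hγ : 0 < γ) (hμ : 0 < μ) (hp : ∀ i, |p i| ≤ 2 ^ i * e)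
    {s u t : ℝ} (hs : 0 ≤ s) (hsu : s ≤ u) (hut : u ≤ t) :
    |drivenIncr α γ μ m S p s u| ≤ (1 + γ * t) * growth μ m e := by
  have he : 0 ≤ e := by simpa using (abs_nonneg _).trans (hp 0)
  have hg := growth_nonneg (m := m) hμ he
  have h1 : |(cnt m S u - cnt m S s : ℝ)| ≤ m := by
    have h2 : (cnt m S s : ℝ) ≤ cnt m S u := Nat.cast_le.2 (cnt_mono hsu)
    have h3 : (cnt m S u : ℝ) ≤ m := Nat.cast_le.2 (cnt_le _ _ _)
    rw [abs_of_nonneg (by linarith)]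
    have : (0 : ℝ) ≤ cnt m S s := Nat.cast_nonneg _
    linarith
  have h4 : |γ * (u - s)| ≤ γ * t := by
    rw [abs_of_nonneg (mul_nonneg hγ.le (by linarith))]
    gcongr
    linarith
  unfold drivenIncr
  refine (abs_add_le _ _).trans ?_
  rw [abs_mul, abs_mul]
  calc _ ≤ |current α μ m S p s| * m + γ * t * growth μ m e := by
        have h5 := abs_shot_kick_le (α := α) (m := m) (S := S) hμ hp s
        have h6 : 0 ≤ γ * t := (abs_nonneg _).trans h4
        gcongr
    _ ≤ growth μ m e + γ * t * growth μ m e := by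
        gcongr
        exact abs_current_mul_le hμ hp s
    _ = _ := by ring

end Bounds

/-! ### Moments of the Poisson law -/

section PoissonMoments

theorem integrable_pow_poissonMeasure (r : ℝ≥0) {b : ℝ} (hb : 0 ≤ b) :
    Integrable (fun n : ℕ => b ^ n) (poissonMeasure r) := by
  rw [integrable_poissonMeasure_iff]
  refine ((Real.summable_pow_div_factorial (r * b)).mul_left (Real.exp (-r))).congr fun n => ?_
  rw [Real.norm_of_nonneg (by positivity), mul_pow]
  ring

theorem integrable_natCast_sq_poissonMeasure (r : ℝ≥0) :
    Integrable (fun n : ℕ => (n : ℝ) ^ 2) (poissonMeasure r) := by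
  refine (integrable_pow_poissonMeasure r (b := 4) (by norm_num)).mono'
    Measurable.of_discrete.aestronglyMeasurable (Eventually.of_forall fun n => ?_)
  rw [Real.norm_of_nonneg (by positivity), show (4 : ℝ) = 2 ^ 2 by norm_num, ← pow_mul, mul_comm,
    pow_mul]
  have := natCast_le_pow (b := 2) le_rfl n
  gcongr

theorem integrable_natCast_poissonMeasure (r : ℝ≥0) :
    Integrable (fun n : ℕ => (n : ℝ)) (poissonMeasure r) := by
  refine (integrable_pow_poissonMeasure r (b := 2) (by norm_num)).mono'
    Measurable.of_discrete.aestronglyMeasurable (Eventually.of_forall fun n => ?_)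
  rw [Real.norm_of_nonneg (by positivity)]
  exact natCast_le_pow le_rfl n

/-- The weight identity n rⁿ/n! = r·r^{n−1}/(n−1)! shifts the series by one and yields the first two
moments in turn. -/
theorem integral_natCast_mul_poissonMeasure (r : ℝ≥0) (f : ℕ → ℝ)
    (hf : Integrable (fun n : ℕ => n * f n) (poissonMeasure r)) :
    ∫ n, (n : ℝ) * f n ∂(poissonMeasure r) = r * ∫ n, f (n + 1) ∂(poissonMeasure r) := by
  have h := hasSum_integral_poissonMeasure hf
  rw [← h.tsum_eq, h.summable.tsum_eq_zero_add, integral_poissonMeasure, ← tsum_mul_left]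
  simp only [Nat.cast_zero, zero_mul, smul_zero, zero_add]
  refine tsum_congr fun n => ?_
  rw [Nat.factorial_succ, smul_eq_mul, smul_eq_mul]
  push_cast
  field_simp
  ring

theorem integral_natCast_poissonMeasure (r : ℝ≥0) :
    ∫ n, (n : ℝ) ∂(poissonMeasure r) = r := by
  have h := integral_natCast_mul_poissonMeasure r (fun _ => 1)
    (by simpa using integrable_natCast_poissonMeasure r)
  simpa using h

theorem integral_natCast_sq_poissonMeasure (r : ℝ≥0) :
    ∫ n, (n : ℝ) ^ 2 ∂(poissonMeasure r) = r + r ^ 2 := by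
  have h := integral_natCast_mul_poissonMeasure r (fun n => n)
    (by simpa [sq] using integrable_natCast_sq_poissonMeasure r)
  simp only [← sq] at h
  rw [h]
  push_cast
  rw [integral_add (integrable_natCast_poissonMeasure r) (integrable_const _),
    integral_natCast_poissonMeasure]
  simp
  ring

end PoissonMoments

/-! ### Independence of clock and thermostat; measurability of the past -/

section Clock

theorem indepFun_prodMk_left_of_indepFun {Ω A B C : Type*} [MeasurableSpace Ω] [MeasurableSpace A]
    [MeasurableSpace B] [MeasurableSpace C] {P : Measure Ω} [IsProbabilityMeasure P]
    {X : Ω → A} {Y : Ω → B} {Z : Ω → C} (hX : Measurable X) (hY : Measurable Y)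
    (hZ : Measurable Z) (h1 : IndepFun (fun w => (X w, Z w)) Y P) (h2 : IndepFun X Z P) :
    IndepFun (fun w => (X w, Y w)) Z P := by
  rw [indepFun_iff_map_prod_eq_prod_map_map (by fun_prop) (by fun_prop)] at h1 h2 ⊢
  have hXY : IndepFun X Y P := by
    have := (indepFun_iff_map_prod_eq_prod_map_map (f := fun w => (X w, Z w)) (g := Y) (μ := P)
      (by fun_prop) (by fun_prop)).2 h1
    exact this.comp (φ := Prod.fst) (ψ := id) measurable_fst measurable_id
  have h3 := (indepFun_iff_map_prod_eq_prod_map_map hX.aemeasurable hY.aemeasurable).1 hXY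
  have : IsProbabilityMeasure (P.map X) := Measure.isProbabilityMeasure_map hX.aemeasurable
  have : IsProbabilityMeasure (P.map Y) := Measure.isProbabilityMeasure_map hY.aemeasurable
  have : IsProbabilityMeasure (P.map Z) := Measure.isProbabilityMeasure_map hZ.aemeasurable
  rw [h2] at h1
  rw [h3]
  let g : (A × C) × B → (A × B) × C := fun x => ((x.1.1, x.2), x.1.2)
  have hg : Measurable g := by fun_prop
  have e : (fun w => ((X w, Y w), Z w)) = g ∘ fun w => ((X w, Z w), Y w) := rfl
  rw [e, ← Measure.map_map hg (by fun_prop), h1]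
  -- The hypotheses make X, Y, Z mutually independent; the regrouped product law is identified on
  -- boxes, which form a generating π-system.
  refine (Measure.prod_eq_generateFrom (C := image2 (· ×ˢ ·) {s | MeasurableSet s} {s | MeasurableSet s})
    (D := {s | MeasurableSet s}) generateFrom_prod MeasurableSpace.generateFrom_measurableSet
    isPiSystem_prod MeasurableSpace.isPiSystem_measurableSet
    (Measure.FiniteSpanningSetsIn.mk (fun _ => univ)
      (fun _ => ⟨univ, MeasurableSet.univ, univ, MeasurableSet.univ, univ_prod_univ⟩) (fun _ => measure_lt_top _ _) (iUnion_const _))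
    (Measure.toFiniteSpanningSetsIn _) ?_).symm
  rintro _ ⟨s, hs, t, ht, rfl⟩ u hu
  have hs : MeasurableSet s := hs
  have ht : MeasurableSet t := ht
  have hu : MeasurableSet u := hu
  rw [Measure.map_apply hg ((hs.prod ht).prod hu), Measure.prod_prod]
  have : g ⁻¹' ((s ×ˢ t) ×ˢ u) = (s ×ˢ u) ×ˢ t := by
    ext x
    simp only [g, mem_preimage, mem_prod]
    tauto
  rw [this, Measure.prod_prod, Measure.prod_prod]
  ring

/-- A counting process `n` with stationary independent Poisson increments, and an independent
sequence `p` of independent centred random variables of variance `T`. -/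
structure IsThermalClock {Ω : Type*} [MeasurableSpace Ω] (P : Measure Ω) (r : ℝ≥0) (T : ℝ)
    (n : ℝ≥0 → Ω → ℕ) (p : ℕ → Ω → ℝ) : Prop where
  measurable : ∀ t, Measurable (n t)
  measurable_seq : ∀ j, Measurable (p j)
  path : ∀ w, IsCountingPath fun t => n t w
  incr_law : ∀ s t, s ≤ t → HasLaw (fun w => n t w - n s w) (poissonMeasure (r * (t - s))) P
  indep_past : ∀ s t, s ≤ t →
    IndepFun (fun w => ((fun u : Iic s => n u w), fun j => p j w)) (fun w => n t w - n s w) P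
  indep : IndepFun (fun w t => n t w) (fun w j => p j w) P
  indep_seq : ∀ m : ℕ, IndepFun
    (fun w => ((fun t => n t w), fun i => if i ≤ m then p i w else 0)) (p (m + 1)) P
  memLp : ∀ j, MemLp (p j) 2 P
  mean : ∀ j, ∫ w, p j w ∂P = 0
  second_moment : ∀ j, ∫ w, p j w ^ 2 ∂P = T

/-- The jump times up to time `s` as a functional of the path up to time `s`. -/
def stoppedJumpTime (s : ℝ≥0) (v : Iic s → ℕ) (j : ℕ) : ℝ :=
  ⨅ i : ℕ, if j < v ⟨min (TopologicalSpace.denseSeq ℝ≥0 i) s, mem_Iic.2 (min_le_right _ _)⟩ then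
    ((min (TopologicalSpace.denseSeq ℝ≥0 i) s : ℝ≥0) : ℝ) else (s : ℝ)

theorem measurable_stoppedJumpTime (s : ℝ≥0) : Measurable (stoppedJumpTime s) := by
  refine measurable_pi_iff.2 fun j => ?_
  unfold stoppedJumpTime
  refine Measurable.iInf fun i => Measurable.ite ?_ measurable_const measurable_const
  exact (measurable_pi_apply _) (measurableSet_Ioi (a := j))

/-- The path exceeds j throughout the times after the jump, so dense times come arbitrarily close to
it from the right; truncation at s keeps the infimum a function of the path up to s. -/
theorem IsCountingPath.stoppedJumpTime_eq {n : ℝ≥0 → ℕ} (hn : IsCountingPath n) {s : ℝ≥0} {j : ℕ}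
    (hj : j < n s) : stoppedJumpTime s (fun u => n u) j = jumpTime n j := by
  have hle : ∀ i, (jumpTime n j : ℝ) ≤ if j < n (min (TopologicalSpace.denseSeq ℝ≥0 i) s) then
      ((min (TopologicalSpace.denseSeq ℝ≥0 i) s : ℝ≥0) : ℝ) else (s : ℝ) := by
    intro i
    split_ifs with h
    · exact NNReal.coe_le_coe.2 (hn.jumpTime_le h)
    · exact NNReal.coe_le_coe.2 (hn.jumpTime_le hj)
  refine le_antisymm (le_of_forall_gt_imp_ge_of_dense fun x hx => ?_) (le_ciInf hle)
  obtain ⟨y, hy, hy1, hy2⟩ := (TopologicalSpace.denseRange_denseSeq ℝ≥0).exists_between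
    (x := jumpTime n j) (y := x.toNNReal)
    (by rwa [← NNReal.coe_lt_coe, Real.coe_toNNReal _ (le_trans (NNReal.coe_nonneg _) hx.le)])
  obtain ⟨i, rfl⟩ := hy
  refine (ciInf_le ⟨_, forall_mem_range.2 hle⟩ i).trans ?_
  have hji : j < n (min (TopologicalSpace.denseSeq ℝ≥0 i) s) := by
    rw [hn.lt_iff_jumpTime_le hj]
    exact le_min hy1.le (hn.jumpTime_le hj)
  rw [if_pos hji]
  have h3 : (TopologicalSpace.denseSeq ℝ≥0 i : ℝ) ≤ x :=
    ((Real.lt_toNNReal_iff_coe_lt).1 hy2).le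
  exact (NNReal.coe_le_coe.2 (min_le_left _ _)).trans h3

end Clock

/-! ### Adapted variables and their independence of the future -/

section Adapted

variable {Ω : Type*} [MeasurableSpace Ω] {P : Measure Ω} {r : ℝ≥0} {T : ℝ} {n : ℝ≥0 → Ω → ℕ}
  {p : ℕ → Ω → ℝ} {b : ℕ} {s t u : ℝ≥0} {Z Z₁ Z₂ : Ω → ℝ}

/-- The variable `Z` is a function of the number of jumps up to time `s`, of their times and of
the first `n s + b` terms of the sequence `p`. -/
def Adapted (n : ℝ≥0 → Ω → ℕ) (p : ℕ → Ω → ℝ) (b : ℕ) (s : ℝ≥0) (Z : Ω → ℝ) : Prop :=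
  ∃ Φ : ℕ → (ℕ → ℝ) → (ℕ → ℝ) → ℝ, (∀ m, Measurable fun x : (ℕ → ℝ) × (ℕ → ℝ) => Φ m x.1 x.2) ∧
    (∀ m S S' q q', (∀ i < m, S i = S' i) → (∀ i ≤ m + b, q i = q' i) → Φ m S q = Φ m S' q') ∧
    ∀ w, Z w = Φ (n s w) (fun j => jumpTime (fun t => n t w) j) (fun j => p j w)

omit [MeasurableSpace Ω] in
theorem Adapted.comp₂ {F : ℝ → ℝ → ℝ} (hF : Measurable fun x : ℝ × ℝ => F x.1 x.2)
    (h1 : Adapted n p b s Z₁) (h2 : Adapted n p b s Z₂) :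
    Adapted n p b s fun w => F (Z₁ w) (Z₂ w) := by
  obtain ⟨Φ₁, m1, l1, e1⟩ := h1
  obtain ⟨Φ₂, m2, l2, e2⟩ := h2
  refine ⟨fun m S q => F (Φ₁ m S q) (Φ₂ m S q), fun m => hF.comp ((m1 m).prodMk (m2 m)),
    fun m S S' q q' h h' => ?_, fun w => ?_⟩
  · beta_reduce
    rw [l1 m S S' q q' h h', l2 m S S' q q' h h']
  · beta_reduce
    rw [e1, e2]

omit [MeasurableSpace Ω] in
theorem Adapted.mono_left {b' : ℕ} (hb : b ≤ b') (h : Adapted n p b s Z) : Adapted n p b' s Z := by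
  obtain ⟨Φ, m1, l1, e1⟩ := h
  exact ⟨Φ, m1, fun m S S' q q' h h' => l1 m S S' q q' h fun i hi => h' i (by omega), e1⟩

theorem cnt_congr {m : ℕ} {S S' : ℕ → ℝ} (h : ∀ i < m, S i = S' i) (a : ℝ) :
    cnt m S a = cnt m S' a := by
  rw [cnt, cnt, Finset.filter_congr fun i hi => by rw [h i (Finset.mem_range.1 hi)]]

theorem measurable_cnt (m : ℕ) (a : ℝ) :
    Measurable fun x : (ℕ → ℝ) × (ℕ → ℝ) => cnt m x.1 a := by
  simp_rw [cnt, Finset.card_filter]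
  refine Finset.measurable_sum _ fun i _ => Measurable.ite ?_ measurable_const measurable_const
  exact ((measurable_pi_apply i).comp measurable_fst) measurableSet_Iic

theorem IsCountingPath.cnt_eq {n : ℝ≥0 → ℕ} (hn : IsCountingPath n) (hs : s ≤ t) :
    cnt (n t) (fun j => jumpTime n j) s = n s := by
  simp only [cnt, NNReal.coe_le_coe]
  rw [hn.filter_jumpTime_le hs, Finset.card_range]

theorem measurable_comp_nat {A B : Type*} [MeasurableSpace A] [MeasurableSpace B]
    {f : ℕ → A → B} (hf : ∀ m, Measurable (f m)) {c : A → ℕ} (hc : Measurable c) :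
    Measurable fun x => f (c x) x :=
  (measurable_from_prod_countable_right (f := fun y : ℕ × A => f y.1 y.2) hf).comp
    (hc.prodMk measurable_id)

theorem Adapted.mono (hc : IsThermalClock P r T n p) (hs : s ≤ t) (h : Adapted n p b s Z) :
    Adapted n p b t Z := by
  obtain ⟨Φ, m1, l1, e1⟩ := h
  refine ⟨fun m S q => Φ (cnt m S s) S q, fun m => measurable_comp_nat m1 (measurable_cnt m s),
    fun m S S' q q' h h' => ?_, fun w => ?_⟩
  · have := cnt_le m S s
    beta_reduce
    rw [← cnt_congr h]
    exact l1 _ S S' q q' (fun i hi => h i (by omega)) fun i hi => h' i (by omega)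
  · beta_reduce
    rw [e1, (hc.path w).cnt_eq hs]

/-- The offset falls from 1 to 0: without a jump in (s, t] the product is zero, and after at least
one jump the term p_{n(s)+1} already belongs to the past at time t. -/
theorem Adapted.mul_incr (hc : IsThermalClock P r T n p) (hs : s ≤ t) (h : Adapted n p 1 s Z) :
    Adapted n p 0 t fun w => Z w * (n t w - n s w : ℝ) := by
  obtain ⟨Φ, m1, l1, e1⟩ := h
  refine ⟨fun m S q => Φ (cnt m S s) S q * (m - cnt m S s : ℝ), fun m => ?_,
    fun m S S' q q' h h' => ?_, fun w => ?_⟩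
  · exact (measurable_comp_nat m1 (measurable_cnt m s)).mul
      (measurable_const.sub (measurable_from_nat.comp (measurable_cnt m s)))
  · have := cnt_le m S s
    beta_reduce
    rw [← cnt_congr h]
    rcases this.eq_or_lt with h0 | h0
    · rw [h0, sub_self, mul_zero, mul_zero]
    · rw [l1 _ S S' q q' (fun i hi => h i (by omega)) fun i hi => h' i (by omega)]
  · beta_reduce
    rw [e1, (hc.path w).cnt_eq hs]

theorem Adapted.exists_factor (hc : IsThermalClock P r T n p) (h : Adapted n p b s Z) :
    ∃ Ψ : (Iic s → ℕ) × (ℕ → ℝ) → ℝ, Measurable Ψ ∧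
      ∀ w, Z w = Ψ ((fun u : Iic s => n u w), fun j => p j w) := by
  obtain ⟨Φ, m1, l1, e1⟩ := h
  refine ⟨fun x => Φ (x.1 ⟨s, mem_Iic.2 le_rfl⟩) (stoppedJumpTime s x.1) x.2, ?_, fun w => ?_⟩
  · refine measurable_comp_nat (f := fun m (x : (Iic s → ℕ) × (ℕ → ℝ)) =>
      Φ m (stoppedJumpTime s x.1) x.2) (fun m => ?_)
      ((measurable_pi_apply _).comp measurable_fst)
    exact (m1 m).comp (((measurable_stoppedJumpTime s).comp measurable_fst).prodMk measurable_snd)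
  · rw [e1]
    exact l1 _ _ _ _ _ (fun i hi => ((hc.path w).stoppedJumpTime_eq hi).symm) fun _ _ => rfl

theorem Adapted.measurable (hc : IsThermalClock P r T n p) (h : Adapted n p b s Z) :
    Measurable Z := by
  obtain ⟨Ψ, hΨ, e⟩ := h.exists_factor hc
  rw [show Z = _ from funext e]
  exact hΨ.comp ((measurable_pi_iff.2 fun u => hc.measurable _).prodMk
    (measurable_pi_iff.2 fun j => hc.measurable_seq j))

theorem Adapted.integral_mul_incr (hc : IsThermalClock P r T n p) (h : Adapted n p b s Z)
    (hs : s ≤ t) (φ : ℕ → ℝ) :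
    ∫ w, Z w * φ (n t w - n s w) ∂P =
      (∫ w, Z w ∂P) * ∫ k, φ k ∂(poissonMeasure (r * (t - s))) := by
  have hZ := h.measurable hc
  obtain ⟨Ψ, hΨ, e⟩ := h.exists_factor hc
  have hi : IndepFun Z (fun w => φ (n t w - n s w)) P := by
    rw [show Z = _ from funext e]
    exact (hc.indep_past s t hs).comp hΨ (Measurable.of_discrete (f := φ))
  have hm : Measurable fun w => n t w - n s w :=
    (Measurable.of_discrete (f := fun x : ℕ × ℕ => x.1 - x.2)).comp
      ((hc.measurable t).prodMk (hc.measurable s))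
  rw [hi.integral_fun_mul_eq_mul_integral hZ.aestronglyMeasurable
    ((Measurable.of_discrete (f := φ)).comp hm).aestronglyMeasurable]
  congr 1
  exact (hc.incr_law s t hs).integral_comp (f := φ) Measurable.of_discrete.aestronglyMeasurable

theorem measurable_ite_stopped {f : (ℕ → ℝ) → (ℕ → ℝ) → ℝ}
    (hf : Measurable fun x : (ℕ → ℝ) × (ℕ → ℝ) => f x.1 x.2) (s : ℝ≥0) (m : ℕ) :
    Measurable fun x : (ℝ≥0 → ℕ) × (ℕ → ℝ) =>
      if x.1 s = m then f (stoppedJumpTime s fun u => x.1 u) x.2 else 0 := by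
  have hv : Measurable fun x : (ℝ≥0 → ℕ) × (ℕ → ℝ) => x.1 s :=
    (measurable_pi_apply s).comp measurable_fst
  have hr : Measurable fun x : (ℝ≥0 → ℕ) × (ℕ → ℝ) => fun u : Iic s => x.1 u :=
    measurable_pi_iff.2 fun u => (measurable_pi_apply (u : ℝ≥0)).comp measurable_fst
  have hs : Measurable fun x : (ℝ≥0 → ℕ) × (ℕ → ℝ) =>
      f (stoppedJumpTime s fun u => x.1 u) x.2 :=
    hf.comp (((measurable_stoppedJumpTime s).comp hr).prodMk measurable_snd)
  exact Measurable.ite (hv (measurableSet_singleton m)) hs measurable_const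

/-- The random index is frozen by splitting over {n s = m}. On this event Z depends on the clock and
p_0, …, p_m only, which are independent of p_{m+1}. -/
theorem Adapted.integral_mul_seq (hc : IsThermalClock P r T n p) (h : Adapted n p 0 s Z)
    {g : ℝ → ℝ} (hg : Measurable g) {c : ℝ} (hgc : ∀ j, ∫ w, g (p j w) ∂P = c)
    (hZ : Integrable Z P) (hZg : Integrable (fun w => Z w * g (p (n s w + 1) w)) P) :
    ∫ w, Z w * g (p (n s w + 1) w) ∂P = (∫ w, Z w ∂P) * c := by
  obtain ⟨Φ, m1, l1, e1⟩ := h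
  have hA : ∀ m, MeasurableSet (n s ⁻¹' {m}) := fun m => hc.measurable s (measurableSet_singleton m)
  have hd : Pairwise (Function.onFun Disjoint fun m => n s ⁻¹' {m}) := fun i j hij =>
    (disjoint_singleton.2 hij).preimage _
  have hU : ⋃ m, n s ⁻¹' {m} = univ := by
    ext w
    simp
  have k1 := hasSum_integral_iUnion hA hd (f := fun w => Z w * g (p (n s w + 1) w)) (μ := P)
    hZg.integrableOn
  have k2 := (hasSum_integral_iUnion hA hd (f := Z) (μ := P) hZ.integrableOn).mul_right c
  rw [hU, Measure.restrict_univ] at k1 k2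
  suffices h0 : ∀ m, ∫ w in n s ⁻¹' {m}, Z w * g (p (n s w + 1) w) ∂P =
      (∫ w in n s ⁻¹' {m}, Z w ∂P) * c by
    simp_rw [h0] at k1
    exact k1.unique k2
  intro m
  let Y : (ℝ≥0 → ℕ) × (ℕ → ℝ) → ℝ := fun x =>
    if x.1 s = m then Φ m (stoppedJumpTime s fun u => x.1 u) x.2 else 0
  have hY : Measurable Y := measurable_ite_stopped (m1 m) s m
  let X : Ω → (ℝ≥0 → ℕ) × (ℕ → ℝ) := fun w =>
    ((fun t => n t w), fun i => if i ≤ m then p i w else 0)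
  have hX : Measurable X := by
    refine (measurable_pi_iff.2 fun t => hc.measurable t).prodMk (measurable_pi_iff.2 fun i => ?_)
    split_ifs
    · exact hc.measurable_seq i
    · exact measurable_const
  have hYZ : ∀ w, n s w = m → Y (X w) = Z w := by
    intro w hw
    rw [e1, hw]
    simp only [Y, X, if_pos hw]
    refine l1 _ _ _ _ _ (fun i hi => (hc.path w).stoppedJumpTime_eq (hw ▸ hi)) fun i hi => ?_
    rw [if_pos (by omega)]
  have hY0 : ∀ w, n s w ≠ m → Y (X w) = 0 := fun w hw => if_neg hw
  have hi : IndepFun (fun w => Y (X w)) (fun w => g (p (m + 1) w)) P :=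
    (hc.indep_seq m).comp hY hg
  have h1 : ∫ w in n s ⁻¹' {m}, Z w ∂P = ∫ w, Y (X w) ∂P := by
    rw [← integral_indicator (hA m)]
    refine integral_congr_ae (Eventually.of_forall fun w => ?_)
    by_cases hw : n s w = m
    · beta_reduce
      rw [indicator_of_mem (show w ∈ n s ⁻¹' {m} from hw), hYZ w hw]
    · beta_reduce
      rw [indicator_of_notMem (show w ∉ n s ⁻¹' {m} from hw), hY0 w hw]
  have h2 : ∫ w in n s ⁻¹' {m}, Z w * g (p (n s w + 1) w) ∂P =
      ∫ w, Y (X w) * g (p (m + 1) w) ∂P := by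
    rw [← integral_indicator (hA m)]
    refine integral_congr_ae (Eventually.of_forall fun w => ?_)
    by_cases hw : n s w = m
    · beta_reduce
      rw [indicator_of_mem (show w ∈ n s ⁻¹' {m} from hw), hYZ w hw, hw]
    · beta_reduce
      rw [indicator_of_notMem (show w ∉ n s ⁻¹' {m} from hw), hY0 w hw, zero_mul]
  rw [h1, h2, hi.integral_fun_mul_eq_mul_integral (hY.comp hX).aestronglyMeasurable
    (hg.comp (hc.measurable_seq _)).aestronglyMeasurable, hgc]

end Adapted

/-! ### Second moments of the current and of the compensated increments -/

section Moments

variable {Ω : Type*} [MeasurableSpace Ω] {P : Measure Ω} {r : ℝ≥0} {T : ℝ} {n : ℝ≥0 → Ω → ℕ}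
  {p : ℕ → Ω → ℝ} {s t u : ℝ≥0} {α : ℤ → ℝ} {γ μ : ℝ}

/-- The momentum of the particle with label `0`. -/
def clockMomentum (α : ℤ → ℝ) (μ : ℝ) (n : ℝ≥0 → Ω → ℕ) (p : ℕ → Ω → ℝ) (s : ℝ≥0) (w : Ω) : ℝ :=
  shot (n s w) (fun j => jumpTime (fun t => n t w) j)
    (kick α μ (fun j => jumpTime (fun t => n t w) j) (fun j => p j w)) (J α) s

/-- The difference `p̃ - 𝔭₀ / μ`. -/
def clockCurrent (α : ℤ → ℝ) (μ : ℝ) (n : ℝ≥0 → Ω → ℕ) (p : ℕ → Ω → ℝ) (s : ℝ≥0) (w : Ω) : ℝ :=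
  rho μ * p (n s w + 1) w - clockMomentum α μ n p s w / μ

/-- The increment of the compensated current over `(s, u]`. -/
def clockIncr (α : ℤ → ℝ) (γ μ : ℝ) (n : ℝ≥0 → Ω → ℕ) (p : ℕ → Ω → ℝ) (s u : ℝ≥0) (w : Ω) : ℝ :=
  clockCurrent α μ n p s w * (n u w - n s w : ℝ) + γ * (u - s : ℝ) * clockMomentum α μ n p s w

theorem kick_congr {S S' q q' : ℕ → ℝ} {j : ℕ} (hS : ∀ i ≤ j, S i = S' i)
    (hq : ∀ i ≤ j + 1, q i = q' i) : kick α μ S q j = kick α μ S' q' j := by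
  induction j using Nat.strong_induction_on with
  | _ j ih =>
    have hp : precCount S j = precCount S' j := by
      rw [precCount, precCount, Finset.filter_congr fun i hi => by
        rw [hS i (Finset.mem_range.1 hi).le, hS j le_rfl]]
    rw [kick, kick, hp, hq _ (by have := precCount_le S' j; omega)]
    congr 2
    refine Finset.sum_congr rfl fun i _ => ?_
    have hi := i.2
    rw [hS i hi.le, hS j le_rfl, ih i hi (fun l hl => hS l (by omega)) fun l hl => hq l (by omega)]

theorem measurable_kick (hα : AdmissibleCoupling α) (j : ℕ) :
    Measurable fun x : (ℕ → ℝ) × (ℕ → ℝ) => kick α μ x.1 x.2 j := by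
  have hJ := (continuous_J hα).measurable
  have hS : ∀ i, Measurable fun x : (ℕ → ℝ) × (ℕ → ℝ) => x.1 i := fun i =>
    (measurable_pi_apply i).comp measurable_fst
  have hq : ∀ i, Measurable fun x : (ℕ → ℝ) × (ℕ → ℝ) => x.2 i := fun i =>
    (measurable_pi_apply i).comp measurable_snd
  induction j using Nat.strong_induction_on with
  | _ j ih =>
    have h1 : Measurable fun x : (ℕ → ℝ) × (ℕ → ℝ) => precCount x.1 j := by
      simp_rw [precCount, Finset.card_filter]
      exact Finset.measurable_sum _ fun i _ =>
        Measurable.ite (measurableSet_lt (hS i) (hS j)) measurable_const measurable_const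
    have h2 : Measurable fun x : (ℕ → ℝ) × (ℕ → ℝ) => x.2 (precCount x.1 j + 1) :=
      measurable_comp_nat (f := fun m (x : (ℕ → ℝ) × (ℕ → ℝ)) => x.2 (m + 1)) (fun m => hq _) h1
    have h3 : Measurable fun x : (ℕ → ℝ) × (ℕ → ℝ) =>
        ∑ i : Fin j, if x.1 i < x.1 j then kick α μ x.1 x.2 i * J α (x.1 j - x.1 i) else 0 :=
      Finset.measurable_sum _ fun i _ => Measurable.ite (measurableSet_lt (hS i) (hS j))
        ((ih i i.2).mul (hJ.comp ((hS j).sub (hS i)))) measurable_const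
    simp_rw [fun x : (ℕ → ℝ) × (ℕ → ℝ) => kick.eq_1 α μ x.1 x.2 j]
    exact (h2.const_mul _).sub (h3.div_const _)

theorem shot_kick_congr {S S' q q' : ℕ → ℝ} {m : ℕ} (hS : ∀ i < m, S i = S' i)
    (hq : ∀ i ≤ m, q i = q' i) (a : ℝ) :
    shot m S (kick α μ S q) (J α) a = shot m S' (kick α μ S' q') (J α) a := by
  refine Finset.sum_congr rfl fun j hj => ?_
  have hj := Finset.mem_range.1 hj
  rw [hS j hj, kick_congr (fun i hi => hS i (by omega)) fun i hi => hq i (by omega)]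

theorem measurable_shot_kick (hα : AdmissibleCoupling α) (m : ℕ) :
    Measurable fun x : ℝ × (ℕ → ℝ) × (ℕ → ℝ) =>
      shot m x.2.1 (kick α μ x.2.1 x.2.2) (J α) x.1 := by
  have hJ := (continuous_J hα).measurable
  have hS : ∀ i, Measurable fun x : ℝ × (ℕ → ℝ) × (ℕ → ℝ) => x.2.1 i := fun i =>
    (measurable_pi_apply i).comp (measurable_fst.comp measurable_snd)
  unfold shot
  refine Finset.measurable_sum _ fun i _ => Measurable.ite (measurableSet_le (hS i) measurable_fst)
    ?_ measurable_const
  exact ((measurable_kick hα i).comp measurable_snd).mul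
    (hJ.comp (measurable_fst.sub (hS i)))

omit [MeasurableSpace Ω] in
theorem adapted_clockMomentum (hα : AdmissibleCoupling α) (s : ℝ≥0) :
    Adapted n p 0 s (clockMomentum α μ n p s) :=
  ⟨fun m S q => shot m S (kick α μ S q) (J α) s,
    fun m => (measurable_shot_kick hα m).comp (measurable_const.prodMk measurable_id),
    fun _ _ _ _ _ h h' => shot_kick_congr h h' _, fun _ => rfl⟩

omit [MeasurableSpace Ω] in
theorem adapted_clockCurrent (hα : AdmissibleCoupling α) (s : ℝ≥0) :
    Adapted n p 1 s (clockCurrent α μ n p s) := by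
  have h1 : Adapted n p 1 s fun w => p (n s w + 1) w :=
    ⟨fun m _ q => q (m + 1), fun m => (measurable_pi_apply _).comp measurable_snd,
      fun m S S' q q' _ h' => h' _ le_rfl, fun _ => rfl⟩
  exact h1.comp₂ (F := fun x y => rho μ * x - y / μ) (by fun_prop)
    ((adapted_clockMomentum hα s).mono_left zero_le_one)

theorem adapted_clockIncr (hc : IsThermalClock P r T n p) (hα : AdmissibleCoupling α)
    (hsu : s ≤ u) : Adapted n p 0 u (clockIncr α γ μ n p s u) :=
  ((adapted_clockCurrent hα s).mul_incr hc hsu).comp₂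
    (F := fun x y => x + γ * (u - s : ℝ) * y) (by fun_prop)
    ((adapted_clockMomentum hα s).mono hc hsu)

/-- A common bound `2 ^ i * seqBound q` for the terms `q i`. -/
def seqBound (q : ℕ → ℝ) : ℝ := √(∑' i, (1 / 4) ^ i * q i ^ 2)

theorem seqBound_sq (q : ℕ → ℝ) :
    seqBound q ^ 2 = (∑' i, ENNReal.ofReal ((1 / 4) ^ i * q i ^ 2)).toReal := by
  rw [seqBound, Real.sq_sqrt (tsum_nonneg fun i => by positivity),
    ENNReal.tsum_toReal_eq fun _ => ENNReal.ofReal_ne_top]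
  exact tsum_congr fun i => (ENNReal.toReal_ofReal (by positivity)).symm

theorem measurable_seqBound : Measurable seqBound := by
  have h : ∀ q, seqBound q = √((∑' i, ENNReal.ofReal ((1 / 4) ^ i * q i ^ 2)).toReal) :=
    fun q => by rw [← seqBound_sq]; exact (Real.sqrt_sq (Real.sqrt_nonneg _)).symm
  rw [show seqBound = _ from funext h]
  fun_prop

theorem IsThermalClock.lintegral_seq_ne_top (hc : IsThermalClock P r T n p) :
    ∫⁻ w, ∑' i, ENNReal.ofReal ((1 / 4) ^ i * p i w ^ 2) ∂P ≠ ⊤ := by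
  have hm := hc.measurable_seq
  rw [lintegral_tsum fun i => Measurable.aemeasurable (by fun_prop)]
  have h1 : ∀ i : ℕ, ∫⁻ w, ENNReal.ofReal ((1 / 4) ^ i * p i w ^ 2) ∂P =
      ENNReal.ofReal ((1 / 4) ^ i * T) := by
    intro i
    rw [← hc.second_moment i, ← integral_const_mul, ofReal_integral_eq_lintegral_ofReal
      ((hc.memLp i).integrable_sq.const_mul _) (Eventually.of_forall fun w => by positivity)]
  have hT : 0 ≤ T := by
    rw [← hc.second_moment 0]
    exact integral_nonneg fun w => sq_nonneg _
  simp_rw [h1]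
  rw [← ENNReal.ofReal_tsum_of_nonneg (fun i => by positivity)
    ((summable_geometric_of_lt_one (by norm_num) (by norm_num)).mul_right T)]
  exact ENNReal.ofReal_ne_top

theorem IsThermalClock.integrable_seqBound_sq (hc : IsThermalClock P r T n p) :
    Integrable (fun w => seqBound (fun j => p j w) ^ 2) P := by
  have hm := hc.measurable_seq
  simp_rw [seqBound_sq]
  exact integrable_toReal_of_lintegral_ne_top (Measurable.aemeasurable (by fun_prop))
    hc.lintegral_seq_ne_top

/-- The weighted series of squares has finite expectation, hence converges almost surely. Where it
diverges, `tsum` is 0 and the bound may fail. -/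
theorem IsThermalClock.ae_abs_le (hc : IsThermalClock P r T n p) :
    ∀ᵐ w ∂P, ∀ i, |p i w| ≤ 2 ^ i * seqBound (fun j => p j w) := by
  have hm := hc.measurable_seq
  filter_upwards [ae_lt_top (by fun_prop) hc.lintegral_seq_ne_top] with w hw i
  have h1 : Summable fun i => (1 / 4 : ℝ) ^ i * p i w ^ 2 := by
    refine (ENNReal.summable_toReal hw.ne).congr fun i => ?_
    exact ENNReal.toReal_ofReal (by positivity)
  have h2 := h1.le_tsum i fun j _ => by positivity
  have h3 : p i w ^ 2 ≤ 4 ^ i * ∑' i, (1 / 4 : ℝ) ^ i * p i w ^ 2 := by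
    calc p i w ^ 2 = 4 ^ i * ((1 / 4) ^ i * p i w ^ 2) := by
          rw [← mul_assoc, ← mul_pow]; norm_num
      _ ≤ _ := by gcongr
  calc |p i w| = √(p i w ^ 2) := (Real.sqrt_sq_eq_abs _).symm
    _ ≤ √(4 ^ i * ∑' i, (1 / 4 : ℝ) ^ i * p i w ^ 2) := Real.sqrt_le_sqrt h3
    _ = 2 ^ i * seqBound (fun j => p j w) := by
      rw [Real.sqrt_mul (by positivity), show (4 : ℝ) ^ i = (2 ^ i) ^ 2 by
        rw [← pow_mul, mul_comm, pow_mul]; norm_num, Real.sqrt_sq (by positivity)]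
      rfl

/-- The square is a geometric function of the number of jumps times the square of `seqBound`; these
are independent, and both are integrable. This is the dominating variable for every limit over the
sample space. -/
theorem IsThermalClock.integrable_growth_sq (hc : IsThermalClock P r T n p) (hμ : 0 < μ)
    (t : ℝ≥0) :
    Integrable (fun w => growth μ (n t w) (seqBound fun j => p j w) ^ 2) P := by
  have hi : IndepFun (n t) (fun w => seqBound (fun j => p j w) ^ 2) P :=
    hc.indep.comp (measurable_pi_apply t) (measurable_seqBound.pow_const 2)
  have hi2 : IndepFun (fun w => ((2 + 1 / μ) ^ 4) ^ n t w)
      (fun w => seqBound (fun j => p j w) ^ 2) P :=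
    hi.comp (φ := fun k : ℕ => ((2 + 1 / μ) ^ 4) ^ k) Measurable.of_discrete measurable_id
  have h0 : ∀ w, n 0 w = 0 := fun w => (hc.path w).zero
  have hlaw := hc.incr_law 0 t zero_le
  simp only [h0, tsub_zero] at hlaw
  have h1 : Integrable (fun w => ((2 + 1 / μ) ^ 4) ^ n t w) P := by
    have := integrable_pow_poissonMeasure (r * t) (b := (2 + 1 / μ) ^ 4) (by positivity)
    rw [← hlaw.map_eq] at this
    exact this.comp_measurable (hc.measurable t)
  refine ((hi2.integrable_mul h1 hc.integrable_seqBound_sq).const_mul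
    (4 * rho μ ^ 2 * (2 + 1 / μ) ^ 2)).congr (Eventually.of_forall fun w => ?_)
  simp only [growth, Pi.mul_apply]
  rw [← pow_mul]
  ring

theorem IsThermalClock.memLp_growth (hc : IsThermalClock P r T n p) (hμ : 0 < μ) (t : ℝ≥0) :
    MemLp (fun w => growth μ (n t w) (seqBound fun j => p j w)) 2 P := by
  rw [memLp_two_iff_integrable_sq]
  · exact hc.integrable_growth_sq hμ t
  · have hm := hc.measurable_seq
    have h1 : Measurable fun w => seqBound fun j => p j w :=
      measurable_seqBound.comp (measurable_pi_iff.2 hm)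
    have h2 : Measurable fun w => (2 + 1 / μ) ^ (2 * n t w + 1) :=
      (Measurable.of_discrete (f := fun k : ℕ => (2 + 1 / μ) ^ (2 * k + 1))).comp (hc.measurable t)
    unfold growth
    exact (Measurable.mul (by fun_prop) h2).aestronglyMeasurable

theorem drivenIncr_eq_clockIncr (hc : IsThermalClock P r T n p) (hsu : s ≤ u) (hut : u ≤ t)
    (w : Ω) :
    drivenIncr α γ μ (n t w) (fun j => jumpTime (fun t => n t w) j) (fun j => p j w) s u =
      clockIncr α γ μ n p s u w := by
  have hn := hc.path w
  rw [drivenIncr, clockIncr, current, clockCurrent, clockMomentum, hn.cnt_eq hut,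
    hn.cnt_eq (hsu.trans hut), ← hn.shot_eq (hsu.trans hut)]

theorem memLp_clockMomentum (hc : IsThermalClock P r T n p) (hα : AdmissibleCoupling α)
    (hμ : 0 < μ) (s : ℝ≥0) : MemLp (clockMomentum α μ n p s) 2 P := by
  refine (hc.memLp_growth hμ s).mono'
    ((adapted_clockMomentum hα s).measurable hc).aestronglyMeasurable ?_
  filter_upwards [hc.ae_abs_le] with w hw
  exact abs_shot_kick_le hμ hw s

theorem memLp_clockCurrent (hc : IsThermalClock P r T n p) (hα : AdmissibleCoupling α)
    (hμ : 0 < μ) (s : ℝ≥0) : MemLp (clockCurrent α μ n p s) 2 P := by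
  refine (hc.memLp_growth hμ s).mono'
    ((adapted_clockCurrent hα s).measurable hc).aestronglyMeasurable ?_
  filter_upwards [hc.ae_abs_le] with w hw
  have hn := hc.path w
  have h := abs_current_le (α := α) (m := n s w) (S := fun j => jumpTime (fun t => n t w) j)
    hμ hw s
  rwa [current, hn.cnt_eq le_rfl] at h

theorem memLp_clockIncr (hc : IsThermalClock P r T n p) (hα : AdmissibleCoupling α) (hγ : 0 < γ)
    (hμ : 0 < μ) (hsu : s ≤ u) : MemLp (clockIncr α γ μ n p s u) 2 P := by
  refine ((hc.memLp_growth hμ u).const_mul (1 + γ * u)).mono'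
    ((adapted_clockIncr hc hα hsu).measurable hc).aestronglyMeasurable ?_
  filter_upwards [hc.ae_abs_le] with w hw
  rw [← drivenIncr_eq_clockIncr hc hsu le_rfl]
  exact abs_drivenIncr_le hγ hμ hw s.2 hsu le_rfl

/-- Recovered from the current and the momentum by division by ρ, which is nonzero because μ > 1/2.
-/
theorem memLp_seq_next (hc : IsThermalClock P r T n p) (hα : AdmissibleCoupling α)
    (hμ : 1 / 2 < μ) (s : ℝ≥0) : MemLp (fun w => p (n s w + 1) w) 2 P := by
  have hμ0 : 0 < μ := by linarith
  have hρ : rho μ ≠ 0 := (div_pos (Real.sqrt_pos.2 (by linarith)) hμ0).ne'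
  have h := ((memLp_clockCurrent hc hα hμ0 s).add
    ((memLp_clockMomentum hc hα hμ0 s).const_mul μ⁻¹)).const_mul (rho μ)⁻¹
  refine h.ae_eq (Eventually.of_forall fun w => ?_)
  simp only [Pi.add_apply, clockCurrent]
  field_simp
  ring

theorem integral_mul_seq_next (hc : IsThermalClock P r T n p) (hα : AdmissibleCoupling α)
    (hμ : 1 / 2 < μ) {Z : Ω → ℝ} (hZ : Adapted n p 0 s Z) (hZ2 : MemLp Z 2 P)
    [IsFiniteMeasure P] : ∫ w, Z w * p (n s w + 1) w ∂P = 0 := by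
  have h := hZ.integral_mul_seq hc (g := fun x => x) measurable_id hc.mean
    (hZ2.integrable one_le_two) (hZ2.integrable_mul (memLp_seq_next hc hα hμ s))
  rwa [mul_zero] at h

theorem integral_seq_next_sq (hc : IsThermalClock P r T n p) (hα : AdmissibleCoupling α)
    (hμ : 1 / 2 < μ) [IsProbabilityMeasure P] (s : ℝ≥0) :
    ∫ w, p (n s w + 1) w ^ 2 ∂P = T := by
  have h1 : Adapted n p 0 s fun _ => 1 :=
    ⟨fun _ _ _ => 1, fun _ => measurable_const, fun _ _ _ _ _ _ _ => rfl, fun _ => rfl⟩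
  have h := h1.integral_mul_seq hc (g := fun x => x ^ 2) (by fun_prop) hc.second_moment
    (integrable_const _) (by simpa using (memLp_seq_next hc hα hμ s).integrable_sq)
  simpa using h

theorem memLp_clockCurrent_mul_incr (hc : IsThermalClock P r T n p) (hα : AdmissibleCoupling α)
    (hγ : 0 < γ) (hμ : 0 < μ) (hsu : s ≤ u) :
    MemLp (fun w => clockCurrent α μ n p s w * ((n u w - n s w : ℕ) : ℝ)) 2 P := by
  refine ((memLp_clockIncr hc hα hγ hμ hsu).sub
    ((memLp_clockMomentum hc hα hμ s).const_mul (γ * (u - s)))).ae_eq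
    (Eventually.of_forall fun w => ?_)
  simp only [Pi.sub_apply, clockIncr]
  rw [Nat.cast_sub ((hc.path w).mono hsu)]
  ring

theorem clockIncr_eq (hc : IsThermalClock P r T n p) (hsu : s ≤ u) (w : Ω) :
    clockIncr α γ μ n p s u w = clockCurrent α μ n p s w * ((n u w - n s w : ℕ) : ℝ) +
      γ * (u - s : ℝ) * clockMomentum α μ n p s w := by
  rw [clockIncr, Nat.cast_sub ((hc.path w).mono hsu)]

theorem integral_mul_clockCurrent (hc : IsThermalClock P r T n p) (hα : AdmissibleCoupling α)
    (hμ : 1 / 2 < μ) [IsFiniteMeasure P] {Z : Ω → ℝ} (hZ : Adapted n p 0 s Z)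
    (hZ2 : MemLp Z 2 P) : ∫ w, Z w * clockCurrent α μ n p s w ∂P =
      -(∫ w, Z w * clockMomentum α μ n p s w ∂P) / μ := by
  have hμ0 : 0 < μ := by linarith
  have h : ∀ w, Z w * clockCurrent α μ n p s w =
      rho μ * (Z w * p (n s w + 1) w) - (Z w * clockMomentum α μ n p s w) / μ := fun w => by
    rw [clockCurrent]; ring
  simp_rw [h]
  have i1 : Integrable (fun w => rho μ * (Z w * p (n s w + 1) w)) P :=
    (hZ2.integrable_mul (memLp_seq_next hc hα hμ s)).const_mul _
  have i2 : Integrable (fun w => (Z w * clockMomentum α μ n p s w) / μ) P :=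
    (hZ2.integrable_mul (memLp_clockMomentum hc hα hμ0 s)).div_const _
  rw [integral_sub i1 i2, integral_const_mul,
    integral_mul_seq_next hc hα hμ hZ hZ2, integral_div]
  ring

theorem integral_clockCurrent_sq (hc : IsThermalClock P r T n p) (hα : AdmissibleCoupling α)
    (hμ : 1 / 2 < μ) [IsProbabilityMeasure P] :
    ∫ w, clockCurrent α μ n p s w ^ 2 ∂P =
      rho μ ^ 2 * T + (∫ w, clockMomentum α μ n p s w ^ 2 ∂P) / μ ^ 2 := by
  have hμ0 : 0 < μ := by linarith
  have hq := memLp_clockMomentum hc hα hμ0 s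
  have hp := memLp_seq_next hc hα hμ s
  have h : ∀ w, clockCurrent α μ n p s w ^ 2 = rho μ ^ 2 * p (n s w + 1) w ^ 2 -
      2 * rho μ / μ * (clockMomentum α μ n p s w * p (n s w + 1) w) +
      clockMomentum α μ n p s w ^ 2 / μ ^ 2 := fun w => by
    rw [clockCurrent]; ring
  simp_rw [h]
  have i1 : Integrable (fun w => rho μ ^ 2 * p (n s w + 1) w ^ 2) P :=
    hp.integrable_sq.const_mul _
  have i2 : Integrable (fun w => 2 * rho μ / μ * (clockMomentum α μ n p s w * p (n s w + 1) w)) P :=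
    (hq.integrable_mul hp).const_mul _
  have i12 : Integrable (fun w => rho μ ^ 2 * p (n s w + 1) w ^ 2 -
      2 * rho μ / μ * (clockMomentum α μ n p s w * p (n s w + 1) w)) P := i1.sub i2
  rw [integral_add i12 (hq.integrable_sq.div_const _), integral_sub i1 i2,
    integral_const_mul, integral_const_mul, integral_div, integral_seq_next_sq hc hα hμ,
    integral_mul_seq_next hc hα hμ (adapted_clockMomentum hα s) hq]
  ring

/-- The compensated increments are orthogonal to the past. -/
theorem integral_mul_clockIncr (hc : IsThermalClock P r T n p) (hα : AdmissibleCoupling α)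
    (hγ : 0 < γ) (hμ : 1 / 2 < μ) (hr : (r : ℝ) = γ * μ) [IsProbabilityMeasure P]
    (hsu : s ≤ u) {Z : Ω → ℝ} (hZ : Adapted n p 0 s Z) (hZ2 : MemLp Z 2 P) :
    ∫ w, Z w * clockIncr α γ μ n p s u w ∂P = 0 := by
  have hμ0 : 0 < μ := by linarith
  have hq := memLp_clockMomentum hc hα hμ0 s
  have hZX : Adapted n p 1 s fun w => Z w * clockCurrent α μ n p s w :=
    (hZ.mono_left zero_le_one).comp₂ (F := fun x y => x * y) (by fun_prop)
      (adapted_clockCurrent hα s)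
  have h1 := hZX.integral_mul_incr hc hsu (fun k => k)
  -- The mean number of jumps γμ(u − s) times the mean current −𝔭₀/μ equals −γ(u − s)𝔭₀, which the
  -- drift of the increment compensates.
  rw [integral_mul_clockCurrent hc hα hμ hZ hZ2, integral_natCast_poissonMeasure, NNReal.coe_mul,
    NNReal.coe_sub hsu, hr] at h1
  have h2 : ∀ w, Z w * clockIncr α γ μ n p s u w =
      Z w * clockCurrent α μ n p s w * ((n u w - n s w : ℕ) : ℝ) +
      γ * (u - s : ℝ) * (Z w * clockMomentum α μ n p s w) := fun w => by
    rw [clockIncr_eq hc hsu]; ring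
  have i1 : Integrable (fun w => Z w * clockCurrent α μ n p s w * ((n u w - n s w : ℕ) : ℝ)) P :=
    (hZ2.integrable_mul (memLp_clockCurrent_mul_incr hc hα hγ hμ0 hsu)).congr
      (Eventually.of_forall fun w => (mul_assoc _ _ _).symm)
  have i2 : Integrable (fun w => γ * (u - s : ℝ) * (Z w * clockMomentum α μ n p s w)) P :=
    (hZ2.integrable_mul hq).const_mul _
  simp_rw [h2]
  rw [integral_add i1 i2, h1, integral_const_mul]
  field_simp
  ring

/-- The second moment of the compensated increments. -/
theorem integral_clockIncr_sq (hc : IsThermalClock P r T n p) (hα : AdmissibleCoupling α)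
    (hγ : 0 < γ) (hμ : 1 / 2 < μ) (hr : (r : ℝ) = γ * μ) [IsProbabilityMeasure P]
    (hsu : s ≤ u) :
    ∫ w, clockIncr α γ μ n p s u w ^ 2 ∂P =
      (u - s : ℝ) * (γ * ((2 - 1 / μ) * T + (∫ w, clockMomentum α μ n p s w ^ 2 ∂P) / μ)) +
        (u - s : ℝ) ^ 2 * (γ ^ 2 * (2 * μ - 1) * T) := by
  have hμ0 : 0 < μ := by linarith
  have hq := memLp_clockMomentum hc hα hμ0 s
  have hXn := memLp_clockCurrent_mul_incr hc hα hγ hμ0 hsu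
  have hX := adapted_clockCurrent (n := n) (p := p) (μ := μ) hα s
  have hqa := adapted_clockMomentum (n := n) (p := p) (μ := μ) hα s
  have hX2 : Adapted n p 1 s fun w => clockCurrent α μ n p s w ^ 2 :=
    hX.comp₂ (F := fun x _ => x ^ 2) (by fun_prop) hX
  have hqX : Adapted n p 1 s fun w => clockMomentum α μ n p s w * clockCurrent α μ n p s w :=
    (hqa.mono_left zero_le_one).comp₂ (F := fun x y => x * y) (by fun_prop) hX
  have h1 := hX2.integral_mul_incr hc hsu (fun k => (k : ℝ) ^ 2)
  have h2 := hqX.integral_mul_incr hc hsu (fun k => k)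
  rw [integral_mul_clockCurrent hc hα hμ hqa hq, integral_natCast_poissonMeasure, NNReal.coe_mul,
    NNReal.coe_sub hsu, hr] at h2
  rw [integral_clockCurrent_sq hc hα hμ, integral_natCast_sq_poissonMeasure, NNReal.coe_mul,
    NNReal.coe_sub hsu, hr] at h1
  have h3 : ∀ w, clockIncr α γ μ n p s u w ^ 2 =
      clockCurrent α μ n p s w ^ 2 * ((n u w - n s w : ℕ) : ℝ) ^ 2 +
      2 * γ * (u - s : ℝ) * (clockMomentum α μ n p s w * clockCurrent α μ n p s w *
        ((n u w - n s w : ℕ) : ℝ)) +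
      γ ^ 2 * (u - s : ℝ) ^ 2 * clockMomentum α μ n p s w ^ 2 := fun w => by
    rw [clockIncr_eq hc hsu]; ring
  have i1 : Integrable (fun w => clockCurrent α μ n p s w ^ 2 * ((n u w - n s w : ℕ) : ℝ) ^ 2) P :=
    hXn.integrable_sq.congr (Eventually.of_forall fun w => mul_pow _ _ _)
  have i2 : Integrable (fun w => 2 * γ * (u - s : ℝ) * (clockMomentum α μ n p s w *
      clockCurrent α μ n p s w * ((n u w - n s w : ℕ) : ℝ))) P :=
    ((hq.integrable_mul hXn).congr
      (Eventually.of_forall fun w => (mul_assoc _ _ _).symm)).const_mul _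
  have i3 : Integrable (fun w => γ ^ 2 * (u - s : ℝ) ^ 2 * clockMomentum α μ n p s w ^ 2) P :=
    hq.integrable_sq.const_mul _
  -- With this ρ² the first-order coefficient γμ(ρ²T + 𝔼𝔭₀²/μ²) takes the stated form; in the
  -- second-order coefficient the contributions of 𝔼𝔭₀², namely γ², −2γ² and γ², cancel.
  have hρ : rho μ ^ 2 = (2 * μ - 1) / μ ^ 2 := by
    rw [rho, div_pow, Real.sq_sqrt (by linarith)]
  simp_rw [h3]
  have i12 : Integrable (fun w =>
      clockCurrent α μ n p s w ^ 2 * ((n u w - n s w : ℕ) : ℝ) ^ 2 +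
      2 * γ * (u - s : ℝ) * (clockMomentum α μ n p s w * clockCurrent α μ n p s w *
        ((n u w - n s w : ℕ) : ℝ))) P := i1.add i2
  rw [integral_add i12 i3, integral_add i1 i2, h1, integral_const_mul, integral_const_mul,
    h2, hρ]
  simp_rw [← sq]
  field_simp
  ring

end Moments

/-! ### Itô isometry for the compensated integral -/

section Isometry

variable {Ω : Type*} [MeasurableSpace Ω] {P : Measure Ω} {r : ℝ≥0} {T : ℝ} {n : ℝ≥0 → Ω → ℕ}
  {p : ℕ → Ω → ℝ} {α : ℤ → ℝ} {γ μ : ℝ}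

/-- The second moment of the momentum of the particle with label `0`. -/
def momentumVar (P : Measure Ω) (α : ℤ → ℝ) (μ : ℝ) (n : ℝ≥0 → Ω → ℕ) (p : ℕ → Ω → ℝ) (s : ℝ) : ℝ :=
  ∫ w, clockMomentum α μ n p s.toNNReal w ^ 2 ∂P

/-- The shot noise with kernel `J` up to time `t`. -/
def clockShot (α : ℤ → ℝ) (μ : ℝ) (n : ℝ≥0 → Ω → ℕ) (p : ℕ → Ω → ℝ) (t : ℝ≥0) (s : ℝ) (w : Ω) : ℝ :=
  shot (n t w) (fun j => jumpTime (fun t => n t w) j)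
    (kick α μ (fun j => jumpTime (fun t => n t w) j) (fun j => p j w)) (J α) s

/-- The compensated integral of `f` against the current. -/
def clockDriven (α : ℤ → ℝ) (γ μ : ℝ) (n : ℝ≥0 → Ω → ℕ) (p : ℕ → Ω → ℝ) (f : ℝ → ℂ) (t : ℝ≥0)
    (w : Ω) : ℂ :=
  driven α γ (n t w) (fun j => jumpTime (fun t => n t w) j)
    (kick α μ (fun j => jumpTime (fun t => n t w) j) (fun j => p j w)) f t

/-- The points of the partition of `[0, t]` into `M` intervals of equal length. -/
def grid (t : ℝ≥0) (M k : ℕ) : ℝ≥0 := k * (t / M)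

theorem coe_grid (t : ℝ≥0) (M k : ℕ) : (grid t M k : ℝ) = k * (t / M) := by
  simp [grid]

theorem grid_mono (t : ℝ≥0) (M : ℕ) : Monotone (grid t M) := fun i j h => by
  unfold grid
  gcongr

theorem grid_le (t : ℝ≥0) {M k : ℕ} (h : k ≤ M) : grid t M k ≤ t := by
  refine (grid_mono t M h).trans ?_
  rw [grid, mul_div_left_comm]
  exact mul_le_of_le_one_right' (div_self_le_one _)

theorem clockShot_eq (hc : IsThermalClock P r T n p) {s t : ℝ≥0} (hs : s ≤ t) (w : Ω) :
    clockShot α μ n p t s w = clockMomentum α μ n p s w :=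
  ((hc.path w).shot_eq hs).symm

theorem measurable_clockShot (hc : IsThermalClock P r T n p) (hα : AdmissibleCoupling α)
    (t : ℝ≥0) : Measurable fun x : ℝ × Ω => clockShot α μ n p t x.1 x.2 := by
  have h : ∀ x : ℝ × Ω, clockShot α μ n p t x.1 x.2 =
      shot (n t x.2) (stoppedJumpTime t fun u => n u x.2)
        (kick α μ (stoppedJumpTime t fun u => n u x.2) (fun j => p j x.2)) (J α) x.1 := fun x =>
    shot_kick_congr (fun i hi => ((hc.path x.2).stoppedJumpTime_eq hi).symm) (fun _ _ => rfl) _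
  rw [funext h]
  have hS : Measurable fun x : ℝ × Ω => stoppedJumpTime t fun u => n u x.2 :=
    (measurable_stoppedJumpTime t).comp
      (measurable_pi_iff.2 fun u => (hc.measurable u).comp measurable_snd)
  have hp : Measurable fun x : ℝ × Ω => fun j => p j x.2 :=
    measurable_pi_iff.2 fun j => (hc.measurable_seq j).comp measurable_snd
  exact measurable_comp_nat (f := fun m (x : ℝ × Ω) =>
      shot m (stoppedJumpTime t fun u => n u x.2)
        (kick α μ (stoppedJumpTime t fun u => n u x.2) (fun j => p j x.2)) (J α) x.1)
    (fun m => (measurable_shot_kick hα m).comp (measurable_fst.prodMk (hS.prodMk hp)))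
    ((hc.measurable t).comp measurable_snd)

/-- On a finite horizon the momentum is a jointly measurable shot noise, so Fubini applies; for each
s the integrals over growing horizons are eventually constant. -/
theorem measurable_momentumVar (hc : IsThermalClock P r T n p) (hα : AdmissibleCoupling α)
    [SFinite P] : Measurable (momentumVar P α μ n p) := by
  have h1 : ∀ N : ℕ, Measurable fun s : ℝ => ∫ w, clockShot α μ n p N (max s 0) w ^ 2 ∂P := by
    intro N
    have h2 : Measurable fun x : ℝ × Ω => clockShot α μ n p N (max x.1 0) x.2 ^ 2 :=
      ((measurable_clockShot hc hα N).comp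
        ((measurable_fst.max measurable_const).prodMk measurable_snd)).pow_const 2
    exact h2.stronglyMeasurable.integral_prod_right'.measurable
  refine measurable_of_tendsto_metrizable h1 (tendsto_pi_nhds.2 fun s => ?_)
  refine tendsto_const_nhds.congr' ?_
  filter_upwards [eventually_ge_atTop ⌈s⌉₊] with N hN
  refine integral_congr_ae (Eventually.of_forall fun w => ?_)
  have h3 : s.toNNReal ≤ N := by
    rw [Real.toNNReal_le_iff_le_coe, NNReal.coe_natCast]
    exact (Nat.le_ceil s).trans (by exact_mod_cast hN)
  beta_reduce
  rw [← clockShot_eq hc h3, Real.coe_toNNReal']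

theorem momentumVar_nonneg (s : ℝ) : 0 ≤ momentumVar P α μ n p s :=
  integral_nonneg fun _ => sq_nonneg _

omit [MeasurableSpace Ω] in
theorem abs_clockShot_le (hμ : 0 < μ) {w : Ω} {t : ℝ≥0}
    (hw : ∀ i, |p i w| ≤ 2 ^ i * seqBound (fun j => p j w)) (s : ℝ) :
    |clockShot α μ n p t s w| ≤ growth μ (n t w) (seqBound fun j => p j w) :=
  abs_shot_kick_le hμ hw s

theorem momentumVar_le (hc : IsThermalClock P r T n p) (hμ : 0 < μ) {s : ℝ} {t : ℝ≥0}
    (hs : s ≤ t) :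
    momentumVar P α μ n p s ≤ ∫ w, growth μ (n t w) (seqBound fun j => p j w) ^ 2 ∂P := by
  refine integral_mono_of_nonneg (Eventually.of_forall fun _ => sq_nonneg _)
    (hc.integrable_growth_sq hμ t) ?_
  filter_upwards [hc.ae_abs_le] with w hw
  have h1 : s.toNNReal ≤ t := Real.toNNReal_le_iff_le_coe.2 hs
  rw [← clockShot_eq hc h1, ← sq_abs]
  have := abs_clockShot_le (α := α) (n := n) (t := t) hμ hw s.toNNReal
  gcongr

theorem integral_clockIncr_mul (hc : IsThermalClock P r T n p) (hα : AdmissibleCoupling α)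
    (hγ : 0 < γ) (hμ : 1 / 2 < μ) (hr : (r : ℝ) = γ * μ) [IsProbabilityMeasure P]
    {s₁ u₁ s₂ u₂ : ℝ≥0} (h1 : s₁ ≤ u₁) (h12 : u₁ ≤ s₂) (h2 : s₂ ≤ u₂) :
    ∫ w, clockIncr α γ μ n p s₁ u₁ w * clockIncr α γ μ n p s₂ u₂ w ∂P = 0 :=
  integral_mul_clockIncr hc hα hγ hμ hr h2 ((adapted_clockIncr hc hα h1).mono hc h12)
    (memLp_clockIncr hc hα hγ (by linarith) h1)

/-- The Riemann sums of the compensated integral. -/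
def clockSum (α : ℤ → ℝ) (γ μ : ℝ) (n : ℝ≥0 → Ω → ℕ) (p : ℕ → Ω → ℝ) (f : ℝ → ℂ) (t : ℝ≥0)
    (M : ℕ) (w : Ω) : ℂ :=
  ∑ k ∈ Finset.range M, f (grid t M k) * (clockIncr α γ μ n p (grid t M k) (grid t M (k + 1)) w : ℂ)

theorem clockSum_eq (hc : IsThermalClock P r T n p) (f : ℝ → ℂ) (t : ℝ≥0) (M : ℕ) (w : Ω) :
    clockSum α γ μ n p f t M w = ∑ k ∈ Finset.range M, f (k * (t / M)) *
      (drivenIncr α γ μ (n t w) (fun j => jumpTime (fun t => n t w) j) (fun j => p j w)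
        (k * (t / M)) ((k + 1 : ℕ) * (t / M)) : ℂ) := by
  refine Finset.sum_congr rfl fun k hk => ?_
  rw [← drivenIncr_eq_clockIncr hc (grid_mono t M k.le_succ)
    (grid_le t (Finset.mem_range.1 hk)), coe_grid, coe_grid]

/-- Increments over disjoint cells are orthogonal, as the earlier one is adapted and the later one
is centred against the past; only the diagonal of the double sum survives. -/
theorem integral_conj_clockSum_mul (hc : IsThermalClock P r T n p) (hα : AdmissibleCoupling α)
    (hγ : 0 < γ) (hμ : 1 / 2 < μ) (hr : (r : ℝ) = γ * μ) [IsProbabilityMeasure P]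
    (f g : ℝ → ℂ) (t : ℝ≥0) (M : ℕ) :
    ∫ w, starRingEnd ℂ (clockSum α γ μ n p f t M w) * clockSum α γ μ n p g t M w ∂P =
      ∑ k ∈ Finset.range M, starRingEnd ℂ (f (grid t M k)) * g (grid t M k) *
        ((∫ w, clockIncr α γ μ n p (grid t M k) (grid t M (k + 1)) w ^ 2 ∂P : ℝ) : ℂ) := by
  have hμ0 : 0 < μ := by linarith
  set D : ℕ → Ω → ℝ := fun k => clockIncr α γ μ n p (grid t M k) (grid t M (k + 1)) with hD
  have hD2 : ∀ k, MemLp (D k) 2 P := fun k =>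
    memLp_clockIncr hc hα hγ hμ0 (grid_mono t M k.le_succ)
  have horth : ∀ k l, k ≠ l → ∫ w, D k w * D l w ∂P = 0 := by
    intro k l hkl
    rcases lt_or_gt_of_ne hkl with h | h
    · exact integral_clockIncr_mul hc hα hγ hμ hr (grid_mono t M k.le_succ) (grid_mono t M h)
        (grid_mono t M l.le_succ)
    · simp_rw [mul_comm (D k _)]
      exact integral_clockIncr_mul hc hα hγ hμ hr (grid_mono t M l.le_succ) (grid_mono t M h)
        (grid_mono t M k.le_succ)
  have h1 : ∀ w, starRingEnd ℂ (clockSum α γ μ n p f t M w) * clockSum α γ μ n p g t M w =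
      ∑ k ∈ Finset.range M, ∑ l ∈ Finset.range M,
        starRingEnd ℂ (f (grid t M k)) * g (grid t M l) * ((D k w * D l w : ℝ) : ℂ) := by
    intro w
    simp only [clockSum, map_sum, Finset.sum_mul_sum]
    refine Finset.sum_congr rfl fun k _ => Finset.sum_congr rfl fun l _ => ?_
    rw [map_mul, Complex.conj_ofReal]
    push_cast
    ring
  have hint : ∀ k l, Integrable (fun w => starRingEnd ℂ (f (grid t M k)) * g (grid t M l) *
      ((D k w * D l w : ℝ) : ℂ)) P := fun k l =>
    (((hD2 k).integrable_mul (hD2 l)).ofReal).const_mul _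
  simp_rw [h1]
  rw [integral_finsetSum _ fun k _ => integrable_finsetSum _ fun l _ => hint k l]
  refine Finset.sum_congr rfl fun k hk => ?_
  rw [integral_finsetSum _ fun l _ => hint k l, Finset.sum_eq_single_of_mem k hk]
  · rw [integral_const_mul, integral_complex_ofReal]
    simp_rw [sq]
    rfl
  · intro l _ hl
    rw [integral_const_mul, integral_complex_ofReal, horth k l hl.symm]
    simp

theorem measurable_clockSum (hc : IsThermalClock P r T n p) (hα : AdmissibleCoupling α)
    (f : ℝ → ℂ) (t : ℝ≥0) (M : ℕ) : Measurable (clockSum α γ μ n p f t M) := by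
  unfold clockSum
  refine Finset.measurable_sum _ fun k _ => measurable_const.mul (Complex.measurable_ofReal.comp ?_)
  exact (adapted_clockIncr hc hα (grid_mono t M k.le_succ)).measurable hc

theorem tendsto_clockSum (hc : IsThermalClock P r T n p) (hα : AdmissibleCoupling α)
    {f : ℝ → ℂ} (hf : Continuous f) {t : ℝ≥0} (ht : 0 < t) (w : Ω) :
    Tendsto (fun M => clockSum α γ μ n p f t M w) atTop (𝓝 (clockDriven α γ μ n p f t w)) := by
  simp_rw [clockSum_eq hc]
  have hn := hc.path w
  exact tendsto_sum_drivenIncr hα hf (NNReal.coe_pos.2 ht)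
    (fun j hj => ⟨NNReal.coe_pos.2 (hn.jumpTime_pos hj), (hn.jumpTime_mem j hj).2⟩)
    fun i j hij hj => NNReal.coe_le_coe.2 (hn.jumpTime_le_jumpTime hij hj)

theorem clockDriven_zero (hc : IsThermalClock P r T n p) (f : ℝ → ℂ) (w : Ω) :
    clockDriven α γ μ n p f 0 w = 0 := by
  have h0 : n 0 w = 0 := (hc.path w).zero
  simp [clockDriven, driven, h0]

theorem norm_clockSum_le (hc : IsThermalClock P r T n p) (hγ : 0 < γ) (hμ : 0 < μ) {f : ℝ → ℂ}
    {t : ℝ≥0} {C : ℝ} (hf : ∀ s ∈ Icc (0 : ℝ) t, ‖f s‖ ≤ C) {w : Ω}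
    (hw : ∀ i, |p i w| ≤ 2 ^ i * seqBound (fun j => p j w)) (M : ℕ) :
    ‖clockSum α γ μ n p f t M w‖ ≤
      C * (1 + γ * t) * growth μ (n t w) (seqBound fun j => p j w) := by
  rw [clockSum_eq hc]
  exact norm_sum_drivenIncr_le hγ hμ hw t.2 hf M

theorem integrable_mul_clockShot_sq (hc : IsThermalClock P r T n p) (hα : AdmissibleCoupling α)
    (hμ : 0 < μ) [IsProbabilityMeasure P] {f : ℝ → ℂ} (hf : Continuous f) (t : ℝ≥0) :
    Integrable (fun x : ℝ × Ω => f x.1 * ((clockShot α μ n p t x.1 x.2 ^ 2 : ℝ) : ℂ))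
      ((volume.restrict (Ioc (0 : ℝ) t)).prod P) := by
  obtain ⟨C, hC⟩ := isCompact_Icc.exists_bound_of_continuousOn
    (hf.continuousOn (s := Icc (0 : ℝ) t))
  have hb := ((hc.integrable_growth_sq hμ t).const_mul C).comp_snd (volume.restrict (Ioc (0 : ℝ) t))
  refine hb.mono' ?_ ?_
  · exact ((hf.measurable.comp measurable_fst).mul (Complex.measurable_ofReal.comp
      ((measurable_clockShot hc hα t).pow_const 2))).aestronglyMeasurable
  · have h1 : ∀ᵐ x : ℝ × Ω ∂((volume.restrict (Ioc (0 : ℝ) t)).prod P),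
        ∀ i, |p i x.2| ≤ 2 ^ i * seqBound (fun j => p j x.2) :=
      Measure.quasiMeasurePreserving_snd.ae hc.ae_abs_le
    have h2 : ∀ᵐ x : ℝ × Ω ∂((volume.restrict (Ioc (0 : ℝ) t)).prod P), x.1 ∈ Ioc (0 : ℝ) t :=
      Measure.quasiMeasurePreserving_fst.ae (ae_restrict_mem measurableSet_Ioc)
    filter_upwards [h1, h2] with x hx hx2
    rw [norm_mul, Complex.norm_real, Real.norm_of_nonneg (sq_nonneg _), ← sq_abs]
    have h3 := hC x.1 ⟨hx2.1.le, hx2.2⟩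
    have h4 := abs_clockShot_le (α := α) (n := n) (t := t) hμ hx x.1
    exact mul_le_mul h3 (by gcongr) (by positivity) ((norm_nonneg _).trans h3)

theorem integral_integral_clockShot_sq (hc : IsThermalClock P r T n p)
    (hα : AdmissibleCoupling α) (hμ : 0 < μ) [IsProbabilityMeasure P] {f : ℝ → ℂ}
    (hf : Continuous f) (t : ℝ≥0) :
    ∫ w, (∫ s in (0 : ℝ)..t, f s * ((clockShot α μ n p t s w ^ 2 : ℝ) : ℂ)) ∂P =
      ∫ s in (0 : ℝ)..t, f s * (momentumVar P α μ n p s : ℂ) := by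
  simp_rw [intervalIntegral.integral_of_le (NNReal.coe_nonneg t)]
  rw [← integral_integral_swap (integrable_mul_clockShot_sq hc hα hμ hf t)]
  refine setIntegral_congr_fun measurableSet_Ioc fun s hs => ?_
  rw [integral_const_mul, integral_complex_ofReal, momentumVar]
  congr 2
  refine integral_congr_ae (Eventually.of_forall fun w => ?_)
  beta_reduce
  rw [← clockShot_eq hc (Real.toNNReal_le_iff_le_coe.2 hs.2), Real.coe_toNNReal _ hs.1.le]

/-- Continuity of 𝔼𝔭₀² in time is bypassed: the Riemann sums of 𝔭₀² converge along each path, which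
has finitely many jumps, and the expectation follows by domination. -/
theorem tendsto_sum_momentumVar (hc : IsThermalClock P r T n p) (hα : AdmissibleCoupling α)
    (hμ : 0 < μ) [IsProbabilityMeasure P] {f : ℝ → ℂ} (hf : Continuous f) {t : ℝ≥0} (ht : 0 < t) :
    Tendsto (fun M : ℕ => ∑ k ∈ Finset.range M, ((t / M : ℝ) : ℂ) *
      (f (grid t M k) * (momentumVar P α μ n p (grid t M k) : ℂ))) atTop
      (𝓝 (∫ s in (0 : ℝ)..t, f s * (momentumVar P α μ n p s : ℂ))) := by
  rw [← integral_integral_clockShot_sq hc hα hμ hf t]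
  have hsum : ∀ M : ℕ, ∑ k ∈ Finset.range M, ((t / M : ℝ) : ℂ) *
      (f (grid t M k) * (momentumVar P α μ n p (grid t M k) : ℂ)) =
      ∫ w, ∑ k ∈ Finset.range M, ((t / M : ℝ) : ℂ) *
        (f (k * (t / M)) * ((clockShot α μ n p t (k * (t / M)) w ^ 2 : ℝ) : ℂ)) ∂P := by
    intro M
    have hint : ∀ k, Integrable (fun w => ((t / M : ℝ) : ℂ) *
        (f (grid t M k) * ((clockMomentum α μ n p (grid t M k) w ^ 2 : ℝ) : ℂ))) P := fun k =>
      ((((memLp_clockMomentum hc hα hμ _).integrable_sq).ofReal).const_mul _).const_mul _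
    have h1 : ∀ w, ∑ k ∈ Finset.range M, ((t / M : ℝ) : ℂ) *
        (f (k * (t / M)) * ((clockShot α μ n p t (k * (t / M)) w ^ 2 : ℝ) : ℂ)) =
        ∑ k ∈ Finset.range M, ((t / M : ℝ) : ℂ) *
        (f (grid t M k) * ((clockMomentum α μ n p (grid t M k) w ^ 2 : ℝ) : ℂ)) := fun w =>
      Finset.sum_congr rfl fun k hk => by
        rw [← clockShot_eq hc (grid_le t (Finset.mem_range.1 hk).le), coe_grid]
    simp_rw [h1]
    rw [integral_finsetSum _ fun k _ => hint k]
    refine Finset.sum_congr rfl fun k _ => ?_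
    rw [integral_const_mul, integral_const_mul, integral_complex_ofReal, momentumVar,
      Real.toNNReal_coe]
  simp_rw [hsum]
  obtain ⟨C, hC⟩ := isCompact_Icc.exists_bound_of_continuousOn
    (hf.continuousOn (s := Icc (0 : ℝ) t))
  have hC0 : 0 ≤ C := (norm_nonneg _).trans (hC 0 ⟨le_rfl, t.2⟩)
  refine tendsto_integral_of_dominated_convergence
    (fun w => t * (C * growth μ (n t w) (seqBound fun j => p j w) ^ 2)) (fun M => ?_)
    (((hc.integrable_growth_sq hμ t).const_mul C).const_mul _) (fun M => ?_)
    (Eventually.of_forall fun w => tendsto_sum_shot_sq hα hf (NNReal.coe_pos.2 ht) _)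
  · refine (Finset.measurable_sum _ fun k _ => measurable_const.mul (measurable_const.mul
      (Complex.measurable_ofReal.comp ?_))).aestronglyMeasurable
    exact ((measurable_clockShot hc hα t).comp
      (measurable_const.prodMk measurable_id)).pow_const 2
  · filter_upwards [hc.ae_abs_le] with w hw
    have hterm : ∀ k ∈ Finset.range M, ‖((t / M : ℝ) : ℂ) *
        (f (k * (t / M)) * ((clockShot α μ n p t (k * (t / M)) w ^ 2 : ℝ) : ℂ))‖ ≤
        t / M * (C * growth μ (n t w) (seqBound fun j => p j w) ^ 2) := by
      intro k hk
      rw [norm_mul, norm_mul, Complex.norm_real, Complex.norm_real,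
        Real.norm_of_nonneg (show 0 ≤ (t / M : ℝ) by positivity),
        Real.norm_of_nonneg (sq_nonneg _), ← sq_abs (clockShot _ _ _ _ _ _ _)]
      have h3 := hC (grid t M k) ⟨NNReal.coe_nonneg _,
        NNReal.coe_le_coe.2 (grid_le t (Finset.mem_range.1 hk).le)⟩
      rw [coe_grid] at h3
      have h4 := abs_clockShot_le (α := α) (n := n) (t := t) hμ hw (k * (t / M))
      gcongr
    refine (norm_sum_le_of_le _ hterm).trans ?_
    rw [Finset.sum_const, Finset.card_range, nsmul_eq_mul, ← mul_assoc]
    refine mul_le_mul_of_nonneg_right ?_ (by positivity)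
    rw [mul_div_left_comm]
    exact mul_le_of_le_one_right t.2 (div_self_le_one _)

theorem intervalIntegrable_momentumVar (hc : IsThermalClock P r T n p)
    (hα : AdmissibleCoupling α) (hμ : 0 < μ) [SFinite P] {t : ℝ} (ht : 0 ≤ t) :
    IntervalIntegrable (momentumVar P α μ n p) volume 0 t := by
  rw [intervalIntegrable_iff, uIoc_of_le ht]
  refine Measure.integrableOn_of_bounded
    (M := ∫ w, growth μ (n t.toNNReal w) (seqBound fun j => p j w) ^ 2 ∂P)
    (by simp) (measurable_momentumVar hc hα).aestronglyMeasurable ?_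
  filter_upwards [ae_restrict_mem measurableSet_Ioc] with s hs
  rw [Real.norm_of_nonneg (momentumVar_nonneg s)]
  exact momentumVar_le hc hμ (by rw [Real.coe_toNNReal _ ht]; exact hs.2)

theorem integral_conj_clockSum_mul_eq (hc : IsThermalClock P r T n p) (hα : AdmissibleCoupling α)
    (hγ : 0 < γ) (hμ : 1 / 2 < μ) (hr : (r : ℝ) = γ * μ) [IsProbabilityMeasure P]
    (f g : ℝ → ℂ) (t : ℝ≥0) (M : ℕ) :
    ∫ w, starRingEnd ℂ (clockSum α γ μ n p f t M w) * clockSum α γ μ n p g t M w ∂P =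
      γ * ((2 - 1 / μ) * T : ℝ) * (∑ k ∈ Finset.range M, ((t / M : ℝ) : ℂ) *
        (starRingEnd ℂ (f (k * (t / M))) * g (k * (t / M)))) +
      γ / μ * (∑ k ∈ Finset.range M, ((t / M : ℝ) : ℂ) *
        (starRingEnd ℂ (f (grid t M k)) * g (grid t M k) *
          (momentumVar P α μ n p (grid t M k) : ℂ))) +
      ((t / M : ℝ) : ℂ) * (γ ^ 2 * (2 * μ - 1) * T : ℝ) *
        (∑ k ∈ Finset.range M, ((t / M : ℝ) : ℂ) *
        (starRingEnd ℂ (f (k * (t / M))) * g (k * (t / M)))) := by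
  rw [integral_conj_clockSum_mul hc hα hγ hμ hr, Finset.mul_sum, Finset.mul_sum, Finset.mul_sum,
    ← Finset.sum_add_distrib, ← Finset.sum_add_distrib]
  refine Finset.sum_congr rfl fun k _ => ?_
  have hstep : ((grid t M (k + 1) : ℝ) - grid t M k) = t / M := by
    rw [coe_grid, coe_grid]
    push_cast
    ring
  rw [integral_clockIncr_sq hc hα hγ hμ hr (grid_mono t M k.le_succ), hstep, momentumVar,
    Real.toNNReal_coe, coe_grid]
  push_cast
  ring

/-- The Itô isometry for the compensated integrals. -/
theorem integral_conj_clockDriven_mul (hc : IsThermalClock P r T n p) (hα : AdmissibleCoupling α)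
    (hγ : 0 < γ) (hμ : 1 / 2 < μ) (hr : (r : ℝ) = γ * μ) [IsProbabilityMeasure P]
    {f g : ℝ → ℂ} (hf : Continuous f) (hg : Continuous g) (t : ℝ≥0) :
    Integrable (fun w => starRingEnd ℂ (clockDriven α γ μ n p f t w) *
      clockDriven α γ μ n p g t w) P ∧
    ∫ w, starRingEnd ℂ (clockDriven α γ μ n p f t w) * clockDriven α γ μ n p g t w ∂P =
      γ * ∫ s in (0 : ℝ)..t, starRingEnd ℂ (f s) * g s *
        (((2 - 1 / μ) * T + momentumVar P α μ n p s / μ : ℝ) : ℂ) := by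
  have hμ0 : 0 < μ := by linarith
  rcases eq_zero_or_pos t with rfl | ht
  · simp [clockDriven_zero hc]
  have hF : Continuous fun s => starRingEnd ℂ (f s) * g s :=
    (Complex.continuous_conj.comp hf).mul hg
  obtain ⟨A, hA⟩ := isCompact_Icc.exists_bound_of_continuousOn
    (hf.continuousOn (s := Icc (0 : ℝ) t))
  obtain ⟨B, hB⟩ := isCompact_Icc.exists_bound_of_continuousOn
    (hg.continuousOn (s := Icc (0 : ℝ) t))
  obtain ⟨C, hC⟩ := isCompact_Icc.exists_bound_of_continuousOn
    (hF.continuousOn (s := Icc (0 : ℝ) t))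
  have hA0 : 0 ≤ A := (norm_nonneg _).trans (hA 0 ⟨le_rfl, t.2⟩)
  set b : Ω → ℝ := fun w => A * (1 + γ * t) * (B * (1 + γ * t)) *
    growth μ (n t w) (seqBound fun j => p j w) ^ 2 with hb
  have hbi : Integrable b P := (hc.integrable_growth_sq hμ0 t).const_mul _
  have hlim : ∀ w, Tendsto (fun M => starRingEnd ℂ (clockSum α γ μ n p f t M w) *
      clockSum α γ μ n p g t M w) atTop (𝓝 (starRingEnd ℂ (clockDriven α γ μ n p f t w) *
      clockDriven α γ μ n p g t w)) := fun w =>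
    ((Complex.continuous_conj.tendsto _).comp (tendsto_clockSum hc hα hf ht w)).mul
      (tendsto_clockSum hc hα hg ht w)
  have hmeas : ∀ M, AEStronglyMeasurable (fun w => starRingEnd ℂ (clockSum α γ μ n p f t M w) *
      clockSum α γ μ n p g t M w) P := fun M =>
    ((Complex.continuous_conj.measurable.comp (measurable_clockSum hc hα f t M)).mul
      (measurable_clockSum hc hα g t M)).aestronglyMeasurable
  have hbound : ∀ᵐ w ∂P, ∀ M, ‖starRingEnd ℂ (clockSum α γ μ n p f t M w) *
      clockSum α γ μ n p g t M w‖ ≤ b w := by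
    filter_upwards [hc.ae_abs_le] with w hw M
    rw [norm_mul, RCLike.norm_conj]
    have h1 := norm_clockSum_le (α := α) hc hγ hμ0 hA hw M
    have h2 := norm_clockSum_le (α := α) hc hγ hμ0 hB hw M
    refine (mul_le_mul h1 h2 (norm_nonneg _) ((norm_nonneg _).trans h1)).trans (le_of_eq ?_)
    rw [hb]
    ring
  refine ⟨hbi.mono' (aestronglyMeasurable_of_tendsto_ae atTop hmeas
    (Eventually.of_forall hlim)) ?_, ?_⟩
  · filter_upwards [hbound] with w hw
    exact le_of_tendsto (hlim w).norm (Eventually.of_forall hw)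
  have h1 := tendsto_integral_of_dominated_convergence b hmeas hbi
    (fun M => hbound.mono fun w hw => hw M) (Eventually.of_forall hlim)
  simp_rw [integral_conj_clockSum_mul_eq hc hα hγ hμ hr] at h1
  have h2 : Tendsto (fun M : ℕ => ∑ k ∈ Finset.range M, ((t / M : ℝ) : ℂ) *
      (starRingEnd ℂ (f (k * (t / M))) * g (k * (t / M)))) atTop
      (𝓝 (∫ s in (0 : ℝ)..t, starRingEnd ℂ (f s) * g s)) :=
    tendsto_riemann_sum (G := fun s => starRingEnd ℂ (f s) * g s) (NNReal.coe_pos.2 ht)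
      countable_empty (fun s _ _ => hF.continuousAt) hC
  have h3 := tendsto_sum_momentumVar (α := α) hc hα hμ0 hF ht
  -- The second-order part of the variance of the increments carries one extra mesh factor and
  -- disappears.
  have h4 : Tendsto (fun M : ℕ => ((t / M : ℝ) : ℂ)) atTop (𝓝 ((0 : ℝ) : ℂ)) :=
    (Complex.continuous_ofReal.tendsto _).comp (tendsto_const_div_atTop_nhds_zero_nat (t : ℝ))
  have h5 := ((h2.const_mul (γ * ((2 - 1 / μ) * T : ℝ) : ℂ)).add
    (h3.const_mul (γ / μ : ℂ))).add ((h4.mul_const ((γ ^ 2 * (2 * μ - 1) * T : ℝ) : ℂ)).mul h2)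
  rw [tendsto_nhds_unique h1 h5]
  have h6 : IntervalIntegrable (fun s => starRingEnd ℂ (f s) * g s *
      (momentumVar P α μ n p s : ℂ)) volume 0 t :=
    IntervalIntegrable.continuousOn_mul (f := fun s => (momentumVar P α μ n p s : ℂ))
      ⟨(intervalIntegrable_momentumVar hc hα hμ0 (NNReal.coe_nonneg t)).1.ofReal,
        (intervalIntegrable_momentumVar hc hα hμ0 (NNReal.coe_nonneg t)).2.ofReal⟩
      hF.continuousOn
  have h7 : ∀ s, starRingEnd ℂ (f s) * g s *
      (((2 - 1 / μ) * T + momentumVar P α μ n p s / μ : ℝ) : ℂ) =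
      ((2 - 1 / μ) * T : ℝ) * (starRingEnd ℂ (f s) * g s) +
      (1 / μ : ℂ) * (starRingEnd ℂ (f s) * g s * (momentumVar P α μ n p s : ℂ)) := fun s => by
    push_cast
    ring
  simp_rw [h7]
  rw [intervalIntegral.integral_add ((hF.intervalIntegrable _ _).const_mul _) (h6.const_mul _),
    intervalIntegral.integral_const_mul, intervalIntegral.integral_const_mul]
  push_cast
  ring

end Isometry

/-! ### Renewal equation for the injected energy -/

section Renewal

variable {Ω : Type*} [MeasurableSpace Ω] {P : Measure Ω} {r : ℝ≥0} {T : ℝ} {n : ℝ≥0 → Ω → ℕ}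
  {p : ℕ → Ω → ℝ} {α : ℤ → ℝ} {γ μ : ℝ} {h : ℝ → ℝ}

/-- The wave function driven by the thermostat, as a shot noise. -/
def clockWave (α : ℤ → ℝ) (μ : ℝ) (n : ℝ≥0 → Ω → ℕ) (p : ℕ → Ω → ℝ) (t : ℝ≥0) (w : Ω) (k : ℝ) : ℂ :=
  shot (n t w) (fun j => jumpTime (fun t => n t w) j)
    (kick α μ (fun j => jumpTime (fun t => n t w) j) (fun j => p j w))
    (fun u => Complex.I * Complex.exp (-(Complex.I * disp α k) * u)) t

theorem IsResponse.volterra_ofReal (hh : IsResponse α γ h) (u : ℝ) :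
    (J α u : ℂ) = h u + γ * ∫ s in (0 : ℝ)..u, (J α s : ℂ) * (h (u - s) : ℂ) := by
  have h1 : ∫ s in (0 : ℝ)..u, J α s * h (u - s) = ∫ s in (0 : ℝ)..u, J α (u - s) * h s := by
    simpa using (intervalIntegral.integral_comp_sub_left
      (fun s => J α (u - s) * h s) (a := 0) (b := u) u)
  have h2 := hh.volterra u
  rw [← h1] at h2
  simp_rw [← Complex.ofReal_mul]
  rw [intervalIntegral.integral_ofReal, h2]
  push_cast
  ring

/-- The Volterra equation has the form e = f + γ J∗f with e = J and f = h, so damped propagation of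
the noise gives the momentum. -/
theorem clockMomentum_eq_clockDriven (hc : IsThermalClock P r T n p) (hα : AdmissibleCoupling α)
    (hh : IsResponse α γ h) (t : ℝ≥0) (w : Ω) :
    (clockMomentum α μ n p t w : ℂ) =
      clockDriven α γ μ n p (fun s => (h (t - s) : ℂ)) t w := by
  have h1 := shot_eq_driven hα (γ := γ) (m := n t w)
    (x := kick α μ (fun j => jumpTime (fun t => n t w) j) (fun j => p j w))
    (Complex.continuous_ofReal.comp hh.continuous) hh.volterra_ofReal
    ((hc.path w).jumpTime_mem (t := t))
  rw [clockDriven, ← Function.comp_def, ← Function.comp_def]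
  refine Eq.trans ?_ h1
  rw [clockMomentum, shot, shot]
  push_cast
  refine Finset.sum_congr rfl fun j _ => ?_
  split_ifs <;> simp

theorem clockWave_eq_clockDriven (hc : IsThermalClock P r T n p) (hα : AdmissibleCoupling α)
    (hh : IsResponse α γ h) (t : ℝ≥0) (w : Ω) (k : ℝ) :
    clockWave α μ n p t w k = clockDriven α γ μ n p (fun s => resp α γ h (t - s) k) t w :=
  shot_eq_driven hα (f := fun t => resp α γ h t k)
    ((continuous_resp (γ := γ) hα hh.continuous).comp (f := fun t : ℝ => (t, k)) (by fun_prop))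
    (fun u => hh.resolvent u k) ((hc.path w).jumpTime_mem (t := t))

/-- The rate at which energy is injected into the chain. -/
def injection (P : Measure Ω) (α : ℤ → ℝ) (μ T : ℝ) (n : ℝ≥0 → Ω → ℕ) (p : ℕ → Ω → ℝ) (s : ℝ) : ℝ :=
  (2 - 1 / μ) * T + momentumVar P α μ n p s / μ

theorem integral_conj_clockWave_mul (hc : IsThermalClock P r T n p) (hα : AdmissibleCoupling α)
    (hγ : 0 < γ) (hμ : 1 / 2 < μ) (hr : (r : ℝ) = γ * μ) [IsProbabilityMeasure P]
    (hh : IsResponse α γ h) (t : ℝ≥0) (k₁ k₂ : ℝ) :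
    Integrable (fun w => starRingEnd ℂ (clockWave α μ n p t w k₁) * clockWave α μ n p t w k₂) P ∧
    ∫ w, starRingEnd ℂ (clockWave α μ n p t w k₁) * clockWave α μ n p t w k₂ ∂P =
      γ * ∫ s in (0 : ℝ)..t, starRingEnd ℂ (resp α γ h (t - s) k₁) * resp α γ h (t - s) k₂ *
        (injection P α μ T n p s : ℂ) := by
  simp_rw [clockWave_eq_clockDriven hc hα hh]
  have hf : ∀ k, Continuous fun s : ℝ => resp α γ h (t - s) k := fun k =>
    (continuous_resp (γ := γ) hα hh.continuous).comp (f := fun s : ℝ => ((t - s : ℝ), k))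
      (by fun_prop)
  exact integral_conj_clockDriven_mul hc hα hγ hμ hr (hf k₁) (hf k₂) t

/-- The isometry with f = g = h(t − ·). As the injection contains 𝔼𝔭₀² itself, this is a renewal
equation with kernel (γ/μ)h² of total mass Γ/μ < 1. -/
theorem momentumVar_eq (hc : IsThermalClock P r T n p) (hα : AdmissibleCoupling α)
    (hγ : 0 < γ) (hμ : 1 / 2 < μ) (hr : (r : ℝ) = γ * μ) [IsProbabilityMeasure P]
    (hh : IsResponse α γ h) {t : ℝ} (ht : 0 ≤ t) :
    momentumVar P α μ n p t = γ * ∫ s in (0 : ℝ)..t, h (t - s) ^ 2 * injection P α μ T n p s := by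
  lift t to ℝ≥0 using ht
  have hf : Continuous fun s : ℝ => (h (t - s) : ℂ) :=
    Complex.continuous_ofReal.comp (hh.continuous.comp (by fun_prop))
  have h1 := (integral_conj_clockDriven_mul hc hα hγ hμ hr hf hf t).2
  simp_rw [← clockMomentum_eq_clockDriven hc hα hh, Complex.conj_ofReal] at h1
  rw [← Complex.ofReal_inj, momentumVar, Real.toNNReal_coe, ← integral_complex_ofReal]
  simp_rw [Complex.ofReal_pow, pow_two]
  rw [h1, Complex.ofReal_mul, ← intervalIntegral.integral_ofReal]
  simp_rw [injection]
  push_cast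
  rfl

theorem injection_nonneg (hμ : 1 / 2 < μ) (hT : 0 ≤ T) (s : ℝ) : 0 ≤ injection P α μ T n p s := by
  have h1 : 0 < μ := by linarith
  have h2 : 1 / μ ≤ 2 := by
    rw [div_le_iff₀ h1]
    linarith
  exact add_nonneg (mul_nonneg (by linarith) hT) (div_nonneg (momentumVar_nonneg s) h1.le)

theorem measurable_injection (hc : IsThermalClock P r T n p) (hα : AdmissibleCoupling α)
    [SFinite P] : Measurable (injection P α μ T n p) :=
  ((measurable_momentumVar hc hα).div_const μ).const_add _

theorem intervalIntegrable_injection (hc : IsThermalClock P r T n p)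
    (hα : AdmissibleCoupling α) (hμ : 0 < μ) [SFinite P] {t : ℝ} (ht : 0 ≤ t) :
    IntervalIntegrable (injection P α μ T n p) volume 0 t :=
  intervalIntegrable_const.add ((intervalIntegrable_momentumVar hc hα hμ ht).div_const μ)

/-- The supremum S over [0, t] is finite and satisfies S ≤ (2 − 1/μ)T + S/(2μ) by γ∫h² ≤ 1/2. As
1/(2μ) < 1, this bounds S independently of t. -/
theorem exists_injection_le (hc : IsThermalClock P r T n p) (hα : AdmissibleCoupling α)
    (hγ : 0 < γ) (hμ : 1 / 2 < μ) (hT : 0 ≤ T) (hr : (r : ℝ) = γ * μ) [IsProbabilityMeasure P]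
    (hh : IsResponse α γ h) : ∃ C, ∀ t, 0 ≤ t → injection P α μ T n p t ≤ C := by
  have hμ0 : 0 < μ := by linarith
  have hθ : 1 / (2 * μ) < 1 := by
    rw [div_lt_one (by positivity)]
    linarith
  have h2 : 0 ≤ (2 - 1 / μ) * T := by
    have : 1 / μ ≤ 2 := by
      rw [div_le_iff₀ hμ0]
      linarith
    exact mul_nonneg (by linarith) hT
  refine ⟨(2 - 1 / μ) * T / (1 - 1 / (2 * μ)), fun t ht => ?_⟩
  set A := injection P α μ T n p
  set S := A '' Icc 0 t
  have hne : S.Nonempty := ⟨A 0, 0, ⟨le_rfl, ht⟩, rfl⟩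
  have hbdd : BddAbove S := by
    refine ⟨(2 - 1 / μ) * T +
      (∫ w, growth μ (n t.toNNReal w) (seqBound fun j => p j w) ^ 2 ∂P) / μ, ?_⟩
    rintro _ ⟨s, hs, rfl⟩
    refine add_le_add_right (div_le_div_of_nonneg_right ?_ hμ0.le) _
    exact momentumVar_le hc hμ0 (by rw [Real.coe_toNNReal _ ht]; exact hs.2)
  have hA0 : 0 ≤ sSup S := (injection_nonneg hμ hT 0).trans (le_csSup hbdd ⟨0, ⟨le_rfl, ht⟩, rfl⟩)
  have hle : ∀ s ∈ Icc 0 t, A s ≤ (2 - 1 / μ) * T + 1 / (2 * μ) * sSup S := fun s hs => by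
    have h3 : ∫ u in (0 : ℝ)..s, h (s - u) ^ 2 * A u ≤ ∫ u in (0 : ℝ)..s, h (s - u) ^ 2 * sSup S := by
      have hc2 : Continuous fun u => h (s - u) ^ 2 :=
        (hh.continuous.comp (by fun_prop)).pow 2
      refine intervalIntegral.integral_mono_on hs.1
        ((intervalIntegrable_injection hc hα hμ0 hs.1).continuousOn_mul hc2.continuousOn)
        ((hc2.intervalIntegrable _ _).mul_const _) fun u hu => ?_
      exact mul_le_mul_of_nonneg_left
        (le_csSup hbdd ⟨u, ⟨hu.1, hu.2.trans hs.2⟩, rfl⟩) (sq_nonneg _)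
    have h4 : ∫ u in (0 : ℝ)..s, h (s - u) ^ 2 = ∫ u in (0 : ℝ)..s, h u ^ 2 := by
      simpa using (intervalIntegral.integral_comp_sub_left (fun u => h u ^ 2)
        (a := 0) (b := s) s)
    rw [intervalIntegral.integral_mul_const, h4] at h3
    have h5 := hh.energy s hs.1
    show (2 - 1 / μ) * T + momentumVar P α μ n p s / μ ≤ _
    rw [momentumVar_eq hc hα hγ hμ hr hh hs.1]
    gcongr
    rw [div_le_iff₀ hμ0]
    calc γ * ∫ u in (0 : ℝ)..s, h (s - u) ^ 2 * A u
        ≤ (γ * ∫ u in (0 : ℝ)..s, h u ^ 2) * sSup S := by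
          rw [mul_assoc]
          exact mul_le_mul_of_nonneg_left h3 hγ.le
      _ ≤ 1 / 2 * sSup S := mul_le_mul_of_nonneg_right h5 hA0
      _ = 1 / (2 * μ) * sSup S * μ := by field_simp
  have h6 : sSup S ≤ (2 - 1 / μ) * T + 1 / (2 * μ) * sSup S := csSup_le hne (by
    rintro _ ⟨s, hs, rfl⟩
    exact hle s hs)
  have h7 : A t ≤ sSup S := le_csSup hbdd ⟨t, ⟨ht, le_rfl⟩, rfl⟩
  rw [le_div_iff₀ (by linarith)]
  refine (mul_le_mul_of_nonneg_right h7 (by linarith)).trans ?_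
  linarith

end Renewal

/-! ### From the Poisson process to the thermal clock -/

section PoissonClock

variable {Ω : Type*} [MeasurableSpace Ω] {P : Measure Ω} {T : ℝ} {N : ℝ≥0 → Ω → ℕ}
  {p : ℕ → Ω → ℝ}

theorem exists_monotone_partition (F : Finset ℝ≥0) : ∀ s, (∀ u ∈ F, u ≤ s) →
    ∃ (τ : ℕ → ℝ≥0) (m : ℕ), Monotone τ ∧ τ 0 = 0 ∧ (∀ i, m ≤ i → τ i = s) ∧
      ∀ u ∈ F, ∃ i, i ≤ m ∧ τ i = u := by
  have extend : ∀ (τ : ℕ → ℝ≥0) (m : ℕ) (a s : ℝ≥0), Monotone τ → (∀ i, m ≤ i → τ i = a) →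
      a ≤ s → Monotone fun i => if i ≤ m then τ i else s := by
    intro τ m a s h1 h2 h3 i j hij
    beta_reduce
    split_ifs with hi hj hj
    · exact h1 hij
    · exact (h1 hi).trans ((h2 m le_rfl).le.trans h3)
    · omega
    · exact le_rfl
  induction F using Finset.induction_on_max with
  | empty =>
    intro s _
    exact ⟨fun i => if i ≤ 0 then 0 else s, 1,
      extend (fun _ => 0) 0 0 s monotone_const (fun _ _ => rfl) zero_le, by simp,
      fun i hi => if_neg (by omega), by simp⟩
  | insert a F ha ih =>
    intro s hs
    obtain ⟨τ, m, h1, h2, h3, h4⟩ := ih a fun u hu => (ha u hu).le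
    refine ⟨fun i => if i ≤ m then τ i else s, m + 1,
      extend τ m a s h1 h3 (hs a (Finset.mem_insert_self a F)), by simp [h2],
      fun i hi => if_neg (by omega), fun u hu => ?_⟩
    rcases Finset.mem_insert.1 hu with rfl | hu
    · exact ⟨m, m.le_succ, by simp [h3 m le_rfl]⟩
    · obtain ⟨i, hi, rfl⟩ := h4 u hu
      exact ⟨i, by omega, if_pos hi⟩

/-- Finitely many past times suffice. They are placed, with s and t, on one monotone sequence
starting at 0; past values are then partial sums of increments, independent of the last one. -/
theorem indepFun_past_incr [IsProbabilityMeasure P] (hN : ∀ t, Measurable (N t))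
    (h0 : ∀ w, N 0 w = 0) (hmono : ∀ w, Monotone fun t => N t w) (hinc : HasIndepIncrements N P)
    {s t : ℝ≥0} (hst : s ≤ t) :
    IndepFun (fun w (u : Iic s) => N u w) (fun w => N t w - N s w) P := by
  refine IndepFun.process_indepFun (fun u => hN u) ((hN t).sub (hN s)) fun I => ?_
  obtain ⟨τ, m, h1, h2, h3, h4⟩ := exists_monotone_partition (I.image Subtype.val) s (by
    intro u hu
    obtain ⟨v, _, rfl⟩ := Finset.mem_image.1 hu
    exact v.2)
  set σ : ℕ → ℝ≥0 := fun i => if i ≤ m then τ i else t with hσ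
  have hσm : Monotone σ := fun i j hij => by
    simp only [hσ]
    split_ifs with hi hj hj
    · exact h1 hij
    · exact (h1 hi).trans ((h3 m le_rfl).le.trans hst)
    · omega
    · exact le_rfl
  have h5 := (hinc.nat hσm).indepFun_finset (Finset.range m) {m} (by simp)
    (fun i => (hN _).sub (hN _))
  choose! ι hι using h4
  have htel : ∀ i w, N (σ i) w = ∑ j ∈ Finset.range i, (N (σ (j + 1)) w - N (σ j) w) := by
    intro i w
    induction i with
    | zero => simp [hσ, h2, h0]
    | succ i ih =>
      rw [Finset.sum_range_succ, ← ih, add_tsub_cancel_of_le (hmono w (hσm i.le_succ))]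
  have h6 : IndepFun (fun w (u : I) => ∑ j : Finset.range m,
      if (j : ℕ) < ι u then N (σ (j + 1)) w - N (σ j) w else 0)
      (fun w => N (σ (m + 1)) w - N (σ m) w) P :=
    h5.comp (φ := fun (x : Finset.range m → ℕ) (u : I) =>
        ∑ j : Finset.range m, if (j : ℕ) < ι u then x j else 0)
      (ψ := fun x : ({m} : Finset ℕ) → ℕ => x ⟨m, by simp⟩)
      (measurable_pi_iff.2 fun u => Finset.measurable_sum _ fun j _ => by
        split_ifs
        · exact measurable_pi_apply _
        · exact measurable_const) (measurable_pi_apply (⟨m, by simp⟩ : ({m} : Finset ℕ)))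
  convert h6 using 1
  · ext w u
    have hu := hι u (Finset.mem_image_of_mem _ u.2)
    have hu2 : σ (ι u) = u := by simp [hσ, hu.1, hu.2]
    conv_lhs => rw [← hu2, htel]
    rw [Finset.sum_coe_sort (Finset.range m)
      (fun j => if j < ι u then N (σ (j + 1)) w - N (σ j) w else 0), ← Finset.sum_filter]
    refine Finset.sum_congr ?_ fun _ _ => rfl
    ext j
    simp only [Finset.mem_filter, Finset.mem_range]
    omega
  · ext w
    simp [hσ, h3 m le_rfl]

theorem isThermalClock_of_path [IsProbabilityMeasure P] (hT : 0 ≤ T) (r : ℝ≥0)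
    (hN : ∀ t, Measurable (N t)) (hpath : ∀ w, IsCountingPath fun t => N t w)
    (hinc : HasIndepIncrements N P)
    (hlaw : ∀ s t : ℝ≥0, s ≤ t → HasLaw (fun w => N t w - N s w) (poissonMeasure (t - s)) P)
    (hp : IsGaussianSeq P T p) (hind : IndepFun (fun w t => N t w) (fun w j => p j w) P) :
    IsThermalClock P r T (fun t => N (r * t)) p where
  measurable t := hN _
  measurable_seq := hp.measurable
  path w :=
    { zero := by simpa using (hpath w).zero
      mono := fun s t hst => (hpath w).mono (mul_le_mul_right hst r)
      right_cont := fun t => ((hpath w).right_cont (r * t)).comp (f := fun t => r * t)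
        (by fun_prop) fun s hs => mul_le_mul_right hs r }
  incr_law s t hst := by
    rw [mul_tsub]
    exact hlaw _ _ (mul_le_mul_right hst r)
  indep_past s t hst := by
    have h1 := indepFun_past_incr hN (fun w => (hpath w).zero) (fun w => (hpath w).mono) hinc
      (mul_le_mul_right hst r)
    have h2 : IndepFun (fun w (u : Iic s) => N (r * u) w)
        (fun w => N (r * t) w - N (r * s) w) P :=
      h1.comp (φ := fun (x : Iic (r * s) → ℕ) (u : Iic s) => x ⟨r * u, mul_le_mul_right u.2 r⟩)
        (ψ := fun x => x)
        (by fun_prop) measurable_id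
    refine indepFun_prodMk_left_of_indepFun (by fun_prop) ?_ (by fun_prop) ?_ h2
    · exact measurable_pi_iff.2 hp.measurable
    · exact hind.comp (φ := fun x : ℝ≥0 → ℕ => ((fun u : Iic s => x (r * u)), x (r * t) - x (r * s)))
        (ψ := fun x => x) (by fun_prop) measurable_id
  indep := hind.comp (φ := fun (x : ℝ≥0 → ℕ) (t : ℝ≥0) => x (r * t)) (ψ := fun x => x)
    (by fun_prop) measurable_id
  indep_seq m := by
    have h1 := hp.indep.indepFun_finset (Finset.range (m + 1)) {m + 1} (by simp) hp.measurable
    have h2 : IndepFun (fun w i => if i ≤ m then p i w else 0) (p (m + 1)) P :=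
      h1.comp (φ := fun (x : Finset.range (m + 1) → ℝ) (i : ℕ) =>
          if h : i ≤ m then x ⟨i, by simp; omega⟩ else 0)
        (ψ := fun x : ({m + 1} : Finset ℕ) → ℝ => x ⟨m + 1, by simp⟩)
        (measurable_pi_iff.2 fun i => by split_ifs <;> fun_prop)
        (by fun_prop)
    have hm : Measurable fun w i => if i ≤ m then p i w else 0 :=
      measurable_pi_iff.2 fun i => by
        by_cases h : i ≤ m <;> simp [h, hp.measurable]
    have h3 := indepFun_prodMk_left_of_indepFun (Y := fun w t => N (r * t) w) hm (by fun_prop)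
      (hp.measurable (m + 1)) ?_ h2
    · exact h3.comp (φ := Prod.swap) (ψ := fun x => x) measurable_swap measurable_id
    · exact (hind.comp (φ := fun (x : ℝ≥0 → ℕ) (t : ℝ≥0) => x (r * t))
        (ψ := fun x : ℕ → ℝ => ((fun i => if i ≤ m then x i else 0), x (m + 1))) (by fun_prop)
        (Measurable.prodMk (measurable_pi_iff.2 fun i => by
          split_ifs <;> fun_prop) (by fun_prop))).symm
  memLp j := by
    have h1 := memLp_id_gaussianReal (μ := 0) (v := T.toNNReal) 2
    rw [← (hp.law j).map_eq, memLp_map_measure_iff aestronglyMeasurable_id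
      (hp.measurable j).aemeasurable] at h1
    exact h1
  mean j := by
    rw [(hp.law j).integral_eq, integral_id_gaussianReal]
  second_moment j := by
    have h1 : Var[p j; P] = T := by
      rw [(hp.law j).variance_eq, variance_id_gaussianReal, Real.coe_toNNReal _ hT]
    rw [← h1, variance_of_integral_eq_zero (hp.measurable j).aemeasurable]
    rw [(hp.law j).integral_eq, integral_id_gaussianReal]

/-- After modification on a null set, the paths of a Poisson process are counting paths. -/
theorem exists_isThermalClock [IsProbabilityMeasure P] (hT : 0 ≤ T) (r : ℝ≥0)
    (hN : IsPoissonProcess P N) (hp : IsGaussianSeq P T p)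
    (hind : IndepFun (fun w t => N t w) (fun w j => p j w) P) :
    ∃ n : ℝ≥0 → Ω → ℕ, IsThermalClock P r T n p ∧ ∀ᵐ w ∂P, ∀ t, n t w = N (r * t) w := by
  classical
  obtain ⟨G, hG, hGm, hG1⟩ := hN.paths.exists_measurable_mem
  set N' : ℝ≥0 → Ω → ℕ := fun t w => if w ∈ G then N t w else 0 with hN'
  have hae : ∀ᵐ w ∂P, ∀ t, N' t w = N t w := by
    filter_upwards [hG] with w hw t
    simp [hN', hw]
  refine ⟨fun t => N' (r * t), isThermalClock_of_path hT r
    (fun t => Measurable.ite hGm (hN.measurable t) measurable_const) (fun w => ?_) ?_ ?_ hp ?_,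
    hae.mono fun w hw t => hw _⟩
  · by_cases hw : w ∈ G
    · obtain ⟨h1, h2, h3⟩ := hG1 w hw
      simp only [hN', hw, if_true]
      exact ⟨h1, h2, h3⟩
    · simp only [hN', hw, if_false]
      exact ⟨rfl, monotone_const, fun t => continuousWithinAt_const⟩
  · intro m t ht
    refine (hN.indep m t ht).congr fun i => ?_
    filter_upwards [hae] with w hw
    rw [hw, hw]
  · intro s t hst
    refine (hN.law s t hst).congr ?_
    filter_upwards [hae] with w hw
    rw [hw, hw]
  · refine hind.congr ?_ (ae_eq_refl _)
    filter_upwards [hae] with w hw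
    exact funext fun t => (hw t).symm

end PoissonClock

/-! ### The Wigner function and its scaling limit -/

section EnergyTransport

variable {Ω : Type*} [MeasurableSpace Ω] {P : Measure Ω} {r : ℝ≥0} {T : ℝ} {n N : ℝ≥0 → Ω → ℕ}
  {p : ℕ → Ω → ℝ} {α : ℤ → ℝ} {γ μ : ℝ} {h : ℝ → ℝ} {ψ : ℝ≥0 → Ω → ℝ → ℂ}

theorem ae_eq_clockWave (hc : IsThermalClock P (γ * μ).toNNReal T n p) (hα : AdmissibleCoupling α)
    (hn : ∀ᵐ w ∂P, ∀ t, n t w = N ((γ * μ).toNNReal * t) w)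
    (hψ : IsWaveFunction P α γ μ N p (fun _ _ => 0) ψ) :
    ∀ᵐ w ∂P, ∀ t k, ψ t w k = clockWave α μ n p t w k := by
  filter_upwards [hn, hψ] with w hnw hw t k
  have h1 : clock N γ μ w = fun t => n t w := funext fun t => (hnw t).symm
  refine (hc.path w).wave_eq_shot hα (φ := fun t => ψ t w) (p := fun j => p j w)
    (fun t k => ((hw t).2 k).1) (fun t k => ?_) t k
  have h2 := ((hw t).2 k).2
  simp only [thermo, h1] at h2
  rw [h2]
  ring

theorem integrableOn_exp_mul_injection (hc : IsThermalClock P r T n p)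
    (hα : AdmissibleCoupling α) (hγ : 0 < γ) (hμ : 1 / 2 < μ) (hT : 0 ≤ T)
    (hr : (r : ℝ) = γ * μ) [IsProbabilityMeasure P] (hh : IsResponse α γ h) {z : ℂ}
    (hz : 0 < z.re) :
    IntegrableOn (fun t : ℝ => Complex.exp (-z * t) * (injection P α μ T n p t : ℂ)) (Ioi 0) := by
  obtain ⟨C, hC⟩ := exists_injection_le hc hα hγ hμ hT hr hh
  refine integrableOn_exp_neg_mul_of_bound hz (C := C)
    (Complex.measurable_ofReal.comp (measurable_injection hc hα)).aestronglyMeasurable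
    fun t ht => ?_
  have h0 := injection_nonneg (P := P) (α := α) (n := n) (p := p) hμ hT t
  have h1 := hC t ht.le
  rw [Complex.norm_real, Real.norm_of_nonneg h0]
  nlinarith [mul_nonneg (h0.trans h1) (mul_nonneg ht.le ht.le), mul_nonneg (h0.trans h1) ht.le]

theorem integrableOn_exp_mul_response_sq (hγ : 0 < γ) (hh : IsResponse α γ h) {z : ℂ}
    (hz : 0 < z.re) :
    IntegrableOn (fun t : ℝ => Complex.exp (-z * t) * ((h t ^ 2 : ℝ) : ℂ)) (Ioi 0) := by
  refine (integrableOn_sq_response hγ hh).1.mono' ?_ ?_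
  · exact (Continuous.mul (by fun_prop) (Complex.continuous_ofReal.comp
      (hh.continuous.pow 2))).aestronglyMeasurable
  · filter_upwards [ae_restrict_mem measurableSet_Ioi] with t ht
    rw [norm_mul, Complex.norm_real, Real.norm_of_nonneg (sq_nonneg _), Complex.norm_exp]
    refine mul_le_of_le_one_left (sq_nonneg _) (Real.exp_le_one_iff.2 ?_)
    simpa using mul_nonneg hz.le (le_of_lt ht)

theorem tendsto_laplace_response_sq (hγ : 0 < γ) (hh : IsResponse α γ h) {z : ℂ}
    (hz : 0 < z.re) :
    Tendsto (fun ε : ℝ => ∫ t in Ioi (0 : ℝ), Complex.exp (-(ε * z) * t) * ((h t ^ 2 : ℝ) : ℂ))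
      (𝓝[>] 0) (𝓝 ((∫ t in Ioi (0 : ℝ), h t ^ 2 : ℝ) : ℂ)) := by
  rw [← integral_complex_ofReal]
  refine tendsto_integral_filter_of_dominated_convergence (fun t => h t ^ 2) ?_ ?_
    (integrableOn_sq_response hγ hh).1 ?_
  · exact Eventually.of_forall fun ε => (Continuous.mul (by fun_prop)
      (Complex.continuous_ofReal.comp (hh.continuous.pow 2))).aestronglyMeasurable
  · filter_upwards [self_mem_nhdsWithin] with ε hε
    filter_upwards [ae_restrict_mem measurableSet_Ioi] with t ht
    rw [norm_mul, Complex.norm_real, Real.norm_of_nonneg (sq_nonneg _), Complex.norm_exp]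
    refine mul_le_of_le_one_left (sq_nonneg _) (Real.exp_le_one_iff.2 ?_)
    simpa using mul_nonneg (mul_nonneg (le_of_lt hε) hz.le) (le_of_lt ht)
  · refine Eventually.of_forall fun t => ?_
    have h1 : Continuous fun ε : ℝ => Complex.exp (-(ε * z) * t) * ((h t ^ 2 : ℝ) : ℂ) := by
      fun_prop
    simpa using (h1.tendsto 0).mono_left nhdsWithin_le_nhds

/-- The renewal equation after Laplace transformation, multiplied by z to clear the pole of the
constant term. -/
theorem laplace_injection (hc : IsThermalClock P r T n p)
    (hα : AdmissibleCoupling α) (hγ : 0 < γ) (hμ : 1 / 2 < μ) (hT : 0 ≤ T)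
    (hr : (r : ℝ) = γ * μ) [IsProbabilityMeasure P] (hh : IsResponse α γ h) {z : ℂ}
    (hz : 0 < z.re) :
    (z * ∫ t in Ioi (0 : ℝ), Complex.exp (-z * t) * (injection P α μ T n p t : ℂ)) *
      (1 - (γ / μ : ℝ) * ∫ t in Ioi (0 : ℝ), Complex.exp (-z * t) * ((h t ^ 2 : ℝ) : ℂ)) =
      ((2 - 1 / μ) * T : ℝ) := by
  have hA := integrableOn_exp_mul_injection hc hα hγ hμ hT hr hh hz
  have hz0 : z ≠ 0 := fun h0 => by simp [h0] at hz
  obtain ⟨h1, h2⟩ := laplace_convolution hA (integrableOn_exp_mul_response_sq hγ hh hz)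
  have h3 : ∀ t ∈ Ioi (0 : ℝ), Complex.exp (-z * t) * (injection P α μ T n p t : ℂ) =
      ((2 - 1 / μ) * T : ℝ) * Complex.exp (-z * t) + (γ / μ : ℝ) * (Complex.exp (-z * t) *
        ∫ s in (0 : ℝ)..t, (injection P α μ T n p s : ℂ) * ((h (t - s) ^ 2 : ℝ) : ℂ)) := by
    intro t ht
    have h4 : injection P α μ T n p t = (2 - 1 / μ) * T + γ / μ *
        ∫ s in (0 : ℝ)..t, injection P α μ T n p s * h (t - s) ^ 2 := by
      rw [injection, momentumVar_eq hc hα hγ hμ hr hh (le_of_lt ht)]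
      simp_rw [mul_comm (injection P α μ T n p _)]
      ring
    simp_rw [← Complex.ofReal_mul]
    rw [intervalIntegral.integral_ofReal]
    conv_lhs => rw [h4]
    push_cast
    ring
  have h5 : ∫ t in Ioi (0 : ℝ), Complex.exp (-z * t) * (injection P α μ T n p t : ℂ) =
      ((2 - 1 / μ) * T : ℝ) * (1 / z) + (γ / μ : ℝ) *
      ((∫ t in Ioi (0 : ℝ), Complex.exp (-z * t) * (injection P α μ T n p t : ℂ)) *
      ∫ t in Ioi (0 : ℝ), Complex.exp (-z * t) * ((h t ^ 2 : ℝ) : ℂ)) := by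
    conv_lhs => rw [setIntegral_congr_fun measurableSet_Ioi h3]
    rw [integral_add ((integrableOn_exp_neg_mul_Ioi hz).const_mul _) (h1.const_mul _),
      integral_const_mul, integral_const_mul, h2, integral_exp_neg_mul_Ioi hz, one_div z]
  have h6 := congrArg (z * ·) h5
  beta_reduce at h6
  rw [mul_add, mul_left_comm z _ (1 / z), mul_one_div_cancel hz0, mul_one] at h6
  linear_combination h6

/-- The Laplace transform of the injected energy has a pole with the stationary rate as residue. -/
theorem tendsto_laplace_injection (hc : IsThermalClock P r T n p)
    (hα : AdmissibleCoupling α) (hγ : 0 < γ) (hμ : 1 / 2 < μ) (hT : 0 ≤ T)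
    (hr : (r : ℝ) = γ * μ) [IsProbabilityMeasure P] (hh : IsResponse α γ h) {z : ℂ}
    (hz : 0 < z.re) :
    Tendsto (fun ε : ℝ => (ε : ℂ) * ∫ t in Ioi (0 : ℝ), Complex.exp (-(ε * z) * t) *
      (injection P α μ T n p t : ℂ)) (𝓝[>] 0)
      (𝓝 (((2 - 1 / μ) * T : ℝ) / ((1 - Gam α γ / μ : ℝ) * z))) := by
  have hμ0 : 0 < μ := by linarith
  have hz0 : z ≠ 0 := fun h0 => by simp [h0] at hz
  have h1 := (tendsto_laplace_response_sq hγ hh hz).const_mul ((γ / μ : ℝ) : ℂ)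
  have h2 : ((γ / μ : ℝ) : ℂ) * ((∫ t in Ioi (0 : ℝ), h t ^ 2 : ℝ) : ℂ) =
      ((Gam α γ / μ : ℝ) : ℂ) := by
    rw [(bdry_Jgt_sq hα hγ hh).2]
    push_cast
    ring
  rw [h2] at h1
  -- Γ ≤ 1/2 < μ: no resonance occurs, and the limit of the inverse exists.
  have h3 : (1 - ((Gam α γ / μ : ℝ) : ℂ)) ≠ 0 := by
    have h4 : Gam α γ / μ < 1 := by
      rw [div_lt_one hμ0]
      exact (Gam_mem hα hγ).2.trans_lt hμ
    rw [← Complex.ofReal_one, ← Complex.ofReal_sub, Complex.ofReal_ne_zero]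
    linarith
  have h5 := h1.const_sub 1
  have h6 := ((h5.inv₀ h3).const_mul (((2 - 1 / μ) * T : ℝ) : ℂ)).div_const z
  have h7 : ((2 - 1 / μ) * T : ℝ) / ((1 - Gam α γ / μ : ℝ) * z) =
      (((2 - 1 / μ) * T : ℝ) : ℂ) * (1 - ((Gam α γ / μ : ℝ) : ℂ))⁻¹ / z := by
    rw [Complex.ofReal_sub, Complex.ofReal_one, div_mul_eq_div_div, div_eq_mul_inv _ (1 - _ : ℂ)]
  rw [h7]
  refine h6.congr' ?_
  filter_upwards [h5.eventually_ne h3, self_mem_nhdsWithin] with ε hε hε0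
  have h8 := laplace_injection hc hα hγ hμ hT hr hh (z := ε * z) (by
    rw [Complex.re_ofReal_mul]
    exact mul_pos hε0 hz)
  rw [← h8, mul_inv_cancel_right₀ hε]
  field_simp

theorem fourierWigner_eq (hc : IsThermalClock P (γ * μ).toNNReal T n p)
    (hα : AdmissibleCoupling α) (hγ : 0 < γ) (hμ : 1 / 2 < μ) [IsProbabilityMeasure P]
    (hh : IsResponse α γ h) (hn : ∀ᵐ w ∂P, ∀ t, n t w = N ((γ * μ).toNNReal * t) w)
    (hψ : IsWaveFunction P α γ μ N p (fun _ _ => 0) ψ) {ε t : ℝ} (hε : 0 < ε) (ht : 0 ≤ t)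
    (η k : ℝ) :
    Integrable (wignerProd ψ ε t η k) P ∧
    fourierWigner P ψ ε t η k = γ * ε / 2 * ∫ s in (0 : ℝ)..(t / ε),
      (injection P α μ T n p s : ℂ) * (starRingEnd ℂ (resp α γ h (t / ε - s) (k - ε * η / 2)) *
        resp α γ h (t / ε - s) (k + ε * η / 2)) := by
  have hr : ((γ * μ).toNNReal : ℝ) = γ * μ := Real.coe_toNNReal _ (by nlinarith)
  have h1 := integral_conj_clockWave_mul hc hα hγ hμ hr hh (t / ε).toNNReal
    (k - ε * η / 2) (k + ε * η / 2)
  have h2 : wignerProd ψ ε t η k =ᵐ[P] fun w =>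
      starRingEnd ℂ (clockWave α μ n p (t / ε).toNNReal w (k - ε * η / 2)) *
        clockWave α μ n p (t / ε).toNNReal w (k + ε * η / 2) := by
    filter_upwards [ae_eq_clockWave hc hα hn hψ] with w hw
    rw [wignerProd, hw, hw]
  refine ⟨h1.1.congr h2.symm, ?_⟩
  rw [fourierWigner, integral_congr_ae h2, h1.2, Real.coe_toNNReal _ (div_nonneg ht hε.le)]
  simp_rw [mul_comm (injection P α μ T n p _ : ℂ)]
  ring

/-- The second moment of the wave is a convolution in microscopic time, so its transform factors.
The substitution t = εu replaces z by εz and adds a factor ε to the one in the Wigner function. -/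
theorem laplaceWigner_eq (hc : IsThermalClock P (γ * μ).toNNReal T n p)
    (hα : AdmissibleCoupling α) (hγ : 0 < γ) (hμ : 1 / 2 < μ) (hT : 0 ≤ T)
    [IsProbabilityMeasure P] (hh : IsResponse α γ h)
    (hn : ∀ᵐ w ∂P, ∀ t, n t w = N ((γ * μ).toNNReal * t) w)
    (hψ : IsWaveFunction P α γ μ N p (fun _ _ => 0) ψ) {ε : ℝ} (hε : 0 < ε) {z : ℂ}
    (hz : 0 < z.re) (η k : ℝ) :
    IntegrableOn (fun t : ℝ => Complex.exp (-z * t) * fourierWigner P ψ ε t η k) (Ioi 0) ∧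
    laplaceWigner P ψ ε z η k = γ / 2 *
      (ε * ∫ t in Ioi (0 : ℝ), Complex.exp (-(ε * z) * t) * (injection P α μ T n p t : ℂ)) *
      (ε * ∫ t in Ioi (0 : ℝ), Complex.exp (-(ε * z) * t) *
        (starRingEnd ℂ (resp α γ h t (k - ε * η / 2)) * resp α γ h t (k + ε * η / 2))) := by
  have hr : ((γ * μ).toNNReal : ℝ) = γ * μ := Real.coe_toNNReal _ (by nlinarith)
  have hεz : 0 < ((ε : ℂ) * z).re := by
    rw [Complex.re_ofReal_mul]
    exact mul_pos hε hz
  obtain ⟨h1, h2⟩ := laplace_convolution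
    (integrableOn_exp_mul_injection hc hα hγ hμ hT hr hh hεz)
    (integrableOn_exp_mul_conj_resp_mul hα hγ hh hεz (k - ε * η / 2) (k + ε * η / 2))
  set G : ℝ → ℂ := fun u => Complex.exp (-(ε * z) * u) * ∫ s in (0 : ℝ)..u,
    (injection P α μ T n p s : ℂ) * (starRingEnd ℂ (resp α γ h (u - s) (k - ε * η / 2)) *
      resp α γ h (u - s) (k + ε * η / 2)) with hG
  have h3 : ∀ t ∈ Ioi (0 : ℝ), Complex.exp (-z * t) * fourierWigner P ψ ε t η k =
      γ * ε / 2 * G (ε⁻¹ * t) := by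
    intro t ht
    have h4 : -((ε : ℂ) * z) * ((ε⁻¹ * t : ℝ) : ℂ) = -z * t := by
      have : (ε : ℂ) ≠ 0 := Complex.ofReal_ne_zero.2 hε.ne'
      push_cast
      field_simp
    rw [(fourierWigner_eq hc hα hγ hμ hh hn hψ hε (le_of_lt ht) η k).2, hG]
    beta_reduce
    rw [h4, inv_mul_eq_div]
    ring
  have h5 : IntegrableOn (fun t => G (ε⁻¹ * t)) (Ioi 0) := by
    rw [integrableOn_Ioi_comp_mul_left_iff G 0 (inv_pos.2 hε), mul_zero]
    exact h1
  refine ⟨(integrableOn_congr_fun h3 measurableSet_Ioi).2 (h5.const_mul _), ?_⟩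
  rw [laplaceWigner, setIntegral_congr_fun measurableSet_Ioi h3, integral_const_mul,
    integral_comp_mul_left_Ioi G 0 (inv_pos.2 hε), mul_zero, inv_inv, h2, Complex.real_smul]
  ring

end EnergyTransport

end HarmonicChain

end

/-! ### Assembly of the limit -/

open HarmonicChain in
theorem mainTheorem3 (α : ℤ → ℝ) (hα : AdmissibleCoupling α) (γ : ℝ) (hγ : 0 < γ) :
    ((∀ᵐ β : ℝ, HasBdry (Jgt α γ) β) ∧
      Integrable (fun β : ℝ => ‖bdry (Jgt α γ) β‖ ^ 2) ∧
      Gam α γ ∈ Ioc (0 : ℝ) (1 / 2)) ∧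
    (∀ k : ℝ, HasBdry (gt α γ) (disp α k)) ∧
    ∀ (Ω : Type*) [MeasurableSpace Ω] (P : Measure Ω) [IsProbabilityMeasure P]
      (μ T : ℝ) (N : ℝ≥0 → Ω → ℕ) (p : ℕ → Ω → ℝ) (ψ : ℝ≥0 → Ω → ℝ → ℂ),
      1 / 2 < μ → 0 < T → IsPoissonProcess P N → IsGaussianSeq P T p →
      IndepFun (fun w t => N t w) (fun w j => p j w) P →
      IsWaveFunction P α γ μ N p (fun _ _ => 0) ψ →
      ∀ (z : ℂ) (η k : ℝ), 0 < z.re →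
        (∀ ε : ℝ, 0 < ε →
          (∀ t : ℝ, 0 ≤ t → Integrable (wignerProd ψ ε t η k) P) ∧
          IntegrableOn (fun t : ℝ => Complex.exp (-z * t) * fourierWigner P ψ ε t η k)
            (Ioi 0)) ∧
        Tendsto (fun ε : ℝ => laplaceWigner P ψ ε z η k) (𝓝[>] 0)
          (𝓝 ((γ * T * ‖nu α γ k‖ ^ 2 : ℝ) * (1 - 1 / (2 * μ) : ℝ) /
            ((1 - Gam α γ / μ : ℝ) * z * (z + Complex.I * (dispDeriv α k * η : ℝ))))) := by
  obtain ⟨h, hh⟩ := exists_isResponse hα hγ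
  refine ⟨⟨Eventually.of_forall fun β => hasBdry_Jgt hα hγ β, (bdry_Jgt_sq hα hγ hh).1,
    Gam_mem hα hγ⟩, fun k => hasBdry_gt hα hγ _, ?_⟩
  intro Ω _ P _ μ T N p ψ hμ hT hN hp hind hψ z η k hz
  obtain ⟨n, hc, hn⟩ := exists_isThermalClock hT.le (γ * μ).toNNReal hN hp hind
  refine ⟨fun ε hε => ⟨fun t ht => (fourierWigner_eq hc hα hγ hμ hh hn hψ hε ht η k).1,
    (laplaceWigner_eq hc hα hγ hμ hT.le hh hn hψ hε hz η k).1⟩, ?_⟩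
  have hr : ((γ * μ).toNNReal : ℝ) = γ * μ := Real.coe_toNNReal _ (by nlinarith)
  have h1 := ((tendsto_laplace_injection hc hα hγ hμ hT.le hr hh hz).const_mul
    (γ / 2 : ℂ)).mul (tendsto_laplace_resp_mul hα hγ hh hz η k)
  -- The factor 1/2 of the Wigner function combines with the injection rate: (2 − 1/μ)/2 = 1 −
  -- 1/(2μ).
  have h2 : ((γ * T * ‖nu α γ k‖ ^ 2 : ℝ) * (1 - 1 / (2 * μ) : ℝ) /
      ((1 - Gam α γ / μ : ℝ) * z * (z + Complex.I * (dispDeriv α k * η : ℝ))) : ℂ) =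
      (γ / 2 : ℂ) * (((2 - 1 / μ) * T : ℝ) / ((1 - Gam α γ / μ : ℝ) * z)) *
        ((‖nu α γ k‖ ^ 2 : ℝ) / (z + Complex.I * (dispDeriv α k * η : ℝ))) := by
    generalize ((1 - Gam α γ / μ : ℝ) : ℂ) = D
    generalize z + Complex.I * ((dispDeriv α k * η : ℝ) : ℂ) = E
    push_cast
    ring
  rw [h2]
  refine h1.congr' ?_
  filter_upwards [self_mem_nhdsWithin] with ε hε
  exact (laplaceWigner_eq hc hα hγ hμ hT.le hh hn hψ hε hz η k).2.symm
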